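/- Theorem. Consider the single source replacement path problem (SSRP): given an undirected, unweighted simple graph $G=(V,E)$ with $n=|V|$ vertices and $m=|E|$ edges, given as a list of its edges, and a source $s\in V$, output a shortest path tree $T$ of $s$ and, for every vertex $t$ reachable from $s$ and every edge $e$ on the $s$–$t$ path of $T$, the length $|st\diamond e|$ of a shortest path from $s$ to $t$ in $G$ that avoids $e$ (which is $\infty$ if there is no such path). There is a randomized algorithm that solves SSRP in $\tilde O(m\sqrt n+n^2)$ time with high probability. Precisely: for every $c\in\mathbb N$ there are a program for the word RAM with words of $O(\log n)$ bits and access to independent fair coin flips, and constants $C,k$, such that for every such graph $G$ with $n\ge 1$ vertices and $m$ edges, every listing of its edges, and every source $s$, the program always halts within $C\,(m\sqrt n+n^2)\,(1+\log n)^k$ steps, and with probability at least $1-n^{-c}$ all of its output is correct. -/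

import Mathlib

/-! ### A randomized word RAM

Programs are structured programs over finitely many registers and finitely many arrays
(registers and arrays are named by numerals fixed in the program).  All values are words of
`w` bits.  Every evaluation of a node of an expression and every executed command costs one
step.  Random bits are read one at a time from a sequence `ω : ℕ → Bool`. -/

namespace RAM

/-- The binary word operations; subtraction is truncated at `0`, `x / 0 = 0`, `x % 0 = x`,
and the comparisons return `1` or `0`.  Results are reduced modulo `2 ^ w` in `Expr.eval`. -/
inductive Op
  | add | sub | mul | div | mod | lt | eq

def Op.eval : Op → ℕ → ℕ → ℕ
  | .add, x, y => x + y
  | .sub, x, y => x - y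
  | .mul, x, y => x * y
  | .div, x, y => x / y
  | .mod, x, y => x % y
  | .lt, x, y => if x < y then 1 else 0
  | .eq, x, y => if x = y then 1 else 0

/-- Expressions: literals, registers, array look-ups, binary operations. -/
inductive Expr
  | lit (k : ℕ)
  | reg (x : ℕ)
  | get (a : ℕ) (i : Expr)
  | bin (o : Op) (e f : Expr)

/-- Commands: `assign x e` is `x := e`, `put a i e` is `a[i] := e`, and `flip x` stores the next
random bit in register `x`; a condition holds if its value is nonzero. -/
inductive Cmd
  | skip
  | assign (x : ℕ) (e : Expr)
  | put (a : ℕ) (i e : Expr)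
  | flip (x : ℕ)
  | seq (p q : Cmd)
  | ite (b : Expr) (p q : Cmd)
  | loop (b : Expr) (p : Cmd)

/-- A state: the registers, the arrays, and the number of random bits already read. -/
structure State where
  reg : ℕ → ℕ
  mem : ℕ → ℕ → ℕ
  pos : ℕ

/-- The value of an expression on a machine with words of `w` bits. -/
def Expr.eval (w : ℕ) (σ : State) : Expr → ℕ
  | .lit k => k % 2 ^ w
  | .reg x => σ.reg x
  | .get a i => σ.mem a (i.eval w σ)
  | .bin o e f => o.eval (e.eval w σ) (f.eval w σ) % 2 ^ w

/-- The number of steps needed to evaluate an expression. -/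
def Expr.cost : Expr → ℕ
  | .lit _ => 1
  | .reg _ => 1
  | .get _ i => i.cost + 1
  | .bin _ e f => e.cost + f.cost + 1

def State.setReg (σ : State) (x v : ℕ) : State :=
  { σ with reg := Function.update σ.reg x v }

def State.setMem (σ : State) (a i v : ℕ) : State :=
  { σ with mem := Function.update σ.mem a (Function.update (σ.mem a) i v) }

/-- `Exec w ω p σ t τ`: with words of `w` bits and random bits `ω`, the program `p` started in
state `σ` halts after exactly `t` steps in state `τ`. -/
inductive Exec (w : ℕ) (ω : ℕ → Bool) : Cmd → State → ℕ → State → Prop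
  | skip (σ : State) : Exec w ω .skip σ 1 σ
  | assign (σ : State) (x : ℕ) (e : Expr) :
      Exec w ω (.assign x e) σ (e.cost + 1) (σ.setReg x (e.eval w σ))
  | put (σ : State) (a : ℕ) (i e : Expr) :
      Exec w ω (.put a i e) σ (i.cost + e.cost + 1) (σ.setMem a (i.eval w σ) (e.eval w σ))
  | flip (σ : State) (x : ℕ) :
      Exec w ω (.flip x) σ 1
        { σ.setReg x (if ω σ.pos then 1 else 0) with pos := σ.pos + 1 }
  | seq {p q : Cmd} {σ τ υ : State} {t₁ t₂ : ℕ} :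
      Exec w ω p σ t₁ τ → Exec w ω q τ t₂ υ → Exec w ω (.seq p q) σ (t₁ + t₂ + 1) υ
  | iteTrue {b : Expr} {p q : Cmd} {σ τ : State} {t : ℕ} :
      b.eval w σ ≠ 0 → Exec w ω p σ t τ → Exec w ω (.ite b p q) σ (b.cost + t + 1) τ
  | iteFalse {b : Expr} {p q : Cmd} {σ τ : State} {t : ℕ} :
      b.eval w σ = 0 → Exec w ω q σ t τ → Exec w ω (.ite b p q) σ (b.cost + t + 1) τ
  | loopTrue {b : Expr} {p : Cmd} {σ τ υ : State} {t₁ t₂ : ℕ} :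
      b.eval w σ ≠ 0 → Exec w ω p σ t₁ τ → Exec w ω (.loop b p) τ t₂ υ →
        Exec w ω (.loop b p) σ (b.cost + t₁ + t₂ + 1) υ
  | loopFalse {b : Expr} {p : Cmd} {σ : State} :
      b.eval w σ = 0 → Exec w ω (.loop b p) σ (b.cost + 1) σ

/-- The law of a sequence of independent fair coin flips. -/
noncomputable def coins : MeasureTheory.Measure (ℕ → Bool) :=
  MeasureTheory.Measure.infinitePi fun _ : ℕ => (PMF.uniformOfFintype Bool).toMeasure

end RAM

/-! ### Single source replacement paths -/

namespace SSRP

/-- `u 0 v 0, …, u (m-1) v (m-1)` lists every edge of `G` exactly once, in any order and with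
any orientation; in particular `G` has exactly `m` edges. -/
def ListsEdges {n m : ℕ} (G : SimpleGraph (Fin n)) (u v : Fin m → Fin n) : Prop :=
  Function.Injective (fun j => s(u j, v j)) ∧ Set.range (fun j => s(u j, v j)) = G.edgeSet

/-- The input: registers `0, 1, 2` hold `n`, `m` and the source, arrays `0` and `1` hold the two
endpoints of the `m` edges, and everything else is `0`. -/
def input {n m : ℕ} (u v : Fin m → Fin n) (src : Fin n) : RAM.State where
  reg x := if x = 0 then n else if x = 1 then m else if x = 2 then (src : ℕ) else 0
  mem a j :=
    if h : j < m then
      if a = 0 then (u ⟨j, h⟩ : ℕ) else if a = 1 then (v ⟨j, h⟩ : ℕ) else 0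
    else 0
  pos := 0

/-- `|st ⋄ e|`: the length of a shortest path from `x` to `y` in `G` that avoids the edge `e`,
which is `⊤` if there is none. -/
noncomputable def replacementLength {n : ℕ} (G : SimpleGraph (Fin n)) (x y : Fin n)
    (e : Sym2 (Fin n)) : ℕ∞ :=
  (G.deleteEdges {e}).edist x y

/-- Lengths are output as words; since finite distances are less than `n`, infinity is output
as `n`. -/
noncomputable def code (n : ℕ) (d : ℕ∞) : ℕ :=
  if d = ⊤ then n else d.toNat

/-- The arrays `par` and `len` solve the single source replacement path problem for `(G, src)`:
`par` is the parent array of a shortest path tree of `src` (with entry `n` at the root and at the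
unreachable vertices), and for each reachable `t` and each `i`, the entry `len[t * n + i]` is the
length of a shortest path from `src` to `t` avoiding the `i`-th edge of the tree path from `src`
to `t`. -/
def Solves {n : ℕ} (G : SimpleGraph (Fin n)) (src : Fin n) (par len : ℕ → ℕ) : Prop :=
  (∀ t : Fin n, t = src ∨ ¬ G.Reachable src t → par t = n) ∧
  ∀ t : Fin n, G.Reachable src t → ∃ P : G.Walk src t, P.length = G.dist src t ∧
    ∀ i < P.length,
      par (P.getVert (i + 1)) = (P.getVert i : ℕ) ∧
      len (t * n + i) =
        code n (replacementLength G src t s(P.getVert i, P.getVert (i + 1)))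

end SSRP

/-!
The program is deterministic, so its output is correct with probability one. Let `T` be a
breadth-first tree of the source `s`. For a vertex `q ≠ s` let `g t` be the distance from `s` to `t`
in the graph without the edge from `q` to its parent `p`; only the values at the `t` in the subtree
of `q` are asked for, since `g` is the depth elsewhere (`IsTree.repl_eq_dep`).

Let `K = ⌈√n⌉`. Some residue class `a` modulo `K` contains the depths of at most `n / K` reachable
vertices (`mul_landmarks_le`); these vertices are the landmarks. They fill whole levels of the tree,
and consecutive levels of landmarks are `K` apart.

*Landmarks.* A replacement path to a landmark `r` in the subtree of `q` runs along `T` to a vertex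
`x` outside of the subtree, takes an edge `x y` into the subtree, and goes on to `r` along any
shortest path of the graph: a shortest path between two vertices of the subtree of `q` does not need
the edge `p q` (`IsTree.repl_le_add`). Hence `g r` is the minimum of `dep x + 1 + d(y, r)` over these
edges (`IsTree.repl_le_cross`, `IsTree.exists_cross`). Whether `x y` is such an edge only depends on
the depth of `q` and on the depths of the lowest common ancestors of `x` and `r` and of `y` and `r`.
So one search from `r` and one table with `(K + 1)²` entries yield `g r` for the last `K` edges on
the tree path to `r` (`IsTree.table_min`), in time `O(n + m + K³)`.

*Other vertices.* For an edge `p q` let `l < dep q + K` be the first level of landmarks at or below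
`q`. At depth `l` and more, the replacement path to `t` visits level `l` for a last time at some `r`,
so that `g t` is the minimum of `g r + d(r, t)`, where `d` is the distance within the depths from `l`
on; it does not depend on `q`, and comes from a second search from each landmark
(`IsTree.level_min`). At depth less than `l`, the values of `g` solve Bellman's equations in the
upper part of the subtree of `q`, with initial values from the known `g` at the neighbours of this
part (`IsTree.repl_near`), so that a breadth-first search with delayed starts finds them.

*Time.* The searches from the landmarks take `O((n / K) (n + m + K³)) = O(m √n + n²)` steps. For a
target `t` the levels of its ancestors `q` are searched for a best `r`; each level is the first one
below at most `K` depths, so that this amounts to at most `K` times the number of landmarks, that is,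
`O(n)` steps for each `t` (`sum_level_le`). Finally, `t` lies above the level `l` for at most `K` of
its ancestors, so that each edge takes part in `O(K)` of the last searches (`IsTree.sum_near`).

Distances are characterized by Bellman's equations, capped at `n` (`Bell`), for which uniqueness is
an induction on values; paths only occur where they are compared with `SimpleGraph.edist`. Programs
are verified by symbolic execution (`Run`, `RunT`) with loop invariants; a `Frame` lists the arrays
and registers that a program may change.
-/

namespace RAM

variable {w : ℕ} {ω : ℕ → Bool}

/-! ### Running times and final states of programs -/

instance : Add Expr := ⟨.bin .add⟩
instance : Sub Expr := ⟨.bin .sub⟩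
instance : Mul Expr := ⟨.bin .mul⟩
instance : Mod Expr := ⟨.bin .mod⟩

/-- The test `e < f`. -/
def Expr.less (e f : Expr) : Expr := .bin .lt e f

/-- The test `e = f`. -/
def Expr.same (e f : Expr) : Expr := .bin .eq e f

/-- `Run w ω c σ Q`: the command `c` started in `σ` halts, and the running time and the final state
satisfy `Q`. -/
def Run (w : ℕ) (ω : ℕ → Bool) (c : Cmd) (σ : State) (Q : ℕ → State → Prop) : Prop :=
  ∃ t τ, Exec w ω c σ t τ ∧ Q t τ

/-- `RunT w ω c σ T Q`: the command `c` started in `σ` halts within `T` steps in a state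
satisfying `Q`. -/
def RunT (w : ℕ) (ω : ℕ → Bool) (c : Cmd) (σ : State) (T : ℕ) (Q : State → Prop) : Prop :=
  Run w ω c σ fun t τ => t ≤ T ∧ Q τ

theorem Run.mono {c : Cmd} {σ : State} {Q Q' : ℕ → State → Prop} (h : Run w ω c σ Q)
    (hQ : ∀ t τ, Q t τ → Q' t τ) : Run w ω c σ Q' := by
  obtain ⟨t, τ, h1, h2⟩ := h
  exact ⟨t, τ, h1, hQ t τ h2⟩

theorem RunT.run {c : Cmd} {σ : State} {T : ℕ} {Q : State → Prop} {Q' : ℕ → State → Prop}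
    (h : RunT w ω c σ T Q) (hQ : ∀ t τ, t ≤ T → Q τ → Q' t τ) : Run w ω c σ Q' :=
  Run.mono h fun t τ h => hQ t τ h.1 h.2

theorem RunT.mono {c : Cmd} {σ : State} {T T' : ℕ} {Q Q' : State → Prop}
    (h : RunT w ω c σ T Q) (hT : T ≤ T') (hQ : ∀ τ, Q τ → Q' τ) : RunT w ω c σ T' Q' :=
  h.run fun _ _ h1 h2 => ⟨h1.trans hT, hQ _ h2⟩

@[simp] theorem run_skip {σ : State} {Q : ℕ → State → Prop} :
    Run w ω .skip σ Q ↔ Q 1 σ := by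
  constructor
  · rintro ⟨t, τ, h, hQ⟩
    cases h
    exact hQ
  · exact fun h => ⟨_, _, .skip _, h⟩

@[simp] theorem run_assign {σ : State} {x : ℕ} {e : Expr} {Q : ℕ → State → Prop} :
    Run w ω (.assign x e) σ Q ↔ Q (e.cost + 1) (σ.setReg x (e.eval w σ)) := by
  constructor
  · rintro ⟨t, τ, h, hQ⟩
    cases h
    exact hQ
  · exact fun h => ⟨_, _, .assign _ _ _, h⟩

@[simp] theorem run_put {σ : State} {a : ℕ} {i e : Expr} {Q : ℕ → State → Prop} :
    Run w ω (.put a i e) σ Q ↔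
      Q (i.cost + e.cost + 1) (σ.setMem a (i.eval w σ) (e.eval w σ)) := by
  constructor
  · rintro ⟨t, τ, h, hQ⟩
    cases h
    exact hQ
  · exact fun h => ⟨_, _, .put _ _ _ _, h⟩

@[simp] theorem run_seq {σ : State} {p q : Cmd} {Q : ℕ → State → Prop} :
    Run w ω (.seq p q) σ Q ↔
      Run w ω p σ fun t₁ τ => Run w ω q τ fun t₂ υ => Q (t₁ + t₂ + 1) υ := by
  constructor
  · rintro ⟨t, τ, h, hQ⟩
    cases h with
    | seq h1 h2 => exact ⟨_, _, h1, _, _, h2, hQ⟩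
  · rintro ⟨_, _, h1, _, _, h2, hQ⟩
    exact ⟨_, _, .seq h1 h2, hQ⟩

@[simp] theorem run_ite {σ : State} {b : Expr} {p q : Cmd} {Q : ℕ → State → Prop} :
    Run w ω (.ite b p q) σ Q ↔
      (b.eval w σ ≠ 0 → Run w ω p σ fun t τ => Q (b.cost + t + 1) τ) ∧
      (b.eval w σ = 0 → Run w ω q σ fun t τ => Q (b.cost + t + 1) τ) := by
  constructor
  · rintro ⟨t, τ, h, hQ⟩
    cases h with
    | iteTrue hb h => exact ⟨fun _ => ⟨_, _, h, hQ⟩, fun h => (hb h).elim⟩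
    | iteFalse hb h => exact ⟨fun h => (h hb).elim, fun _ => ⟨_, _, h, hQ⟩⟩
  · rintro ⟨h1, h2⟩
    by_cases hb : b.eval w σ = 0
    · obtain ⟨t, τ, h, hQ⟩ := h2 hb
      exact ⟨_, _, .iteFalse hb h, hQ⟩
    · obtain ⟨t, τ, h, hQ⟩ := h1 hb
      exact ⟨_, _, .iteTrue hb h, hQ⟩

/-- The time bound `T` is a separate variable, so that it can be given in closed form. -/
theorem RunT.seq {σ : State} {p q : Cmd} {T T₁ T₂ : ℕ} {P Q : State → Prop}
    (hp : RunT w ω p σ T₁ P) (hq : ∀ τ, P τ → RunT w ω q τ T₂ Q) (hT : T₁ + T₂ + 1 ≤ T) :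
    RunT w ω (.seq p q) σ T Q := by
  rw [RunT, run_seq]
  exact hp.run fun t₁ τ h₁ hP => (hq τ hP).run fun t₂ υ h₂ hQ => ⟨by omega, hQ⟩

/-! ### Evaluation of expressions and states -/

@[simp] theorem eval_lit_zero {σ : State} : (Expr.lit 0).eval w σ = 0 := by simp [Expr.eval]

@[simp] theorem eval_lit_one [NeZero w] {σ : State} : (Expr.lit 1).eval w σ = 1 :=
  Nat.mod_eq_of_lt (Nat.one_lt_two_pow (NeZero.ne w))

@[simp] theorem eval_reg {σ : State} {x : ℕ} : (Expr.reg x).eval w σ = σ.reg x := rfl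

@[simp] theorem eval_get {σ : State} {a : ℕ} {i : Expr} :
    (Expr.get a i).eval w σ = σ.mem a (i.eval w σ) := rfl

@[simp] theorem eval_add {σ : State} {e f : Expr} :
    (e + f).eval w σ = (e.eval w σ + f.eval w σ) % 2 ^ w := rfl

@[simp] theorem eval_sub {σ : State} {e f : Expr} :
    (e - f).eval w σ = (e.eval w σ - f.eval w σ) % 2 ^ w := rfl

@[simp] theorem eval_mul {σ : State} {e f : Expr} :
    (e * f).eval w σ = (e.eval w σ * f.eval w σ) % 2 ^ w := rfl

@[simp] theorem eval_mod {σ : State} {e f : Expr} :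
    (e % f).eval w σ = (e.eval w σ % f.eval w σ) % 2 ^ w := rfl

@[simp] theorem eval_less_eq_zero [NeZero w] {σ : State} {e f : Expr} :
    (e.less f).eval w σ = 0 ↔ f.eval w σ ≤ e.eval w σ := by
  have h : 1 % 2 ^ w = 1 := Nat.mod_eq_of_lt (Nat.one_lt_two_pow (NeZero.ne w))
  simp only [Expr.less, Expr.eval, Op.eval]
  split_ifs with h1 <;> simp [h] <;> omega

@[simp] theorem eval_same_eq_zero [NeZero w] {σ : State} {e f : Expr} :
    (e.same f).eval w σ = 0 ↔ e.eval w σ ≠ f.eval w σ := by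
  have h : 1 % 2 ^ w = 1 := Nat.mod_eq_of_lt (Nat.one_lt_two_pow (NeZero.ne w))
  simp only [Expr.same, Expr.eval, Op.eval]
  split_ifs with h1 <;> simp [h, h1]

@[simp] theorem cost_lit {k : ℕ} : (Expr.lit k).cost = 1 := rfl
@[simp] theorem cost_reg {x : ℕ} : (Expr.reg x).cost = 1 := rfl
@[simp] theorem cost_get {a : ℕ} {i : Expr} : (Expr.get a i).cost = i.cost + 1 := rfl
@[simp] theorem cost_add {e f : Expr} : (e + f).cost = e.cost + f.cost + 1 := rfl
@[simp] theorem cost_sub {e f : Expr} : (e - f).cost = e.cost + f.cost + 1 := rfl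
@[simp] theorem cost_mul {e f : Expr} : (e * f).cost = e.cost + f.cost + 1 := rfl
@[simp] theorem cost_mod {e f : Expr} : (e % f).cost = e.cost + f.cost + 1 := rfl
@[simp] theorem cost_less {e f : Expr} : (e.less f).cost = e.cost + f.cost + 1 := rfl
@[simp] theorem cost_same {e f : Expr} : (e.same f).cost = e.cost + f.cost + 1 := rfl

@[simp] theorem setReg_reg {σ : State} {x v y : ℕ} :
    (σ.setReg x v).reg y = if y = x then v else σ.reg y := by
  simp [State.setReg, Function.update_apply]

@[simp] theorem setReg_mem {σ : State} {x v : ℕ} : (σ.setReg x v).mem = σ.mem := rfl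

@[simp] theorem setMem_reg {σ : State} {a i v : ℕ} : (σ.setMem a i v).reg = σ.reg := rfl

@[simp] theorem setMem_mem {σ : State} {a i v b : ℕ} :
    (σ.setMem a i v).mem b = if b = a then Function.update (σ.mem a) i v else σ.mem b := by
  simp [State.setMem, Function.update_apply]

/-- `Frame M r σ τ`: the states `σ` and `τ` agree on all arrays outside `M` and on all registers
below `r`. -/
def Frame (M : List ℕ) (r : ℕ) (σ τ : State) : Prop :=
  (∀ a, a ∉ M → τ.mem a = σ.mem a) ∧ ∀ x < r, τ.reg x = σ.reg x

@[simp] theorem Frame.refl {M : List ℕ} {r : ℕ} {σ : State} : Frame M r σ σ :=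
  ⟨fun _ _ => rfl, fun _ _ => rfl⟩

theorem Frame.trans {M : List ℕ} {r : ℕ} {σ τ υ : State} (h : Frame M r σ τ)
    (h' : Frame M r τ υ) : Frame M r σ υ :=
  ⟨fun a ha => (h'.1 a ha).trans (h.1 a ha), fun x hx => (h'.2 x hx).trans (h.2 x hx)⟩

theorem Frame.weaken {M M' : List ℕ} {r r' : ℕ} {σ τ : State} (h : Frame M r σ τ)
    (hM : M ⊆ M') (hr : r' ≤ r) : Frame M' r' σ τ :=
  ⟨fun a ha => h.1 a fun h' => ha (hM h'), fun x hx => h.2 x (by omega)⟩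

@[simp] theorem frame_setReg {M : List ℕ} {r : ℕ} {σ τ : State} {x v : ℕ} (hx : r ≤ x) :
    Frame M r σ (τ.setReg x v) ↔ Frame M r σ τ := by
  refine and_congr Iff.rfl (forall₂_congr fun y hy => ?_)
  rw [setReg_reg, if_neg (by omega)]

@[simp] theorem frame_setMem {M : List ℕ} {r : ℕ} {σ τ : State} {a i v : ℕ} (ha : a ∈ M) :
    Frame M r σ (τ.setMem a i v) ↔ Frame M r σ τ := by
  refine and_congr (forall₂_congr fun b hb => ?_) Iff.rfl
  rw [setMem_mem, if_neg (by rintro rfl; exact hb ha)]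

theorem Frame.of_setReg {M : List ℕ} {r : ℕ} {σ τ : State} {x v : ℕ} (hx : r ≤ x)
    (h : Frame M r (σ.setReg x v) τ) : Frame M r σ τ :=
  ⟨h.1, fun y hy => by rw [h.2 y hy, setReg_reg, if_neg (by omega)]⟩

/-! ### Counting loops -/

/-- Run `p` while the counter `x` is below `e`, increasing the counter after each round. -/
def upTo (x : ℕ) (e : Expr) (p : Cmd) : Cmd :=
  .loop ((Expr.reg x).less e) (.seq p (.assign x (.reg x + .lit 1)))

/-- Run `p` for all values `0 ≤ x < e` of the counter `x`. -/
def forTo (x : ℕ) (e : Expr) (p : Cmd) : Cmd :=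
  .seq (.assign x (.lit 0)) (upTo x e p)

/-- The invariant `I i t τ` may refer to the value `i` of the counter and to the time `t` spent so
far, which allows amortized time bounds. -/
theorem Run.upTo [NeZero w] {x : ℕ} {e : Expr} {p : Cmd} {a N : ℕ} {σ : State}
    {Q : ℕ → State → Prop} (I : ℕ → ℕ → State → Prop) (hN : N < 2 ^ w) (ha : a ≤ N)
    (h0 : I a 0 σ) (hx : ∀ i t τ, i ≤ N → I i t τ → τ.reg x = i ∧ e.eval w τ = N)
    (hs : ∀ i t τ, a ≤ i → i < N → I i t τ → Run w ω p τ fun t' υ =>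
      υ.reg x = i ∧ I (i + 1) (t + t' + e.cost + 8) (υ.setReg x (i + 1)))
    (hQ : ∀ t τ, I N t τ → Q (t + e.cost + 3) τ) : Run w ω (upTo x e p) σ Q := by
  suffices H : ∀ k i t τ, a ≤ i → i + k = N → I i t τ →
      Run w ω (RAM.upTo x e p) τ fun t' υ => Q (t + t') υ by
    simpa using H (N - a) a 0 σ le_rfl (by omega) h0
  intro k
  induction k with
  | zero =>
    intro i t τ _ hi hI
    obtain rfl : i = N := by omega
    obtain ⟨h1, h2⟩ := hx i t τ le_rfl hI
    refine ⟨_, _, .loopFalse (by simp [h1, h2]), ?_⟩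
    convert hQ t τ hI using 1
    simp
    omega
  | succ k ih =>
    intro i t τ hai hi hI
    obtain ⟨h1, h2⟩ := hx i t τ (by omega) hI
    obtain ⟨t', υ, hp, h3, h4⟩ := hs i t τ hai (by omega) hI
    obtain ⟨t'', υ', hl, h5⟩ := ih (i + 1) _ _ (by omega) (by omega) h4
    have hassign : (Expr.reg x + Expr.lit 1).eval w υ = i + 1 := by
      simp [h3, Nat.mod_eq_of_lt (show i + 1 < 2 ^ w by omega)]
    have h6 := Exec.assign (w := w) (ω := ω) υ x (Expr.reg x + Expr.lit 1)
    rw [hassign] at h6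
    refine ⟨_, _, .loopTrue (by simp [h1, h2]; omega) (.seq hp h6) hl, ?_⟩
    convert h5 using 1
    simp
    omega

/-- The `i`-th round takes at most `B i` steps. -/
theorem RunT.upTo_sum [NeZero w] {x : ℕ} {e : Expr} {p : Cmd} {a N T : ℕ} {σ : State}
    {Q : State → Prop} (I : ℕ → State → Prop) (B : ℕ → ℕ) (hN : N < 2 ^ w) (ha : a ≤ N)
    (h0 : I a σ) (hx : ∀ i τ, i ≤ N → I i τ → τ.reg x = i ∧ e.eval w τ = N)
    (hs : ∀ i τ, a ≤ i → i < N → I i τ → RunT w ω p τ (B i) fun υ =>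
      υ.reg x = i ∧ I (i + 1) (υ.setReg x (i + 1)))
    (hQ : ∀ τ, I N τ → Q τ)
    (hT : ∑ i ∈ Finset.Ico a N, (B i + e.cost + 8) + e.cost + 3 ≤ T) :
    RunT w ω (RAM.upTo x e p) σ T Q := by
  refine Run.upTo (a := a) (N := N)
    (fun i t τ => I i τ ∧ t ≤ ∑ j ∈ Finset.Ico a i, (B j + e.cost + 8)) hN ha ⟨h0, by simp⟩
    (fun i t τ hi hI => hx i τ hi hI.1) (fun i t τ hai hi hI => ?_) fun t τ hI => ?_
  · refine (hs i τ hai hi hI.1).run fun t' υ ht' hυ => ⟨hυ.1, hυ.2, ?_⟩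
    rw [Finset.sum_Ico_succ_top hai]
    have := hI.2
    omega
  · have := hI.2
    exact ⟨by omega, hQ _ hI.1⟩

theorem RunT.forTo_sum [NeZero w] {x : ℕ} {e : Expr} {p : Cmd} {N T : ℕ} {σ : State}
    {Q : State → Prop} (I : ℕ → State → Prop) (B : ℕ → ℕ) (hN : N < 2 ^ w)
    (h0 : I 0 (σ.setReg x 0)) (hx : ∀ i τ, i ≤ N → I i τ → τ.reg x = i ∧ e.eval w τ = N)
    (hs : ∀ i τ, i < N → I i τ → RunT w ω p τ (B i) fun υ =>
      υ.reg x = i ∧ I (i + 1) (υ.setReg x (i + 1)))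
    (hQ : ∀ τ, I N τ → Q τ)
    (hT : ∑ i ∈ Finset.range N, (B i + e.cost + 8) + e.cost + 6 ≤ T) :
    RunT w ω (forTo x e p) σ T Q := by
  refine RunT.seq (T₁ := 2) (T₂ := T - 3) (P := fun τ => τ = σ.setReg x 0) ?_ ?_ (by omega)
  · simp [RunT]
  · rintro _ rfl
    refine RunT.upTo_sum I B hN (Nat.zero_le _) h0 hx (fun i τ _ => hs i τ) hQ ?_
    rw [← Finset.range_eq_Ico]
    omega

theorem RunT.forTo [NeZero w] {x : ℕ} {e : Expr} {p : Cmd} {N T : ℕ} {σ : State}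
    {Q : State → Prop} (I : ℕ → State → Prop) (B : ℕ) (hN : N < 2 ^ w)
    (h0 : I 0 (σ.setReg x 0)) (hx : ∀ i τ, i ≤ N → I i τ → τ.reg x = i ∧ e.eval w τ = N)
    (hs : ∀ i τ, i < N → I i τ → RunT w ω p τ B fun υ =>
      υ.reg x = i ∧ I (i + 1) (υ.setReg x (i + 1)))
    (hQ : ∀ τ, I N τ → Q τ) (hT : N * (B + e.cost + 8) + e.cost + 6 ≤ T) :
    RunT w ω (RAM.forTo x e p) σ T Q :=
  RunT.forTo_sum I (fun _ => B) hN h0 hx hs hQ (by simpa using hT)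

end RAM

namespace SSRP

open RAM

set_option linter.unusedSimpArgs false

/-! ### Distance functions as solutions of Bellman's equations -/

/-- `f` solves Bellman's equations on the vertices `ok`, with edges `E`, initial values `key`, and
all values capped at `n`: on these vertices `f` is the pointwise minimum of `n` and of
`key u + d(u, ·)`, where `d` is the distance inside `ok`. -/
structure Bell (n : ℕ) (E : ℕ → ℕ → Prop) (ok : ℕ → Prop) (key f : ℕ → ℕ) : Prop where
  le_top : ∀ v, ok v → f v ≤ n
  le_key : ∀ v, ok v → f v ≤ key v
  le_step : ∀ u v, ok u → ok v → E u v → f v ≤ f u + 1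
  attained : ∀ v, ok v → f v < n → f v = key v ∨ ∃ u, ok u ∧ E u v ∧ f v = f u + 1

/-- A subsolution lies below a supersolution. -/
theorem sub_le_super {n : ℕ} {E : ℕ → ℕ → Prop} {ok : ℕ → Prop} {key f g : ℕ → ℕ}
    (h1 : ∀ v, ok v → f v ≤ n) (h2 : ∀ v, ok v → f v ≤ key v)
    (h3 : ∀ u v, ok u → ok v → E u v → f v ≤ f u + 1)
    (h4 : ∀ v, ok v → g v < n → key v ≤ g v ∨ ∃ u, ok u ∧ E u v ∧ g u + 1 ≤ g v)
    (v : ℕ) (hv : ok v) : f v ≤ g v := by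
  suffices H : ∀ k v, ok v → g v = k → f v ≤ g v from H _ v hv rfl
  intro k
  induction k using Nat.strong_induction_on with
  | _ k ih =>
    intro v hv hk
    by_cases hn : g v < n
    · rcases h4 v hv hn with h | ⟨u, hu, huv, h⟩
      · exact (h2 v hv).trans h
      · have := ih (g u) (by omega) u hu rfl
        have := h3 u v hu hv huv
        omega
    · have := h1 v hv
      omega

theorem Bell.le_super {n : ℕ} {E : ℕ → ℕ → Prop} {ok : ℕ → Prop} {key f g : ℕ → ℕ}
    (h : Bell n E ok key f)
    (h4 : ∀ v, ok v → g v < n → key v ≤ g v ∨ ∃ u, ok u ∧ E u v ∧ g u + 1 ≤ g v)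
    (v : ℕ) (hv : ok v) : f v ≤ g v :=
  sub_le_super h.1 h.2 h.3 h4 v hv

theorem Bell.sub_le {n : ℕ} {E : ℕ → ℕ → Prop} {ok : ℕ → Prop} {key f g : ℕ → ℕ}
    (h : Bell n E ok key g)
    (h1 : ∀ v, ok v → f v ≤ n) (h2 : ∀ v, ok v → f v ≤ key v)
    (h3 : ∀ u v, ok u → ok v → E u v → f v ≤ f u + 1) (v : ℕ) (hv : ok v) : f v ≤ g v :=
  sub_le_super h1 h2 h3 (fun v hv hn => (h.4 v hv hn).imp (fun h => h.ge)
    fun ⟨u, hu, huv, h⟩ => ⟨u, hu, huv, h.ge⟩) v hv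

theorem Bell.unique {n : ℕ} {E : ℕ → ℕ → Prop} {ok : ℕ → Prop} {key f g : ℕ → ℕ}
    (hf : Bell n E ok key f) (hg : Bell n E ok key g) (v : ℕ) (hv : ok v) : f v = g v :=
  le_antisymm (hg.sub_le hf.1 hf.2 hf.3 v hv) (hf.sub_le hg.1 hg.2 hg.3 v hv)

/-- Only the values on `ok` matter. -/
theorem Bell.congr {n : ℕ} {E : ℕ → ℕ → Prop} {ok ok' : ℕ → Prop} {key key' f f' : ℕ → ℕ}
    (h : Bell n E ok key f) (ho : ∀ v, ok v ↔ ok' v) (hk : ∀ v, ok v → key v = key' v)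
    (hf : ∀ v, ok v → f v = f' v) : Bell n E ok' key' f' := by
  obtain rfl : ok = ok' := funext fun v => propext (ho v)
  refine ⟨fun v hv => ?_, fun v hv => ?_, fun u v hu hv huv => ?_, fun v hv hn => ?_⟩
  · rw [← hf v hv]; exact h.1 v hv
  · rw [← hf v hv, ← hk v hv]; exact h.2 v hv
  · rw [← hf v hv, ← hf u hu]; exact h.3 u v hu hv huv
  · rw [← hf v hv] at hn ⊢
    rw [← hk v hv]
    refine (h.4 v hv hn).imp id ?_
    rintro ⟨u, hu, huv, he⟩
    exact ⟨u, hu, huv, by rw [← hf u hu]; exact he⟩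

/-! ### Breadth-first trees -/

/-- `dep` is the depth (`n` for unreachable vertices) and `par` the parent function of a
breadth-first tree of the graph with edges `E` on the vertices `0, …, n - 1`. -/
structure IsTree (n : ℕ) (E : ℕ → ℕ → Prop) (s : ℕ) (dep par : ℕ → ℕ) : Prop where
  symm : ∀ x y, E x y → E y x
  lt : ∀ x y, E x y → x < n
  s_lt : s < n
  dep_s : dep s = 0
  dep_le : ∀ v < n, dep v ≤ n
  step : ∀ u v, E u v → dep v ≤ dep u + 1
  eq_s : ∀ v < n, dep v = 0 → v = s
  par_edge : ∀ v < n, dep v < n → v ≠ s → E (par v) v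
  dep_par : ∀ v < n, dep v < n → v ≠ s → dep (par v) + 1 = dep v

/-- `q` is an ancestor of `t`, or `t` itself, in the tree. The bound on the number of steps keeps the
iteration from running past the root, where `par` is not a vertex. -/
def Anc (n : ℕ) (dep par : ℕ → ℕ) (q t : ℕ) : Prop :=
  t < n ∧ dep t < n ∧ ∃ k ≤ dep t, par^[k] t = q

/-- The edges in `E` without the edge from `q` to its parent. -/
def Del (E : ℕ → ℕ → Prop) (par : ℕ → ℕ) (q x y : ℕ) : Prop :=
  E x y ∧ ¬ (x = par q ∧ y = q) ∧ ¬ (x = q ∧ y = par q)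

/-- The edge `x y` leads into the subtree of `q`, and is not the edge from the parent of `q`. -/
def Cross (n : ℕ) (E : ℕ → ℕ → Prop) (dep par : ℕ → ℕ) (q x y : ℕ) : Prop :=
  E x y ∧ ¬ Anc n dep par q x ∧ Anc n dep par q y ∧ par y ≠ x

/-- The initial values of a search from `s` alone. -/
def srcKey (n s v : ℕ) : ℕ := if v = s then 0 else n

section

variable {n : ℕ} {E : ℕ → ℕ → Prop} {s : ℕ} {dep par : ℕ → ℕ} (T : IsTree n E s dep par)

include T

theorem IsTree.par_lt {v : ℕ} (h1 : v < n) (h2 : dep v < n) (h3 : v ≠ s) : par v < n :=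
  T.lt _ _ (T.par_edge v h1 h2 h3)

/-- The first `dep t` steps of the parent function stay in the tree. -/
theorem IsTree.iterate {t : ℕ} (ht : t < n) (hd : dep t < n) {k : ℕ} (hk : k ≤ dep t) :
    par^[k] t < n ∧ dep (par^[k] t) + k = dep t := by
  induction k with
  | zero => exact ⟨ht, rfl⟩
  | succ k ih =>
    obtain ⟨h1, h2⟩ := ih (by omega)
    have h3 : par^[k] t ≠ s := by
      intro h
      have := T.dep_s
      rw [h] at h2
      omega
    rw [Function.iterate_succ_apply']
    have := T.dep_par _ h1 (by omega) h3
    exact ⟨T.par_lt h1 (by omega) h3, by omega⟩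

theorem IsTree.anc_lt {q t : ℕ} (h : Anc n dep par q t) : q < n ∧ dep q ≤ dep t := by
  obtain ⟨h1, h2, k, hk, rfl⟩ := h
  obtain ⟨h3, h4⟩ := T.iterate h1 h2 hk
  exact ⟨h3, by omega⟩

theorem IsTree.anc_eq {q t : ℕ} (h : Anc n dep par q t) : par^[dep t - dep q] t = q := by
  obtain ⟨h1, h2, k, hk, rfl⟩ := h
  obtain ⟨h3, h4⟩ := T.iterate h1 h2 hk
  congr 1
  rw [← h4]
  simp

omit T in
theorem anc_refl {t : ℕ} (ht : t < n) (hd : dep t < n) : Anc n dep par t t :=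
  ⟨ht, hd, 0, Nat.zero_le _, rfl⟩

theorem IsTree.anc_of_par {q t : ℕ} (ht : t < n) (hd : dep t < n) (hs : t ≠ s)
    (h : Anc n dep par q (par t)) : Anc n dep par q t := by
  obtain ⟨h1, h2, k, hk, h3⟩ := h
  have := T.dep_par t ht hd hs
  exact ⟨ht, hd, k + 1, by omega, h3⟩

theorem IsTree.anc_s {q : ℕ} (h : Anc n dep par q s) : q = s := by
  obtain ⟨h1, h2, k, hk, h3⟩ := h
  rw [T.dep_s] at hk
  obtain rfl : k = 0 := by omega
  exact h3.symm

theorem IsTree.ne_s {q t : ℕ} (h : Anc n dep par q t) (hq : q ≠ s) : t ≠ s := by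
  rintro rfl
  exact hq (T.anc_s h)

theorem IsTree.anc_par {q t : ℕ} (h : Anc n dep par q t) (hq : q ≠ t) :
    t ≠ s ∧ Anc n dep par q (par t) := by
  have hs : t ≠ s := by
    rintro rfl
    exact hq (T.anc_s h)
  obtain ⟨h1, h2, k, hk, h3⟩ := h
  have := T.dep_par t h1 h2 hs
  cases k with
  | zero => exact (hq h3.symm).elim
  | succ k => exact ⟨hs, T.par_lt h1 h2 hs, by omega, k, by omega, h3⟩

theorem IsTree.s_anc {t : ℕ} (ht : t < n) (hd : dep t < n) : Anc n dep par s t := by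
  obtain ⟨h1, h2⟩ := T.iterate ht hd le_rfl
  exact ⟨ht, hd, dep t, le_rfl, T.eq_s _ h1 (by omega)⟩

theorem IsTree.anc_unique {q q' t : ℕ} (h : Anc n dep par q t) (h' : Anc n dep par q' t)
    (hd : dep q = dep q') : q = q' := by
  rw [← T.anc_eq h, ← T.anc_eq h', hd]

theorem IsTree.anc_of_le {q x r : ℕ} (h : Anc n dep par q r) (h' : Anc n dep par x r)
    (hd : dep q ≤ dep x) : Anc n dep par q x := by
  have hq := T.anc_eq h
  have hx := T.anc_eq h'
  have h1 := T.anc_lt h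
  have h2 := T.anc_lt h'
  have h3 := h'.2.1
  refine ⟨h2.1, by omega, dep x - dep q, by omega, ?_⟩
  rw [← hx, ← Function.iterate_add_apply, hx, ← hq]
  congr 1
  rw [hq]
  omega

theorem IsTree.not_anc_par {q : ℕ} (hq : q < n) (hd : dep q < n) (hs : q ≠ s) :
    ¬ Anc n dep par q (par q) := by
  intro h
  have := T.dep_par q hq hd hs
  have := (T.anc_lt h).2
  omega

/-! ### Replacement paths across one tree edge -/

variable {q : ℕ} (hq : q < n) (hd : dep q < n) (hs : q ≠ s) {g : ℕ → ℕ}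
  (B : Bell n (Del E par q) (· < n) (srcKey n s) g)

include hq hd hs

theorem IsTree.del_of_anc {x y : ℕ} (hx : Anc n dep par q x) (hy : Anc n dep par q y)
    (h : E x y) : Del E par q x y := by
  have := T.not_anc_par hq hd hs
  refine ⟨h, ?_, ?_⟩
  · rintro ⟨rfl, -⟩; exact this hx
  · rintro ⟨-, rfl⟩; exact this hy

include B

omit hq hd hs in
theorem IsTree.dep_le_repl {v : ℕ} (hv : v < n) : dep v ≤ g v := by
  refine B.sub_le T.dep_le (fun v _ => ?_) (fun u v _ _ h => T.step u v h.1) v hv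
  unfold srcKey
  split_ifs with h
  · rw [h, T.dep_s]
  · exact T.dep_le v ‹_›

theorem IsTree.repl_le_dep {v : ℕ} (hv : v < n) (ha : ¬ Anc n dep par q v) : g v ≤ dep v := by
  suffices H : ∀ k v, v < n → ¬ Anc n dep par q v → dep v = k → g v ≤ dep v from H _ v hv ha rfl
  intro k
  induction k with
  | zero =>
    intro v hv _ hk
    have := B.le_key v hv
    rw [srcKey, if_pos (T.eq_s v hv hk)] at this
    omega
  | succ k ih =>
    intro v hv ha hk
    have h1 := T.dep_le v hv
    by_cases h2 : dep v < n
    · have h3 : v ≠ s := by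
        rintro rfl
        have := T.dep_s
        omega
      have h4 := T.dep_par v hv h2 h3
      have h5 := T.par_lt hv h2 h3
      have h6 := ih (par v) h5 (fun h => ha (T.anc_of_par hv h2 h3 h)) (by omega)
      have h7 := B.le_step (par v) v h5 hv ⟨T.par_edge v hv h2 h3,
        fun h => ha (h.2 ▸ anc_refl hv h2), fun h => by
          have := T.dep_par q hq hd hs
          rw [h.1] at h4
          rw [← h.2] at this
          omega⟩
      omega
    · have := B.le_top v hv
      omega

theorem IsTree.repl_eq_dep {v : ℕ} (hv : v < n) (ha : ¬ Anc n dep par q v) : g v = dep v :=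
  le_antisymm (T.repl_le_dep hq hd hs B hv ha) (T.dep_le_repl B hv)

/-- Inside the subtree of `q` one can move along tree edges without using the deleted edge. -/
theorem IsTree.repl_tree {v : ℕ} (h : Anc n dep par q v) :
    g v ≤ g q + (dep v - dep q) ∧ g q ≤ g v + (dep v - dep q) := by
  suffices H : ∀ k v, Anc n dep par q v → dep v = k →
      g v ≤ g q + (dep v - dep q) ∧ g q ≤ g v + (dep v - dep q) from H _ v h rfl
  intro k
  induction k using Nat.strong_induction_on with
  | _ k ih =>
    intro v h hk
    by_cases hqv : q = v
    · subst hqv; simp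
    · obtain ⟨h1, h2⟩ := T.anc_par h hqv
      have h3 := T.dep_par v h.1 h.2.1 h1
      have h4 := T.par_edge v h.1 h.2.1 h1
      have h5 := ih (dep (par v)) (by omega) (par v) h2 rfl
      have h6 := T.anc_lt h2
      have h7 := B.le_step _ _ h2.1 h.1 (T.del_of_anc hq hd hs h2 h h4)
      have h8 := B.le_step _ _ h.1 h2.1 (T.del_of_anc hq hd hs h h2 (T.symm _ _ h4))
      omega

/-- Between two vertices of the subtree of `q`, a shortest path never needs the edge above `q`:
such a path would have to climb to the parent of `q` and to come back. -/
theorem IsTree.repl_le_add {r y : ℕ} {f : ℕ → ℕ} (hr : Anc n dep par q r)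
    (hy : Anc n dep par q y) (F : Bell n E (· < n) (srcKey n r) f) : g r ≤ g y + f y := by
  have hp := T.par_lt hq hd hs
  have hpq := T.dep_par q hq hd hs
  -- Follow a shortest path from `r` to `y`. Either it survives the deletion, or it uses the edge
  -- between `q` and its parent and then `f y` is large in terms of `dep y`.
  have key : ∀ k y, y < n → f y = k →
      g r ≤ g y + f y ∨ f (par q) + dep y ≤ f y + dep (par q) := by
    intro k
    induction k using Nat.strong_induction_on with
    | _ k ih =>
      intro y hy hk
      by_cases hn : f y < n
      · rcases F.attained y hy hn with h | ⟨u, hu, huy, h⟩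
        · left
          rw [srcKey] at h
          split_ifs at h with h'
          · subst h'; omega
          · omega
        · have hstep := T.step u y huy
          rcases ih (f u) (by omega) u hu rfl with h' | h'
          · by_cases he : Del E par q y u
            · have := B.le_step y u hy hu he
              omega
            · right
              have : (y = par q ∧ u = q) ∨ (y = q ∧ u = par q) := by
                by_contra hc
                push Not at hc
                exact he ⟨T.symm _ _ huy, fun h => hc.1 h.1 h.2, fun h => hc.2 h.1 h.2⟩
              rcases this with ⟨rfl, rfl⟩ | ⟨rfl, rfl⟩ <;> omega
          · right; omega
      · left
        have := B.le_top r hr.1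
        omega
  rcases key _ y hy.1 rfl with h | h
  · exact h
  -- Moving through `q` along the tree is no longer than such a path.
  · have h1 : dep r - dep (par q) ≤ f (par q) := by
      refine F.sub_le (f := fun v => dep r - dep v) (fun v _ => ?_) (fun v _ => ?_)
        (fun u v _ _ huv => ?_) _ hp
      · have := hr.2.1
        omega
      · unfold srcKey
        have := hr.2.1
        split_ifs with h
        · rw [h]; omega
        · omega
      · have := T.step v u (T.symm _ _ huv)
        omega
    have h2 := T.repl_tree hq hd hs B hr
    have h3 := T.repl_tree hq hd hs B hy
    have h4 := T.anc_lt hr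
    have h5 := T.anc_lt hy
    omega

/-- Running along the tree to `x`, over the edge `x y`, and on to `r` by any shortest path gives a
bound for the replacement length of `r`. -/
theorem IsTree.repl_le_cross {r x y : ℕ} {f : ℕ → ℕ} (hr : Anc n dep par q r)
    (F : Bell n E (· < n) (srcKey n r) f) (h : Cross n E dep par q x y) :
    g r ≤ dep x + 1 + f y := by
  obtain ⟨h1, h2, h3, h4⟩ := h
  have hx := T.lt _ _ h1
  have h5 := T.repl_le_dep hq hd hs B hx h2
  have h6 := B.le_step x y hx h3.1 ⟨h1, by rintro ⟨rfl, rfl⟩; exact h4 rfl, by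
    rintro ⟨rfl, -⟩; exact h2 (anc_refl hq hd)⟩
  have h7 := T.repl_le_add hq hd hs B hr h3 F
  omega

omit hq hd in
/-- The last edge by which a replacement path to `r` enters the subtree of `q`. -/
theorem IsTree.exists_cross {r : ℕ} {f : ℕ → ℕ} (hr : Anc n dep par q r)
    (F : Bell n E (· < n) (srcKey n r) f) (hg : g r < n) :
    ∃ x y, Cross n E dep par q x y ∧ dep x + 1 + f y ≤ g r := by
  -- follow a replacement path backwards until it leaves the subtree of `q`
  suffices H : ∀ k v, Anc n dep par q v → g v = k → g v < n →
      ∃ x y, Cross n E dep par q x y ∧ dep x + 1 + f y ≤ g v + f v by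
    obtain ⟨x, y, h1, h2⟩ := H _ r hr rfl hg
    have := F.le_key r hr.1
    rw [srcKey, if_pos rfl] at this
    exact ⟨x, y, h1, by omega⟩
  intro k
  induction k using Nat.strong_induction_on with
  | _ k ih =>
    intro v hv hk hn
    have hvs := T.ne_s hv hs
    rcases B.attained v hv.1 hn with h | ⟨u, hu, huv, h⟩
    · rw [srcKey, if_neg hvs] at h
      omega
    · by_cases ha : Anc n dep par q u
      · obtain ⟨x, y, h1, h2⟩ := ih (g u) (by omega) u ha rfl (by omega)
        have := F.le_step v u hv.1 hu (T.symm _ _ huv.1)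
        exact ⟨x, y, h1, by omega⟩
      · refine ⟨u, v, ⟨huv.1, ha, hv, ?_⟩, ?_⟩
        · rintro rfl
          by_cases hqv : q = v
          · subst hqv; exact huv.2.1 ⟨rfl, rfl⟩
          · exact ha (T.anc_par hv hqv).2
        · have := T.dep_le_repl B hu
          omega

/-- A path from level `l` that stays at depth at least `l ≥ dep q` avoids the edge above `q`. -/
theorem IsTree.repl_le_level {l r t : ℕ} {f : ℕ → ℕ} (hl : dep q ≤ l)
    (F : Bell n E (fun v => v < n ∧ l ≤ dep v) (srcKey n r) f) (ht : t < n) (hlt : l ≤ dep t) :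
    g t ≤ g r + f t := by
  have hpq := T.dep_par q hq hd hs
  have h0 := B.le_top
  have := F.sub_le (f := fun v => min n (g v - g r)) (fun v _ => min_le_left _ _) (fun v _ => ?_)
    (fun u v hu hv huv => ?_) t ⟨ht, hlt⟩
  · have := h0 t ht
    omega
  · unfold srcKey
    split_ifs with h
    · rw [h]; simp
    · exact min_le_left _ _
  · have := B.le_step u v hu.1 hv.1 ⟨huv, fun h => by have := hu.2; rw [h.1] at this; omega,
      fun h => by have := hv.2; rw [h.2] at this; omega⟩
    omega

omit hq hd hs in
/-- A replacement path to a vertex at depth at least `l` visits level `l` for a last time. -/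
theorem IsTree.exists_level {l t : ℕ} (f : ℕ → ℕ → ℕ)
    (F : ∀ r < n, dep r = l → Bell n E (fun v => v < n ∧ l ≤ dep v) (srcKey n r) (f r))
    (ht : t < n) (hlt : l ≤ dep t) (hgt : g t < n) :
    ∃ r < n, dep r = l ∧ g r + f r t ≤ g t := by
  suffices H : ∀ k t, t < n → l ≤ dep t → g t = k → g t < n →
      ∃ r < n, dep r = l ∧ g r + f r t ≤ g t from H _ t ht hlt rfl hgt
  intro k
  induction k using Nat.strong_induction_on with
  | _ k ih =>
    intro t ht hlt hk hgt
    by_cases he : dep t = l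
    · have := (F t ht he).le_key t ⟨ht, hlt⟩
      rw [srcKey, if_pos rfl] at this
      exact ⟨t, ht, he, by omega⟩
    · rcases B.attained t ht hgt with h | ⟨u, hu, huv, h⟩
      · rw [srcKey] at h
        split_ifs at h with h'
        · rw [h', T.dep_s] at hlt he
          omega
        · omega
      · have h1 := T.step u t huv.1
        have h2 : l ≤ dep u := by omega
        obtain ⟨r, hr, hrl, h3⟩ := ih (g u) (by omega) u hu h2 rfl (by omega)
        have := (F r hr hrl).le_step u t ⟨hu, h2⟩ ⟨ht, hlt⟩ huv.1
        exact ⟨r, hr, hrl, by omega⟩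

/-- Above level `l`, the replacement lengths in the subtree of `q` solve Bellman's equations whose
initial values come from the neighbours outside the subtree and on level `l`. -/
theorem IsTree.repl_near {l : ℕ} {G key f : ℕ → ℕ}
    (hG1 : ∀ x < n, ¬ Anc n dep par q x → G x = dep x)
    (hG2 : ∀ x < n, Anc n dep par q x → dep x = l → G x = g x)
    (hG3 : ∀ x < n, Anc n dep par q x → dep x ≠ l → n ≤ G x)
    (hk1 : ∀ t, Anc n dep par q t → dep t < l → ∀ x, Del E par q x t → key t ≤ G x + 1)
    (hk2 : ∀ t, Anc n dep par q t → dep t < l →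
      n ≤ key t ∨ ∃ x, Del E par q x t ∧ G x + 1 ≤ key t)
    (F : Bell n E (fun v => Anc n dep par q v ∧ dep v < l) key f)
    {t : ℕ} (ht : Anc n dep par q t) (hlt : dep t < l) : f t = g t := by
  have hgG : ∀ x < n, g x ≤ G x := by
    intro x hx
    by_cases ha : Anc n dep par q x
    · by_cases hl : dep x = l
      · exact (hG2 x hx ha hl).ge
      · exact (B.le_top x hx).trans (hG3 x hx ha hl)
    · rw [hG1 x hx ha]
      exact T.repl_le_dep hq hd hs B hx ha
  refine le_antisymm (F.le_super (fun v hv hn => ?_) t ⟨ht, hlt⟩)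
    (F.sub_le (fun v hv => B.le_top v hv.1.1) (fun v hv => ?_) (fun u v hu hv huv => ?_) t
      ⟨ht, hlt⟩)
  -- `g` is a supersolution of the equations for `f`
  · have hvs := T.ne_s hv.1 hs
    rcases B.attained v hv.1.1 hn with h | ⟨u, hu, huv, h⟩
    · rw [srcKey, if_neg hvs] at h
      omega
    · by_cases ha : Anc n dep par q u
      · by_cases hl : dep u < l
        · exact Or.inr ⟨u, ⟨ha, hl⟩, huv.1, by omega⟩
        · have := T.step v u (T.symm _ _ huv.1)
          have h1 := hG2 u hu ha (by omega)
          have := hk1 v hv.1 hv.2 u huv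
          left; omega
      · have h1 := hG1 u hu ha
        have := hk1 v hv.1 hv.2 u huv
        have := T.dep_le_repl B hu
        left; omega
  -- `g` is a subsolution of the equations for `f`
  · rcases hk2 v hv.1 hv.2 with h | ⟨x, hx, h⟩
    · exact (B.le_top v hv.1.1).trans h
    · have h1 := T.lt _ _ hx.1
      have := B.le_step x v h1 hv.1.1 hx
      have := hgG x h1
      omega
  · exact B.le_step u v hu.1.1 hv.1.1 (T.del_of_anc hq hd hs hu.1 hv.1 huv)

end

/-! ### Lowest common ancestors -/

/-- `v` is the depth of the lowest common ancestor of `x` and `r`, described by the ancestors `q` of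
`r`: those up to depth `v` are ancestors of `x`. -/
def IsLcaDepth (n : ℕ) (dep par : ℕ → ℕ) (x r v : ℕ) : Prop :=
  v ≤ dep r ∧ ∀ q, Anc n dep par q r → (dep q ≤ v ↔ Anc n dep par q x)

section

variable {n : ℕ} {E : ℕ → ℕ → Prop} {s : ℕ} {dep par : ℕ → ℕ}

theorem IsTree.isLcaDepth_of_anc (T : IsTree n E s dep par) {x r : ℕ} (h : Anc n dep par x r) :
    IsLcaDepth n dep par x r (dep x) :=
  ⟨(T.anc_lt h).2, fun _ hq => ⟨fun hd => T.anc_of_le hq h hd, fun hx => (T.anc_lt hx).2⟩⟩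

theorem IsTree.isLcaDepth_of_par (T : IsTree n E s dep par) {x r v : ℕ} (hx : x < n)
    (hd : dep x < n) (hs : x ≠ s) (h : ¬ Anc n dep par x r)
    (hv : IsLcaDepth n dep par (par x) r v) : IsLcaDepth n dep par x r v :=
  ⟨hv.1, fun q hq => (hv.2 q hq).trans ⟨T.anc_of_par hx hd hs, fun hqx =>
    (T.anc_par hqx (by rintro rfl; exact h hq)).2⟩⟩

end

/-! ### Distances in simple graphs -/

section

variable {n : ℕ}

/-- The adjacency relation of a graph on `Fin n`, as a relation on the natural numbers. -/
def adjNat (G : SimpleGraph (Fin n)) (x y : ℕ) : Prop :=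
  ∃ (hx : x < n) (hy : y < n), G.Adj ⟨x, hx⟩ ⟨y, hy⟩

/-- The coded distance from `s`, as a function on the natural numbers. -/
noncomputable def codeDist (G : SimpleGraph (Fin n)) (s : Fin n) (v : ℕ) : ℕ :=
  if h : v < n then code n (G.edist s ⟨v, h⟩) else n

theorem dist_lt_of_reachable {G : SimpleGraph (Fin n)} {s v : Fin n} (h : G.Reachable s v) :
    G.dist s v < n := by
  obtain ⟨p, hp, h1⟩ := h.exists_path_of_dist
  have := hp.length_lt
  rw [Fintype.card_fin] at this
  omega

theorem codeDist_reachable {G : SimpleGraph (Fin n)} {s v : Fin n} (h : G.Reachable s v) :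
    codeDist G s v = G.dist s v := by
  have h1 : G.edist s v ≠ ⊤ := SimpleGraph.edist_ne_top_iff_reachable.mpr h
  simp [codeDist, code, h1, SimpleGraph.dist]

theorem codeDist_not_reachable {G : SimpleGraph (Fin n)} {s v : Fin n} (h : ¬ G.Reachable s v) :
    codeDist G s v = n := by
  have h1 : G.edist s v = ⊤ := by
    by_contra h1
    exact h (SimpleGraph.edist_ne_top_iff_reachable.mp h1)
  simp [codeDist, code, h1]

theorem codeDist_lt_iff {G : SimpleGraph (Fin n)} {s v : Fin n} :
    codeDist G s v < n ↔ G.Reachable s v := by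
  by_cases h : G.Reachable s v
  · simp only [codeDist_reachable h, dist_lt_of_reachable h, h]
  · simp [codeDist_not_reachable h, h]

theorem codeDist_le {G : SimpleGraph (Fin n)} {s v : Fin n} : codeDist G s v ≤ n := by
  by_cases h : G.Reachable s v
  · rw [codeDist_reachable h]
    exact (dist_lt_of_reachable h).le
  · rw [codeDist_not_reachable h]

/-- The distances from `s` solve Bellman's equations. -/
theorem bell_codeDist (G : SimpleGraph (Fin n)) (s : Fin n) :
    Bell n (adjNat G) (· < n) (srcKey n s) (codeDist G s) := by
  refine ⟨fun v hv => codeDist_le (v := ⟨v, hv⟩), fun v hv => ?_, fun u v hu hv huv => ?_,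
    fun v hv hn => ?_⟩
  · unfold srcKey
    split_ifs with h
    · subst h
      rw [codeDist_reachable (SimpleGraph.Reachable.refl s)]
      simp
    · exact codeDist_le (v := ⟨v, hv⟩)
  · obtain ⟨hu, hv, h⟩ := huv
    by_cases h1 : G.Reachable s ⟨u, hu⟩
    · have h2 : G.Reachable s ⟨v, hv⟩ := h1.trans h.reachable
      have h3 := codeDist_reachable h1
      have h4 := codeDist_reachable h2
      dsimp only at h3 h4
      rw [h3, h4]
      obtain ⟨p, hp⟩ := h1.exists_walk_length_eq_dist
      have := SimpleGraph.dist_le (p.concat h)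
      rw [SimpleGraph.Walk.length_concat] at this
      omega
    · have h3 := codeDist_not_reachable h1
      have := codeDist_le (G := G) (s := s) (v := ⟨v, hv⟩)
      dsimp only at h3 this
      omega
  · have h1 : G.Reachable s ⟨v, hv⟩ := codeDist_lt_iff.mp hn
    have h2 := codeDist_reachable h1
    obtain ⟨p, hp⟩ := h1.symm.exists_walk_length_eq_dist
    rw [SimpleGraph.dist_comm] at hp
    cases p with
    | nil => left; simp [srcKey, codeDist, code, hv]
    | @cons _ u _ h p =>
      right
      have h3 : G.Reachable s u := h1.trans h.reachable
      refine ⟨u, u.2, ⟨u.2, hv, h.symm⟩, ?_⟩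
      have h4 := codeDist_reachable h3
      have h5 := SimpleGraph.dist_le p.reverse
      rw [SimpleGraph.Walk.length_reverse] at h5
      rw [SimpleGraph.Walk.length_cons] at hp
      obtain ⟨p', hp'⟩ := h3.exists_walk_length_eq_dist
      have h6 := SimpleGraph.dist_le (p'.concat h.symm)
      rw [SimpleGraph.Walk.length_concat] at h6
      dsimp only at h2
      omega

theorem adjNat_deleteEdges (G : SimpleGraph (Fin n)) (par : ℕ → ℕ) (p q : Fin n)
    (hp : par q = p) (x y : ℕ) :
    adjNat (G.deleteEdges {s(p, q)}) x y ↔ Del (adjNat G) par q x y := by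
  unfold adjNat Del
  rw [hp]
  constructor
  · rintro ⟨hx, hy, h⟩
    rw [SimpleGraph.deleteEdges_adj] at h
    refine ⟨⟨hx, hy, h.1⟩, ?_, ?_⟩
    · rintro ⟨rfl, rfl⟩
      exact h.2 rfl
    · rintro ⟨rfl, rfl⟩
      exact h.2 Sym2.eq_swap
  · rintro ⟨⟨hx, hy, h⟩, h1, h2⟩
    refine ⟨hx, hy, ?_⟩
    rw [SimpleGraph.deleteEdges_adj]
    refine ⟨h, fun h3 => ?_⟩
    rw [Set.mem_singleton_iff, Sym2.eq_iff] at h3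
    rcases h3 with ⟨h3, h4⟩ | ⟨h3, h4⟩
    · exact h1 ⟨congrArg Fin.val h3, congrArg Fin.val h4⟩
    · exact h2 ⟨congrArg Fin.val h3, congrArg Fin.val h4⟩

/-- The tree path from `t` up to the root. -/
theorem IsTree.exists_walk {G : SimpleGraph (Fin n)} {s : Fin n} {dep par : ℕ → ℕ}
    (T : IsTree n (adjNat G) s dep par) (t : Fin n) (hd : dep t < n) :
    ∃ P : G.Walk t s, P.length = dep t ∧ ∀ i ≤ dep t, (P.getVert i : ℕ) = par^[i] t := by
  suffices H : ∀ k (t : Fin n), dep t = k → k < n →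
      ∃ P : G.Walk t s, P.length = k ∧ ∀ i ≤ k, (P.getVert i : ℕ) = par^[i] t from H _ t rfl hd
  intro k
  induction k with
  | zero =>
    intro t ht _
    obtain rfl : t = s := Fin.ext (T.eq_s t t.2 ht)
    refine ⟨.nil, rfl, fun i hi => ?_⟩
    obtain rfl : i = 0 := by omega
    simp
  | succ k ih =>
    intro t ht hk
    have hts : (t : ℕ) ≠ s := by
      intro h
      have := T.dep_s
      rw [h] at ht
      omega
    obtain ⟨hx, hy, h⟩ := T.par_edge t t.2 (by omega) hts
    have h1 := T.dep_par t t.2 (by omega) hts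
    obtain ⟨P, hP, h2⟩ := ih ⟨par t, hx⟩ (by dsimp only; omega) (by omega)
    refine ⟨.cons h.symm P, by simp [hP], fun i hi => ?_⟩
    cases i with
    | zero => simp
    | succ i =>
      rw [SimpleGraph.Walk.getVert_cons_succ, h2 i (by omega)]
      rfl

/-- A tree with the right depths, and solutions of Bellman's equations for its edges, form a correct
output; the edge above `q` has position `dep q - 1` on the tree paths. -/
theorem solves_of_tree {G : SimpleGraph (Fin n)} {s : Fin n} {dep par len : ℕ → ℕ}
    (T : IsTree n (adjNat G) s dep par)
    (hdep : Bell n (adjNat G) (· < n) (srcKey n s) dep)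
    (hpar : ∀ v < n, v = s ∨ dep v = n → par v = n)
    (hlen : ∀ q < n, dep q < n → q ≠ s → ∀ t, Anc n dep par q t → ∀ g,
      Bell n (Del (adjNat G) par q) (· < n) (srcKey n s) g → len (t * n + (dep q - 1)) = g t) :
    Solves G s par len := by
  have hdist : ∀ v : Fin n, dep v = codeDist G s v := fun v =>
    hdep.unique (bell_codeDist G s) v v.2
  refine ⟨fun t ht => hpar t t.2 (ht.imp (congrArg Fin.val) fun h => ?_), fun t ht => ?_⟩
  · rw [hdist, codeDist_not_reachable h]
  · have hd : dep t < n := by rw [hdist, codeDist_lt_iff]; exact ht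
    obtain ⟨P, hP, hv⟩ := T.exists_walk t hd
    have h1 : ∀ i ≤ dep t, (P.reverse.getVert i : ℕ) = par^[dep t - i] t := by
      intro i hi
      rw [SimpleGraph.Walk.getVert_reverse, hP, hv _ (by omega)]
    refine ⟨P.reverse, ?_, fun i hi => ?_⟩
    · rw [SimpleGraph.Walk.length_reverse, hP, hdist, codeDist_reachable ht]
    · rw [SimpleGraph.Walk.length_reverse, hP] at hi
      have h2 := h1 i hi.le
      have h3 := h1 (i + 1) hi
      have h4 : par (P.reverse.getVert (i + 1)) = (P.reverse.getVert i : ℕ) := by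
        rw [h2, h3, ← Function.iterate_succ_apply' par]
        congr 1
        omega
      refine ⟨h4, ?_⟩
      obtain ⟨h5, h6⟩ := T.iterate t.2 hd (show dep t - (i + 1) ≤ dep t by omega)
      rw [← h3] at h5 h6
      have hqs : (P.reverse.getVert (i + 1) : ℕ) ≠ s := by
        intro h
        have := T.dep_s
        rw [h] at h6
        omega
      have h7 := hlen _ h5 (by omega) hqs t ⟨t.2, hd, _, by omega, h3.symm⟩ _
        (by
          have := bell_codeDist
            (G.deleteEdges {s(P.reverse.getVert i, P.reverse.getVert (i + 1))}) s
          rwa [show adjNat _ = _ from funext fun x => funext fun y => propext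
            (adjNat_deleteEdges G par _ _ h4 x y)] at this)
      rw [show dep (P.reverse.getVert (i + 1)) - 1 = i by omega] at h7
      rw [h7]
      simp [codeDist, replacementLength]

end

/-! ### Adjacency lists -/

/-- The words are long enough for all numbers that occur: sums of a few vertices and lengths, and
indices of arrays with rows of length `n` or `m`. -/
def Big (n m w : ℕ) : Prop := 2 * (n * m) + 2 * (n * n) + 2 * m + 8 * n + 8 < 2 ^ w

/-- Row `x` of a two-dimensional array ends before row `n` begins. -/
theorem row_le {x n : ℕ} (c : ℕ) (h : x < n) : x * c + c ≤ n * c := by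
  have := Nat.mul_le_mul_right c (show x + 1 ≤ n by omega)
  linarith

theorem idx_inj {c x y x' y' : ℕ} (hy : y < c) (hy' : y' < c) :
    x * c + y = x' * c + y' ↔ x = x' ∧ y = y' := by
  constructor
  · intro h
    have h1 : (x * c + y) / c = x := by
      rw [mul_comm, Nat.mul_add_div (by omega), Nat.div_eq_of_lt hy, add_zero]
    have h2 : (x' * c + y') / c = x' := by
      rw [mul_comm, Nat.mul_add_div (by omega), Nat.div_eq_of_lt hy', add_zero]
    have h3 : x = x' := by rw [← h1, ← h2, h]
    subst h3
    exact ⟨rfl, by omega⟩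
  · rintro ⟨rfl, rfl⟩
    rfl

/-- The first `deg v` entries of row `v` of `adj` (rows have length `m`) are neighbours of `v`,
the pairs in `S` are listed, and there are `c` entries altogether. -/
structure AdjInv (n m : ℕ) (E S : ℕ → ℕ → Prop) (c : ℕ) (deg adj : ℕ → ℕ) : Prop where
  le : ∀ v < n, deg v ≤ m
  sound : ∀ v < n, ∀ i < deg v, E v (adj (v * m + i))
  complete : ∀ x y, x < n → S x y → ∃ i < deg x, adj (x * m + i) = y
  sum : ∑ v ∈ Finset.range n, deg v = c

theorem AdjInv.push {n m : ℕ} {E S S' : ℕ → ℕ → Prop} {c : ℕ} {deg adj : ℕ → ℕ} {x y : ℕ}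
    (h : AdjInv n m E S c deg adj) (hx : x < n) (hd : deg x < m) (hE : E x y)
    (hS : ∀ a b, S' a b → S a b ∨ (a = x ∧ b = y)) :
    AdjInv n m E S' (c + 1) (Function.update deg x (deg x + 1))
      (Function.update adj (x * m + deg x) y) := by
  have key : ∀ v i, i < deg v → v < n →
      Function.update adj (x * m + deg x) y (v * m + i) = adj (v * m + i) := by
    intro v i hi hv
    have := h.le v hv
    refine Function.update_of_ne (fun he => ?_) _ _
    rw [idx_inj (by omega) hd] at he
    obtain ⟨rfl, rfl⟩ := he
    omega
  refine ⟨fun v hv => ?_, fun v hv i hi => ?_, fun a b ha hab => ?_, ?_⟩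
  · rw [Function.update_apply]
    split_ifs
    · omega
    · exact h.le v hv
  · by_cases hvx : v = x
    · subst hvx
      rw [Function.update_self] at hi
      by_cases hid : i = deg v
      · subst hid; rw [Function.update_self]; exact hE
      · rw [key v i (by omega) hv]
        exact h.sound v hv i (by omega)
    · rw [Function.update_of_ne hvx] at hi
      rw [key v i hi hv]
      exact h.sound v hv i hi
  · rcases hS a b hab with hab | ⟨rfl, rfl⟩
    · obtain ⟨i, hi, he⟩ := h.complete a b ha hab
      refine ⟨i, ?_, by rw [key a i hi ha, he]⟩
      rw [Function.update_apply]
      split_ifs with hax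
      · subst hax; omega
      · exact hi
    · exact ⟨deg a, by simp, by simp⟩
  · rw [Finset.sum_update_of_mem (Finset.mem_range.mpr hx), ← h.sum,
      ← Finset.add_sum_erase _ _ (Finset.mem_range.mpr hx), Finset.sdiff_singleton_eq_erase]
    omega

/-- Append `y` to the adjacency list of `x`. -/
def pushNbr (x y : ℕ) : Cmd :=
  .seq (.put 5 (.reg x * .reg 1 + .get 4 (.reg x)) (.reg y))
    (.put 4 (.reg x) (.get 4 (.reg x) + .lit 1))

/-- Array `4` receives the degrees and array `5` the adjacency lists. -/
def buildAdj : Cmd :=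
  forTo 10 (.reg 1) <| .seq (.assign 11 (.get 0 (.reg 10))) <| .seq (.assign 12 (.get 1 (.reg 10)))
    <| .seq (pushNbr 11 12) (pushNbr 12 11)

theorem run_buildAdj {w : ℕ} [NeZero w] {ω : ℕ → Bool} {n m : ℕ} {E : ℕ → ℕ → Prop} {σ : State}
    (hW : Big n m w) (hm : σ.reg 1 = m)
    (hE : ∀ x y, E x y ↔ ∃ j < m, (σ.mem 0 j = x ∧ σ.mem 1 j = y) ∨ (σ.mem 1 j = x ∧ σ.mem 0 j = y))
    (hlt : ∀ x y, E x y → x < n ∧ y < n ∧ x ≠ y) (h4 : ∀ v, σ.mem 4 v = 0) :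
    RunT w ω buildAdj σ (100 * m + 100) fun τ =>
      AdjInv n m E E (2 * m) (τ.mem 4) (τ.mem 5) ∧ Frame [4, 5] 10 σ τ := by
  unfold Big at hW
  refine RunT.forTo (N := m) (fun j τ => τ.reg 10 = j ∧ Frame [4, 5] 10 σ τ ∧
    (∀ v < n, τ.mem 4 v ≤ j) ∧ AdjInv n m E (fun x y => ∃ j' < j,
      (σ.mem 0 j' = x ∧ σ.mem 1 j' = y) ∨ (σ.mem 1 j' = x ∧ σ.mem 0 j' = y))
      (2 * j) (τ.mem 4) (τ.mem 5)) 80 (by omega) ?_ ?_ ?_ ?_ ?_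
  · refine ⟨by simp, by simp, by simp [h4], ?_⟩
    exact ⟨by simp [h4], by simp [h4], by simp, by simp [h4]⟩
  · rintro j τ - ⟨h1, h2, -⟩
    exact ⟨h1, by simp [h2.2, hm]⟩
  · rintro j τ hj ⟨h1, h2, h3, h5⟩
    have h6 : E (σ.mem 0 j) (σ.mem 1 j) := (hE _ _).mpr ⟨j, hj, .inl ⟨rfl, rfl⟩⟩
    have h7 : E (σ.mem 1 j) (σ.mem 0 j) := (hE _ _).mpr ⟨j, hj, .inr ⟨rfl, rfl⟩⟩
    have h0 := h2.1 0 (by simp)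
    have h1' := h2.1 1 (by simp)
    have hm' := h2.2 1 (by simp)
    rw [hm] at hm'
    obtain ⟨hu, hv, huv⟩ := hlt _ _ h6
    have hdu := h3 _ hu
    have hdv := h3 _ hv
    have := row_le m hu
    have := row_le m hv
    have hvu : σ.mem 1 j ≠ σ.mem 0 j := fun h => huv h.symm
    simp (disch := omega) [RunT, pushNbr, h0, h1', h1, hm', Nat.mod_eq_of_lt, hvu]
    refine ⟨?_, fun x hx => ?_, ?_⟩
    · simp [h2]
    · have := h3 x hx
      simp only [Function.update_apply]
      split_ifs <;> omega
    · have h8 := h5.push hu (by omega) h6 (S' := fun x y => (∃ j' < j,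
        (σ.mem 0 j' = x ∧ σ.mem 1 j' = y) ∨ (σ.mem 1 j' = x ∧ σ.mem 0 j' = y)) ∨
        (x = σ.mem 0 j ∧ y = σ.mem 1 j)) (fun _ _ => id)
      have h9 := h8.push hv (by rw [Function.update_of_ne hvu]; omega) h7 (S' := fun x y => ∃ j' ≤ j,
        (σ.mem 0 j' = x ∧ σ.mem 1 j' = y) ∨ (σ.mem 1 j' = x ∧ σ.mem 0 j' = y)) (by
          rintro x y ⟨j', hj', h⟩
          rcases hj'.lt_or_eq with hj' | rfl
          · exact .inl (.inl ⟨j', hj', h⟩)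
          · rcases h with ⟨rfl, rfl⟩ | ⟨rfl, rfl⟩
            · exact .inl (.inr ⟨rfl, rfl⟩)
            · exact .inr ⟨rfl, rfl⟩)
      rw [Function.update_of_ne hvu] at h9
      exact h9
  · rintro τ ⟨h1, h2, h3, h5⟩
    exact ⟨⟨h5.1, h5.2, fun x y hx hxy => h5.3 x y hx ((hE x y).mp hxy), h5.4⟩, h2⟩
  · simp; omega

/-! ### Breadth-first search with delayed starts -/

/-- Visit the vertex in register `47` with the distance in register `41`: if the vertex is allowed
and new, its distance is stored in array `13`, and it is appended to the queue in array `16`. -/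
def visit : Cmd :=
  .ite ((Expr.reg 41).less (.reg 0)) (.ite (.get 11 (.reg 47))
    (.ite ((Expr.get 13 (.reg 47)).same (.reg 0))
      (.seq (.put 13 (.reg 47) (.reg 41)) (.seq (.put 16 (.reg 48) (.reg 47))
        (.assign 48 (.reg 48 + .lit 1)))) .skip) .skip) .skip

/-- One round of the search: visit the vertices whose initial value is the current distance, and
then the neighbours of all vertices at the current distance. -/
def bfsRound : Cmd :=
  .seq (.assign 41 (.reg 42)) <|
  .seq (forTo 45 (.get 14 (.reg 42))
    (.seq (.assign 47 (.get 15 (.reg 42 * .reg 0 + .reg 45))) visit)) <|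
  .seq (.assign 44 (.reg 48)) <|
  .seq (.assign 41 (.reg 42 + .lit 1)) <|
  upTo 43 (.reg 44) (forTo 46 (.get 4 (.get 16 (.reg 43)))
    (.seq (.assign 47 (.get 5 (.get 16 (.reg 43) * .reg 1 + .reg 46))) visit))

/-- Distribute the allowed vertices over buckets according to their initial values: row `k` of array
`15` lists the vertices with initial value `k`, and entry `k` of array `14` is their number. -/
def fillBuckets : Cmd :=
  forTo 40 (.reg 0) <| .ite (.get 11 (.reg 40)) (.ite ((Expr.get 12 (.reg 40)).less (.reg 0))
    (.seq (.assign 41 (.get 12 (.reg 40)))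
      (.seq (.put 15 (.reg 41 * .reg 0 + .get 14 (.reg 41)) (.reg 40))
        (.put 14 (.reg 41) (.get 14 (.reg 41) + .lit 1)))) .skip) .skip

/-- Breadth-first search among the vertices marked in array `11`, with the initial values in array
`12`; array `13` receives the distances. -/
def bfs : Cmd :=
  .seq (forTo 40 (.reg 0) (.seq (.put 13 (.reg 40) (.reg 0)) (.put 14 (.reg 40) (.lit 0)))) <|
  .seq fillBuckets <|
  .seq (.assign 48 (.lit 0)) <|
  .seq (.assign 43 (.lit 0)) (forTo 42 (.reg 0) bfsRound)

/-- The queue `Q` of length `hi` lists the visited vertices without repetition; all distances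
assigned so far are at most `k` and have a reason. -/
structure QInv (n : ℕ) (E : ℕ → ℕ → Prop) (ok : ℕ → Prop) (key : ℕ → ℕ) (k : ℕ) (D Q : ℕ → ℕ)
    (hi : ℕ) : Prop where
  mem : ∀ i < hi, Q i < n ∧ ok (Q i) ∧ D (Q i) < n
  inj : ∀ i < hi, ∀ j < hi, Q i = Q j → i = j
  surj : ∀ v < n, D v < n → ∃ i < hi, Q i = v
  le : ∀ v < n, D v ≤ n
  vis : ∀ v < n, D v < n → D v ≤ k
  just : ∀ v < n, D v < n → D v = key v ∨ ∃ u, ok u ∧ E u v ∧ D v = D u + 1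

/-- Between two points of time, only vertices at distance `k` have been added to the queue. -/
structure QExt (n k : ℕ) (D Q : ℕ → ℕ) (hi : ℕ) (D' Q' : ℕ → ℕ) (hi' : ℕ) : Prop where
  le : hi ≤ hi'
  queue : ∀ i < hi, Q' i = Q i
  dist : ∀ v < n, D v < n → D' v = D v
  new : ∀ i, hi ≤ i → i < hi' → D' (Q' i) = k

theorem QExt.refl {n k : ℕ} {D Q : ℕ → ℕ} {hi : ℕ} : QExt n k D Q hi D Q hi :=
  ⟨le_rfl, fun _ _ => rfl, fun _ _ _ => rfl, fun _ _ _ => by omega⟩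

section

variable {n k : ℕ} {E : ℕ → ℕ → Prop} {ok : ℕ → Prop} {key D Q D' Q' D'' Q'' : ℕ → ℕ}
  {hi hi' hi'' : ℕ}

theorem QExt.trans (h : QExt n k D Q hi D' Q' hi') (h' : QExt n k D' Q' hi' D'' Q'' hi'')
    (hq' : QInv n E ok key k D' Q' hi') :
    QExt n k D Q hi D'' Q'' hi'' := by
  refine ⟨h.le.trans h'.le, fun i hi => ?_, fun v hv hd => ?_, fun i h1 h2 => ?_⟩
  · rw [h'.queue i (hi.trans_le h.le), h.queue i hi]
  · have := h.dist v hv hd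
    rw [h'.dist v hv (by omega), this]
  · by_cases h3 : i < hi'
    · have := hq'.mem i h3
      rw [h'.queue i h3, h'.dist _ this.1 this.2.2, h.new i h1 h3]
    · exact h'.new i (by omega) h2

theorem QExt.mono (h : QExt n k D Q hi D' Q' hi') (hq : QInv n E ok key k D Q hi)
    (hq' : QInv n E ok key k D' Q' hi') {v : ℕ} (hv : v < n) : D' v ≤ D v := by
  have h1 := hq.le v hv
  have h2 := hq'.le v hv
  by_cases h3 : D v < n
  · exact (h.dist v hv h3).le
  · omega

/-- A queue without repetitions has at most `n` entries. -/
theorem QInv.hi_le (h : QInv n E ok key k D Q hi) : hi ≤ n := by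
  have := Finset.card_le_card_of_injOn (s := Finset.range hi) (t := Finset.range n) Q
    (fun i hi => by simpa using (h.mem i (by simpa using hi)).1)
    (fun i hi j hj => h.inj i (by simpa using hi) j (by simpa using hj))
  simpa using this

theorem QInv.weaken (h : QInv n E ok key k D Q hi) {k' : ℕ} (hk : k ≤ k') :
    QInv n E ok key k' D Q hi :=
  ⟨h.1, h.2, h.3, h.4, fun v hv hd => (h.5 v hv hd).trans hk, h.6⟩

/-- A new vertex `x` is appended with distance `k`. -/
theorem QInv.push (h : QInv n E ok key k D Q hi) {x : ℕ} (hx : x < n) (hk : k < n) (hD : D x = n)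
    (hok : ok x)
    (hj : k = key x ∨ ∃ u, ok u ∧ E u x ∧ k = D u + 1) :
    QInv n E ok key k (Function.update D x k) (Function.update Q hi x) (hi + 1) ∧
      QExt n k D Q hi (Function.update D x k) (Function.update Q hi x) (hi + 1) := by
  have hne : ∀ v, D v < n → v ≠ x := by
    rintro v hv rfl
    omega
  have hold : ∀ v, D v < n → Function.update D x k v = D v := fun v hv =>
    Function.update_of_ne (hne v hv) _ _
  have hQ : ∀ i < hi, Function.update Q hi x i = Q i := fun i hi =>
    Function.update_of_ne (by omega) _ _
  refine ⟨⟨fun i hi' => ?_, fun i hi' j hj' hij => ?_, fun v hv hd => ?_, fun v hv => ?_,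
    fun v hv hd => ?_, fun v hv hd => ?_⟩, ⟨by omega, hQ, fun v _ => hold v, fun i h1 h2 => ?_⟩⟩
  · by_cases h1 : i = hi
    · subst h1; simp [hx, hok, hk]
    · have := h.mem i (by omega)
      rw [hQ i (by omega), hold _ this.2.2]
      exact this
  · by_cases h1 : i = hi <;> by_cases h2 : j = hi
    · omega
    · subst h1
      rw [Function.update_self, hQ j (by omega)] at hij
      exact (hne _ (h.mem j (by omega)).2.2 hij.symm).elim
    · subst h2
      rw [Function.update_self, hQ i (by omega)] at hij
      exact (hne _ (h.mem i (by omega)).2.2 hij).elim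
    · rw [hQ i (by omega), hQ j (by omega)] at hij
      exact h.inj i (by omega) j (by omega) hij
  · by_cases h1 : v = x
    · subst h1; exact ⟨hi, by omega, by simp⟩
    · rw [Function.update_of_ne h1] at hd
      obtain ⟨i, h2, h3⟩ := h.surj v hv hd
      exact ⟨i, by omega, by rw [hQ i h2, h3]⟩
  · rw [Function.update_apply]
    split_ifs
    · omega
    · exact h.le v hv
  · by_cases h1 : v = x
    · subst h1; simp
    · rw [Function.update_of_ne h1] at hd ⊢
      exact h.vis v hv hd
  · by_cases h1 : v = x
    · subst h1
      rw [Function.update_self]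
      refine hj.imp id ?_
      rintro ⟨u, h2, h3, h4⟩
      exact ⟨u, h2, h3, by rw [hold u (by omega)]; exact h4⟩
    · rw [Function.update_of_ne h1] at hd ⊢
      refine (h.just v hv hd).imp id ?_
      rintro ⟨u, h2, h3, h4⟩
      exact ⟨u, h2, h3, by rw [hold u (by omega)]; exact h4⟩
  · obtain rfl : i = hi := by omega
    simp

end

section

variable {w : ℕ} [NeZero w] {ω : ℕ → Bool} {n m : ℕ} {E : ℕ → ℕ → Prop} {ok : ℕ → Prop}
  {key : ℕ → ℕ}

theorem run_visit {k x : ℕ} {τ : State} (hW : Big n m w) (hn : τ.reg 0 = n) (hk : τ.reg 41 = k)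
    (hx : τ.reg 47 = x) (hxn : x < n) (hok : ∀ v, ok v ↔ v < n ∧ τ.mem 11 v ≠ 0)
    (h : QInv n E ok key k (τ.mem 13) (τ.mem 16) (τ.reg 48))
    (hj : ok x → k = key x ∨ ∃ u, ok u ∧ E u x ∧ k = τ.mem 13 u + 1) :
    RunT w ω visit τ 40 fun υ => Frame [13, 16] 48 τ υ ∧
      QInv n E ok key k (υ.mem 13) (υ.mem 16) (υ.reg 48) ∧
      QExt n k (τ.mem 13) (τ.mem 16) (τ.reg 48) (υ.mem 13) (υ.mem 16) (υ.reg 48) ∧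
      (ok x → υ.mem 13 x ≤ k) := by
  unfold Big at hW
  have hhi := h.hi_le
  have hle := h.le x hxn
  have hvis := h.vis x hxn
  simp (disch := omega) [RunT, visit, hn, hk, hx, Nat.mod_eq_of_lt]
  refine ⟨fun h1 => ⟨fun h2 => ⟨fun h3 => ?_, fun h3 => ⟨h, .refl, fun _ => ?_⟩⟩,
    fun h2 => ⟨h, .refl, fun h3 => ?_⟩⟩, fun h1 => ⟨h, .refl, fun _ => by omega⟩⟩
  · have hx' := (hok x).mpr ⟨hxn, h2⟩
    have := h.push hxn h1 h3 hx' (hj hx')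
    exact ⟨by simp, this⟩
  · exact hvis (by omega)
  · exact (((hok x).mp h3).2 h2).elim

/-- The vertices whose initial value is the current distance `d` are visited. -/
theorem run_starts {d : ℕ} {τ : State} (hW : Big n m w) (hn : τ.reg 0 = n) (hd : τ.reg 42 = d)
    (hdn : d < n) (hk : τ.reg 41 = d) (hok : ∀ v, ok v ↔ v < n ∧ τ.mem 11 v ≠ 0)
    (hkc : τ.mem 14 d ≤ n)
    (hKB : ∀ i < τ.mem 14 d, ok (τ.mem 15 (d * n + i)) ∧ key (τ.mem 15 (d * n + i)) = d)
    (h : QInv n E ok key d (τ.mem 13) (τ.mem 16) (τ.reg 48)) :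
    RunT w ω (forTo 45 (.get 14 (.reg 42))
      (.seq (.assign 47 (.get 15 (.reg 42 * .reg 0 + .reg 45))) visit)) τ
      (τ.mem 14 d * 70 + 10) fun υ => Frame [13, 16] 45 τ υ ∧
      QInv n E ok key d (υ.mem 13) (υ.mem 16) (υ.reg 48) ∧
      QExt n d (τ.mem 13) (τ.mem 16) (τ.reg 48) (υ.mem 13) (υ.mem 16) (υ.reg 48) ∧
      ∀ i < τ.mem 14 d, υ.mem 13 (τ.mem 15 (d * n + i)) ≤ d := by
  have hW' := hW
  unfold Big at hW'
  refine RunT.forTo (N := τ.mem 14 d) (fun j υ => υ.reg 45 = j ∧ Frame [13, 16] 45 τ υ ∧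
      QInv n E ok key d (υ.mem 13) (υ.mem 16) (υ.reg 48) ∧
      QExt n d (τ.mem 13) (τ.mem 16) (τ.reg 48) (υ.mem 13) (υ.mem 16) (υ.reg 48) ∧
      ∀ i < j, υ.mem 13 (τ.mem 15 (d * n + i)) ≤ d) 50 (by omega) ?_ ?_ ?_ ?_ ?_
  · simpa using ⟨h, .refl⟩
  · rintro j υ - ⟨h1, h2, -⟩
    exact ⟨h1, by simp [h2.2, hd, h2.1]⟩
  · rintro j υ hj ⟨h1, h2, h3, h4, h5⟩
    have h14 := h2.1 15 (by simp)
    have hn' := h2.2 0 (by simp)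
    have hd' := h2.2 42 (by simp)
    have hk' := h2.2 41 (by simp)
    rw [hn] at hn'
    rw [hd] at hd'
    rw [hk] at hk'
    have := row_le n hdn
    have hx := hKB j hj
    have hxn := ((hok _).mp hx.1).1
    have hxd := h3.le _ hxn
    refine RunT.seq (T₁ := 8) (T₂ := 40)
      (P := fun ρ => ρ = υ.setReg 47 (τ.mem 15 (d * n + j))) ?_ ?_ (by omega)
    · simp (disch := omega) [RunT, h14, hn', hd', h1, Nat.mod_eq_of_lt]
    · rintro _ rfl
      refine (run_visit (k := d) (x := τ.mem 15 (d * n + j)) (E := E) (ok := ok) (key := key) hW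
        (by simp [hn']) (by simp [hk']) (by simp) hxn (by simpa [h2.1] using hok)
        (by simpa using h3) (fun _ => .inl hx.2.symm)).mono le_rfl ?_
      rintro ρ ⟨h6, h7, h8, h9⟩
      simp only [setReg_mem, setReg_reg] at h8
      refine ⟨by simp [h6.2, h1], ?_⟩
      refine ⟨by simp, ?_, by simpa using h7, ?_, ?_⟩
      · rw [frame_setReg le_rfl]
        exact h2.trans ((h6.weaken (List.Subset.refl _) (by simp)).of_setReg (by simp))
      · simpa using h4.trans h8 h3
      · intro i hi
        simp only [setReg_mem]
        by_cases hij : i = j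
        · subst hij; exact h9 hx.1
        · have h10 := h5 i (by omega)
          have := h8.mono h3 h7 ((hok _).mp (hKB i (by omega)).1).1
          omega
  · rintro υ ⟨h1, h2⟩
    exact h2
  · simp; omega

end

section

variable {w : ℕ} [NeZero w] {ω : ℕ → Bool} {n m : ℕ} {E : ℕ → ℕ → Prop} {ok : ℕ → Prop}
  {key : ℕ → ℕ}

/-- All neighbours of the vertex at position `l` of the queue are visited. -/
theorem run_nbrs {d l c : ℕ} {τ : State} (hW : Big n m w) (hn : τ.reg 0 = n) (hm : τ.reg 1 = m)
    (hk : τ.reg 41 = d + 1) (hl : τ.reg 43 = l) (hok : ∀ v, ok v ↔ v < n ∧ τ.mem 11 v ≠ 0)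
    (hE : ∀ x y, E x y → y < n) (A : AdjInv n m E E c (τ.mem 4) (τ.mem 5))
    (h : QInv n E ok key (d + 1) (τ.mem 13) (τ.mem 16) (τ.reg 48)) (hlh : l < τ.reg 48)
    (hd : τ.mem 13 (τ.mem 16 l) = d) :
    RunT w ω (forTo 46 (.get 4 (.get 16 (.reg 43)))
      (.seq (.assign 47 (.get 5 (.get 16 (.reg 43) * .reg 1 + .reg 46))) visit)) τ
      (τ.mem 4 (τ.mem 16 l) * 75 + 15) fun υ => Frame [13, 16] 46 τ υ ∧
      QInv n E ok key (d + 1) (υ.mem 13) (υ.mem 16) (υ.reg 48) ∧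
      QExt n (d + 1) (τ.mem 13) (τ.mem 16) (τ.reg 48) (υ.mem 13) (υ.mem 16) (υ.reg 48) ∧
      ∀ u, ok u → E (τ.mem 16 l) u → υ.mem 13 u ≤ d + 1 := by
  have hW' := hW
  unfold Big at hW'
  obtain ⟨v, hv⟩ : ∃ v, τ.mem 16 l = v := ⟨_, rfl⟩
  obtain ⟨hvn, hvok, hvd⟩ := h.mem l hlh
  rw [hv] at hvn hvok hvd hd ⊢
  have hdeg := A.le v hvn
  have hrow := row_le m hvn
  refine RunT.forTo (N := τ.mem 4 v) (fun j υ => υ.reg 46 = j ∧ Frame [13, 16] 46 τ υ ∧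
      QInv n E ok key (d + 1) (υ.mem 13) (υ.mem 16) (υ.reg 48) ∧
      QExt n (d + 1) (τ.mem 13) (τ.mem 16) (τ.reg 48) (υ.mem 13) (υ.mem 16) (υ.reg 48) ∧
      ∀ i < j, ok (τ.mem 5 (v * m + i)) → υ.mem 13 (τ.mem 5 (v * m + i)) ≤ d + 1) 52 (by omega)
      ?_ ?_ ?_ ?_ ?_
  · simpa using ⟨h, .refl⟩
  · rintro j υ - ⟨h1, h2, -, h4, -⟩
    exact ⟨h1, by simp [h2.2, hl, h2.1, h4.queue l hlh, hv]⟩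
  · rintro j υ hj ⟨h1, h2, h3, h4, h5⟩
    have h5' := h2.1 5 (by simp)
    have hm' := h2.2 1 (by simp)
    have hl' := h2.2 43 (by simp)
    rw [hm] at hm'
    rw [hl] at hl'
    have hv' := h4.queue l hlh
    rw [hv] at hv'
    have hx := A.sound v hvn j hj
    have hxn := hE _ _ hx
    refine RunT.seq (T₁ := 10) (T₂ := 40)
      (P := fun ρ => ρ = υ.setReg 47 (τ.mem 5 (v * m + j))) ?_ ?_ (by omega)
    · simp (disch := omega) [RunT, h5', hm', hl', hv', h1, Nat.mod_eq_of_lt]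
    · rintro _ rfl
      refine (run_visit (k := d + 1) (x := τ.mem 5 (v * m + j)) (E := E) (ok := ok) (key := key) hW
        (by simp [h2.2, hn]) (by simp [h2.2, hk]) (by simp) hxn (by simpa [h2.1] using hok)
        (by simpa using h3) (fun _ => .inr ⟨v, hvok, hx, by
          simp [h4.dist v hvn hvd, hd]⟩)).mono le_rfl ?_
      rintro ρ ⟨h6, h7, h8, h9⟩
      simp only [setReg_mem, setReg_reg] at h8
      refine ⟨by simp [h6.2, h1], by simp, ?_, by simpa using h7, ?_, ?_⟩
      · rw [frame_setReg le_rfl]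
        exact h2.trans ((h6.weaken (List.Subset.refl _) (by simp)).of_setReg (by simp))
      · simpa using h4.trans h8 h3
      · intro i hi hiok
        simp only [setReg_mem]
        by_cases hij : i = j
        · subst hij; exact h9 hiok
        · have h10 := h5 i (by omega) hiok
          have := h8.mono h3 h7 ((hok _).mp hiok).1
          omega
  · rintro υ ⟨h1, h2, h3, h4, h5⟩
    refine ⟨h2, h3, h4, fun u hu hvu => ?_⟩
    obtain ⟨i, hi, rfl⟩ := A.complete v u hvn hvu
    exact h5 i hi hu
  · simp; omega

/-- All neighbours of the vertices at positions `l, …, lim - 1` of the queue are visited. -/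
theorem run_scan {d l lim c : ℕ} {τ : State} (hW : Big n m w) (hn : τ.reg 0 = n)
    (hm : τ.reg 1 = m) (hk : τ.reg 41 = d + 1) (hl : τ.reg 43 = l) (hlim : τ.reg 44 = lim)
    (hok : ∀ v, ok v ↔ v < n ∧ τ.mem 11 v ≠ 0)
    (hE : ∀ x y, E x y → y < n) (A : AdjInv n m E E c (τ.mem 4) (τ.mem 5))
    (h : QInv n E ok key (d + 1) (τ.mem 13) (τ.mem 16) (τ.reg 48)) (hll : l ≤ lim)
    (hlh : lim ≤ τ.reg 48) (hd : ∀ i, l ≤ i → i < lim → τ.mem 13 (τ.mem 16 i) = d) :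
    RunT w ω (upTo 43 (.reg 44) (forTo 46 (.get 4 (.get 16 (.reg 43)))
      (.seq (.assign 47 (.get 5 (.get 16 (.reg 43) * .reg 1 + .reg 46))) visit))) τ
      (∑ i ∈ Finset.Ico l lim, (τ.mem 4 (τ.mem 16 i) * 75 + 24) + 4) fun υ =>
      υ.reg 43 = lim ∧ Frame [13, 16] 43 τ υ ∧
      QInv n E ok key (d + 1) (υ.mem 13) (υ.mem 16) (υ.reg 48) ∧
      QExt n (d + 1) (τ.mem 13) (τ.mem 16) (τ.reg 48) (υ.mem 13) (υ.mem 16) (υ.reg 48) ∧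
      ∀ i, l ≤ i → i < lim → ∀ u, ok u → E (τ.mem 16 i) u → υ.mem 13 u ≤ d + 1 := by
  have hW' := hW
  unfold Big at hW'
  have hhi := h.hi_le
  refine RunT.upTo_sum (N := lim) (a := l) (fun j υ => υ.reg 43 = j ∧ υ.reg 44 = lim ∧
      Frame [13, 16] 43 τ υ ∧
      QInv n E ok key (d + 1) (υ.mem 13) (υ.mem 16) (υ.reg 48) ∧
      QExt n (d + 1) (τ.mem 13) (τ.mem 16) (τ.reg 48) (υ.mem 13) (υ.mem 16) (υ.reg 48) ∧
      ∀ i, l ≤ i → i < j → ∀ u, ok u → E (τ.mem 16 i) u → υ.mem 13 u ≤ d + 1)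
      (fun i => τ.mem 4 (τ.mem 16 i) * 75 + 15) (by omega) hll ?_ ?_ ?_ ?_ ?_
  · refine ⟨hl, hlim, .refl, h, .refl, fun i h1 h2 => by omega⟩
  · rintro j υ - ⟨h1, h2, -⟩
    exact ⟨h1, h2⟩
  · rintro j υ hj1 hj ⟨h1, h1', h2, h3, h4, h5⟩
    have hq := h4.queue j (by omega)
    have hq' := h.mem j (by omega)
    have := h4.le
    have h41 := h2.2 41 (by simp)
    refine (run_nbrs (d := d) (l := j) (c := c) (E := E) (ok := ok) (key := key) hW
      (by simp [h2.2, hn]) (by simp [h2.2, hm]) (by rw [h41, hk]) h1 (by simpa [h2.1] using hok)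
      hE (by simpa [h2.1] using A) h3 (by omega) ?_).mono ?_ ?_
    · rw [hq, h4.dist _ hq'.1 hq'.2.2, hd j hj1 hj]
    · rw [hq, h2.1 4 (by simp)]
    · rintro ρ ⟨h6, h7, h8, h9⟩
      rw [hq] at h9
      refine ⟨by simp [h6.2, h1], by simp, by simp [h6.2, h1'], ?_, by simpa using h7,
        by simpa using h4.trans h8 h3, fun i h10 h11 u hu hiu => ?_⟩
      · rw [frame_setReg le_rfl]
        exact h2.trans (h6.weaken (List.Subset.refl _) (by simp))
      · simp only [setReg_mem]
        by_cases hij : i = j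
        · subst hij; exact h9 u hu hiu
        · have h12 := h5 i h10 (by omega) u hu hiu
          have := h8.mono h3 h7 ((hok _).mp hu).1
          omega
  · rintro υ ⟨h1, -, h2⟩
    exact ⟨h1, h2⟩
  · simp

/-- The buckets list the allowed vertices with initial value below `n`. -/
structure Buckets (n : ℕ) (ok : ℕ → Prop) (key : ℕ → ℕ) (b : ℕ) (kc KB : ℕ → ℕ) : Prop where
  sum : ∑ k ∈ Finset.range n, kc k ≤ b
  sound : ∀ k < n, ∀ i < kc k, ok (KB (k * n + i)) ∧ key (KB (k * n + i)) = k
  complete : ∀ v < b, ok v → key v < n → ∃ i < kc (key v), KB (key v * n + i) = v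

theorem Buckets.le {b : ℕ} {kc KB : ℕ → ℕ} (h : Buckets n ok key b kc KB) {k : ℕ} (hk : k < n) :
    kc k ≤ b :=
  (Finset.single_le_sum (f := kc) (fun _ _ => Nat.zero_le _) (Finset.mem_range.mpr hk)).trans h.sum

theorem Buckets.skip {b : ℕ} {kc KB : ℕ → ℕ} (h : Buckets n ok key b kc KB)
    (hb : ¬ (ok b ∧ key b < n)) : Buckets n ok key (b + 1) kc KB :=
  ⟨h.1.trans (by omega), h.2, fun v hv h1 h2 => h.3 v (by
    rcases Nat.lt_succ_iff_lt_or_eq.mp hv with hv | rfl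
    · exact hv
    · exact (hb ⟨h1, h2⟩).elim) h1 h2⟩

theorem Buckets.push {b : ℕ} {kc KB : ℕ → ℕ} (h : Buckets n ok key b kc KB) (hb : b < n)
    (h1 : ok b) (h2 : key b < n) :
    Buckets n ok key (b + 1) (Function.update kc (key b) (kc (key b) + 1))
      (Function.update KB (key b * n + kc (key b)) b) := by
  have hkey : ∀ k i, k < n → i < kc k →
      Function.update KB (key b * n + kc (key b)) b (k * n + i) = KB (k * n + i) := by
    intro k i hk hi
    have h3 := h.le hk
    have h4 := h.le h2
    refine Function.update_of_ne (fun he => ?_) _ _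
    rw [idx_inj (by omega) (by omega)] at he
    obtain ⟨rfl, rfl⟩ := he
    omega
  refine ⟨?_, fun k hk i hi => ?_, fun v hv h3 h4 => ?_⟩
  · rw [Finset.sum_update_of_mem (Finset.mem_range.mpr h2)]
    have := h.sum
    rw [← Finset.add_sum_erase _ _ (Finset.mem_range.mpr h2), ← Finset.sdiff_singleton_eq_erase]
      at this
    omega
  · by_cases hkb : k = key b
    · subst hkb
      rw [Function.update_self] at hi
      by_cases hik : i = kc (key b)
      · subst hik; rw [Function.update_self]; exact ⟨h1, rfl⟩
      · rw [hkey _ i hk (by omega)]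
        exact h.sound _ hk i (by omega)
    · rw [Function.update_of_ne hkb] at hi
      rw [hkey k i hk hi]
      exact h.sound k hk i hi
  · rcases Nat.lt_succ_iff_lt_or_eq.mp hv with hv | rfl
    · obtain ⟨i, hi, he⟩ := h.complete v hv h3 h4
      refine ⟨i, ?_, by rw [hkey _ i h4 hi, he]⟩
      rw [Function.update_apply]
      split_ifs with hax
      · rw [hax] at hi; omega
      · exact hi
    · exact ⟨kc (key v), by simp, by simp⟩

theorem run_fillBuckets {σ : State} (hW : Big n m w) (hn : σ.reg 0 = n)
    (hok : ∀ v, ok v ↔ v < n ∧ σ.mem 11 v ≠ 0) (hkey : ∀ v < n, σ.mem 12 v = key v)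
    (h0 : ∀ k < n, σ.mem 14 k = 0) :
    RunT w ω fillBuckets σ (60 * n + 10) fun τ =>
      Buckets n ok key n (τ.mem 14) (τ.mem 15) ∧ Frame [14, 15] 40 σ τ := by
  unfold Big at hW
  refine RunT.forTo (N := n) (fun v τ => τ.reg 40 = v ∧ Buckets n ok key v (τ.mem 14) (τ.mem 15) ∧
    Frame [14, 15] 40 σ τ) 50 (by omega) ?_ ?_ ?_ ?_ ?_
  · refine ⟨by simp, ⟨?_, fun k hk i hi => ?_, fun v hv => by omega⟩, by simp⟩
    · rw [Finset.sum_eq_zero]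
      intro k hk
      simpa using h0 k (by simpa using hk)
    · rw [setReg_mem, h0 k hk] at hi
      omega
  · rintro v τ - ⟨h1, -, h2⟩
    exact ⟨h1, by simp [h2.2, hn]⟩
  · rintro v τ hv ⟨h1, h2, h3⟩
    have hn' := h3.2 0 (by simp)
    have h11 := h3.1 11 (by simp)
    have h12 := h3.1 12 (by simp)
    rw [hn] at hn'
    have hkv := hkey v hv
    by_cases h4 : σ.mem 11 v = 0
    · simp (disch := omega) [RunT, h1, h11, h4]
      exact ⟨h2.skip (fun h => ((hok v).mp h.1).2 h4), h3⟩
    · by_cases h5 : key v < n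
      · have h6 := h2.le h5
        have := row_le n h5
        have h7 := h2.push hv ((hok v).mpr ⟨hv, h4⟩) h5
        simp (disch := omega) [RunT, h1, h11, h12, h4, hkv, h5, hn', Nat.mod_eq_of_lt]
        exact ⟨⟨h7, by simpa using h3⟩, fun h => by omega⟩
      · simp (disch := omega) [RunT, h1, h11, h12, h4, hkv, h5, hn']
        exact fun _ => ⟨h2.skip (fun h => h5 h.2), h3⟩
  · rintro τ ⟨-, h2, h3⟩
    exact ⟨h2, h3⟩
  · simp; omega

end

/-- The situation before round `d` of the search: the first `lo` vertices of the queue are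
processed, and the others have distance `d`. -/
structure RoundInv (n : ℕ) (E : ℕ → ℕ → Prop) (ok : ℕ → Prop) (key : ℕ → ℕ) (d : ℕ) (D Q : ℕ → ℕ)
    (lo hi : ℕ) : Prop where
  inv : QInv n E ok key d D Q hi
  le : lo ≤ hi
  done : ∀ i < lo, ∀ u, ok u → E (Q i) u → D u ≤ D (Q i) + 1
  todo : ∀ i, lo ≤ i → i < hi → D (Q i) = d
  starts : ∀ v, ok v → key v < d → D v ≤ key v

section

variable {w : ℕ} [NeZero w] {ω : ℕ → Bool} {n m : ℕ} {E : ℕ → ℕ → Prop} {ok : ℕ → Prop}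
  {key : ℕ → ℕ}

/-- The time of a round is paid for by the starts at distance `d` and by the vertices which the
round processes, that is, by the increase of the sum over the processed part of the queue. -/
theorem run_bfsRound {d c : ℕ} {τ : State} (hW : Big n m w) (hn : τ.reg 0 = n) (hm : τ.reg 1 = m)
    (hd : τ.reg 42 = d) (hdn : d < n) (hok : ∀ v, ok v ↔ v < n ∧ τ.mem 11 v ≠ 0)
    (hE : ∀ x y, E x y → y < n) (A : AdjInv n m E E c (τ.mem 4) (τ.mem 5))
    (K : Buckets n ok key n (τ.mem 14) (τ.mem 15))
    (h : RoundInv n E ok key d (τ.mem 13) (τ.mem 16) (τ.reg 43) (τ.reg 48)) :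
    Run w ω bfsRound τ fun t υ => υ.reg 42 = d ∧ Frame [13, 16] 40 τ υ ∧
      RoundInv n E ok key (d + 1) (υ.mem 13) (υ.mem 16) (υ.reg 43) (υ.reg 48) ∧
      t + ∑ i ∈ Finset.range (τ.reg 43), (τ.mem 4 (τ.mem 16 i) * 75 + 24) ≤
        τ.mem 14 d * 70 + 40 +
          ∑ i ∈ Finset.range (υ.reg 43), (τ.mem 4 (υ.mem 16 i) * 75 + 24) := by
  have hW' := hW
  unfold Big at hW'
  rw [bfsRound, run_seq, run_assign, run_seq]
  refine (run_starts (τ := τ.setReg 41 ((Expr.reg 42).eval w τ)) (d := d) (E := E) (ok := ok)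
    (key := key) hW (by simp [hn]) (by simp [hd]) hdn
    (by simp [hd]) hok (K.le hdn) (K.sound d hdn) (by simpa using h.inv)).run ?_
  rintro t1 τ1 ht1 ⟨f1, q1, e1, s1⟩
  simp only [setReg_mem, setReg_reg, Nat.reduceEqDiff, ↓reduceIte] at ht1 e1 s1
  have hlo1 : τ1.reg 43 = τ.reg 43 := by simp [f1.2]
  have hd1 : τ1.reg 42 = d := by simp [f1.2, hd]
  have h11 : τ1.mem 11 = τ.mem 11 := by simp [f1.1]
  have h4 : τ1.mem 4 = τ.mem 4 := by simp [f1.1]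
  have h5 : τ1.mem 5 = τ.mem 5 := by simp [f1.1]
  have hle1 := e1.le
  have hlo := h.le
  have htodo : ∀ i, τ.reg 43 ≤ i → i < τ1.reg 48 → τ1.mem 13 (τ1.mem 16 i) = d := by
    intro i h1 h2
    by_cases h3 : i < τ.reg 48
    · have := h.inv.mem i h3
      rw [e1.queue i h3, e1.dist _ this.1 this.2.2, h.todo i h1 h3]
    · exact e1.new i (by omega) h2
  rw [run_seq, run_assign, run_seq, run_assign]
  refine (run_scan (d := d) (l := τ.reg 43) (lim := τ1.reg 48) (c := c) (E := E) (ok := ok)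
    (key := key) hW (by simp [f1.2, hn]) (by simp [f1.2, hm]) ?_ (by simp [hlo1]) (by simp)
    (by simpa [h11] using hok) hE (by simpa [h4, h5] using A)
    (by simpa using q1.weaken (Nat.le_succ d)) (by omega) (by simp)
    (by simpa using htodo)).run ?_
  · simp (disch := omega) [hd1, Nat.mod_eq_of_lt]
  rintro t2 τ2 ht2 ⟨l2, f2, q2, e2, s2⟩
  simp only [setReg_mem, setReg_reg, Nat.reduceEqDiff, ↓reduceIte] at ht2 e2 s2
  have q1' := q1.weaken (Nat.le_succ d)
  have hQ : ∀ i < τ.reg 48, τ2.mem 16 i = τ.mem 16 i := fun i hi => by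
    rw [e2.queue i (by omega), e1.queue i hi]
  have hD : ∀ v < n, τ.mem 13 v < n → τ2.mem 13 v = τ.mem 13 v := fun v hv hvd => by
    have := e1.dist v hv hvd
    rw [e2.dist v hv (by omega), this]
  have hmono : ∀ v < n, τ2.mem 13 v ≤ τ.mem 13 v := fun v hv => by
    have := h.inv.le v hv
    have := q2.le v hv
    by_cases hvd : τ.mem 13 v < n
    · exact (hD v hv hvd).le
    · omega
  refine ⟨by simp [f2.2, hd1], ?_, ⟨q2, by rw [l2]; exact e2.le, fun i hi u hu hiu => ?_,
    fun i h1 h2 => e2.new i (by omega) h2, fun v hv hk => ?_⟩, ?_⟩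
  · refine ⟨fun a ha => ?_, fun x hx => ?_⟩
    · have := f2.1 a ha
      simp only [setReg_mem] at this
      rw [this, f1.1 a ha, setReg_mem]
    · have h1 := f2.2 x (by omega)
      have h2 := f1.2 x (by omega)
      simp only [setReg_reg] at h1 h2
      rw [if_neg (by omega), if_neg (by omega)] at h1
      rw [if_neg (by omega)] at h2
      rw [h1, h2]
  · by_cases h1 : i < τ.reg 43
    · rw [hQ i (by omega)] at hiu ⊢
      have h2 := h.inv.mem i (by omega)
      rw [hD _ h2.1 h2.2.2]
      exact (hmono u ((hok u).mp hu).1).trans (h.done i h1 u hu hiu)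
    · rw [l2] at hi
      have h2 := q1.mem i hi
      rw [e2.queue i hi] at hiu ⊢
      rw [e2.dist _ h2.1 h2.2.2, htodo i (by omega) hi]
      exact s2 i (by omega) hi u hu hiu
  · have hvn := ((hok v).mp hv).1
    by_cases h1 : key v < d
    · exact (hmono v hvn).trans (h.starts v hv h1)
    · have h2 : key v = d := by omega
      obtain ⟨i, hi, he⟩ := K.complete v hvn hv (by omega)
      rw [h2] at hi he
      have h3 := s1 i hi
      rw [he] at h3
      have := e2.mono q1' q2 hvn
      omega
  · rw [l2]
    have h1 : ∑ i ∈ Finset.range (τ.reg 43), (τ.mem 4 (τ.mem 16 i) * 75 + 24) =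
        ∑ i ∈ Finset.range (τ.reg 43), (τ.mem 4 (τ2.mem 16 i) * 75 + 24) :=
      Finset.sum_congr rfl fun i hi => by
        rw [hQ i ((Finset.mem_range.mp hi).trans_le hlo)]
    have h2 : ∑ i ∈ Finset.Ico (τ.reg 43) (τ1.reg 48), (τ1.mem 4 (τ1.mem 16 i) * 75 + 24) =
        ∑ i ∈ Finset.Ico (τ.reg 43) (τ1.reg 48), (τ.mem 4 (τ2.mem 16 i) * 75 + 24) :=
      Finset.sum_congr rfl fun i hi => by
        rw [h4, e2.queue i (Finset.mem_Ico.mp hi).2]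
    have h3 := Finset.sum_range_add_sum_Ico (fun i => τ.mem 4 (τ2.mem 16 i) * 75 + 24)
      (show τ.reg 43 ≤ τ1.reg 48 by omega)
    simp only [cost_reg, cost_add, cost_lit]
    omega

/-- The distances computed by the search, and the running time: apart from `O(n)` steps, it is
bounded by the number of edges at the allowed vertices. -/
theorem run_bfs {c : ℕ} {σ : State} (hW : Big n m w) (hn : σ.reg 0 = n) (hm : σ.reg 1 = m)
    (hE : ∀ x y, E x y → x < n ∧ y < n) (A : AdjInv n m E E c (σ.mem 4) (σ.mem 5)) :
    RunT w ω bfs σ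
      (500 * n + 200 + 75 * ∑ v ∈ (Finset.range n).filter (σ.mem 11 · ≠ 0), σ.mem 4 v) fun τ =>
      Bell n E (fun v => v < n ∧ σ.mem 11 v ≠ 0) (σ.mem 12) (τ.mem 13) ∧
      Frame [13, 14, 15, 16] 40 σ τ := by
  have hW' := hW
  unfold Big at hW'
  have hinit : RunT w ω (forTo 40 (.reg 0)
      (.seq (.put 13 (.reg 40) (.reg 0)) (.put 14 (.reg 40) (.lit 0)))) σ (30 * n + 10) fun τ =>
      (∀ v < n, τ.mem 13 v = n ∧ τ.mem 14 v = 0) ∧ Frame [13, 14] 40 σ τ := by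
    refine RunT.forTo (N := n) (fun i τ => τ.reg 40 = i ∧
      (∀ v < i, τ.mem 13 v = n ∧ τ.mem 14 v = 0) ∧ Frame [13, 14] 40 σ τ) 20 (by omega)
      ?_ ?_ ?_ ?_ ?_
    · simp
    · rintro i τ - ⟨h1, -, h3⟩
      exact ⟨h1, by simp [h3.2, hn]⟩
    · rintro i τ hi ⟨h1, h2, h3⟩
      have hn' := h3.2 0 (by simp)
      rw [hn] at hn'
      simp (disch := omega) [RunT, h1, hn']
      refine ⟨fun v hv => ?_, by simpa using h3⟩
      simp only [Function.update_apply]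
      split_ifs with h
      · simp
      · exact h2 v (by omega)
    · exact fun τ h => h.2
    · simp; omega
  refine RunT.seq hinit (T₂ := 470 * n + 180 +
    75 * ∑ v ∈ (Finset.range n).filter (σ.mem 11 · ≠ 0), σ.mem 4 v) ?_ (by omega)
  rintro τ ⟨h1, h2⟩
  have h11 := h2.1 11 (by simp)
  have h12 := h2.1 12 (by simp)
  refine RunT.seq (run_fillBuckets (ok := fun v => v < n ∧ σ.mem 11 v ≠ 0) (key := σ.mem 12) hW
    (by simp [h2.2, hn]) (by simp [h11]) (by simp [h12]) fun k hk => (h1 k hk).2)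
    (T₂ := 400 * n + 160 +
    75 * ∑ v ∈ (Finset.range n).filter (σ.mem 11 · ≠ 0), σ.mem 4 v) ?_ (by omega)
  clear hinit
  rintro υ ⟨K, h3⟩
  have h4 : Frame [13, 14, 15, 16] 40 σ υ :=
    (h2.weaken (by simp) le_rfl).trans (h3.weaken (by simp) le_rfl)
  have h13 : υ.mem 13 = τ.mem 13 := h3.1 13 (by simp)
  clear h3 h2
  rw [RunT, run_seq, run_assign, run_seq, run_assign, forTo, run_seq, run_assign]
  refine Run.upTo (a := 0) (N := n) (fun d t ρ => ρ.reg 42 = d ∧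
    Frame [13, 16] 40 υ ρ ∧ RoundInv n E (fun v => v < n ∧ σ.mem 11 v ≠ 0) (σ.mem 12) d
      (ρ.mem 13) (ρ.mem 16) (ρ.reg 43) (ρ.reg 48) ∧
    t ≤ ∑ k ∈ Finset.range d, (υ.mem 14 k * 70 + 49) +
      ∑ i ∈ Finset.range (ρ.reg 43), (σ.mem 4 (ρ.mem 16 i) * 75 + 24)) (by omega) (Nat.zero_le _)
    ?_ ?_ ?_ ?_
  · refine ⟨by simp, by simp, ?_, by simp⟩
    refine ⟨⟨by simp, by simp, fun v hv h => ?_, fun v hv => ?_, fun v hv h => ?_,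
      fun v hv h => ?_⟩, by simp, by simp, by simp, by simp⟩
    all_goals
      have := (h1 v hv).1
      simp only [setReg_mem, h13] at *
      omega
  · rintro d t ρ - ⟨h5, h6, -⟩
    exact ⟨h5, by simp [h6.2, h4.2, hn]⟩
  · rintro d t ρ - hd ⟨h5, h6, h7, h8⟩
    have g14 : ρ.mem 14 = υ.mem 14 := h6.1 14 (by simp)
    have g15 : ρ.mem 15 = υ.mem 15 := h6.1 15 (by simp)
    have g11 : ρ.mem 11 = σ.mem 11 := by rw [h6.1 11 (by simp), h4.1 11 (by simp)]
    have g4 : ρ.mem 4 = σ.mem 4 := by rw [h6.1 4 (by simp), h4.1 4 (by simp)]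
    have g5 : ρ.mem 5 = σ.mem 5 := by rw [h6.1 5 (by simp), h4.1 5 (by simp)]
    refine (run_bfsRound (d := d) (c := c) hW (by simp [h6.2, h4.2, hn]) (by simp [h6.2, h4.2, hm])
      h5 hd (by simp [g11]) (fun x y h => (hE x y h).2) (by rw [g4, g5]; exact A)
      (by rw [g14, g15]; exact K) h7).mono ?_
    rintro t' ρ' ⟨h9, h10, h11', h12'⟩
    rw [g4, g14] at h12'
    refine ⟨h9, by simp, ?_, by simpa using h11', ?_⟩
    · rw [frame_setReg (by simp)]
      exact h6.trans h10
    · rw [Finset.sum_range_succ]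
      simp only [cost_reg, setReg_reg, setReg_mem, Nat.reduceEqDiff, ↓reduceIte]
      omega
  · rintro t ρ ⟨h5, h6, h7, h8⟩
    -- After round `n - 1` the queue is empty, as a remaining vertex would have distance `n`.
    have hlo : ρ.reg 43 = ρ.reg 48 := by
      by_contra hne
      have h9 := h7.le
      have h10 := h7.todo _ le_rfl (by omega)
      have := (h7.inv.mem _ (show ρ.reg 43 < ρ.reg 48 by omega)).2.2
      omega
    refine ⟨?_, ⟨fun v hv => h7.inv.le v hv.1, fun v hv => ?_, fun u v hu hv huv => ?_,
      fun v hv h => h7.inv.just v hv.1 h⟩, ?_⟩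
    · have h9 : ∑ k ∈ Finset.range n, (υ.mem 14 k * 70 + 49) ≤ 119 * n := by
        rw [Finset.sum_add_distrib, ← Finset.sum_mul]
        have := K.sum
        simp
        omega
      -- each allowed vertex enters the queue at most once
      have h10 : ∑ i ∈ Finset.range (ρ.reg 43), (σ.mem 4 (ρ.mem 16 i) * 75 + 24) ≤
          ∑ v ∈ (Finset.range n).filter (σ.mem 11 · ≠ 0), (σ.mem 4 v * 75 + 24) := by
        rw [hlo, ← Finset.sum_image (f := fun v => σ.mem 4 v * 75 + 24) (g := ρ.mem 16)
          (fun i hi j hj => h7.inv.inj i (by simpa using hi) j (by simpa using hj))]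
        refine Finset.sum_le_sum_of_subset fun v hv => ?_
        obtain ⟨i, hi, rfl⟩ := Finset.mem_image.mp hv
        have := h7.inv.mem i (by simpa using hi)
        simpa using this.2.1
      have h11' : ∑ v ∈ (Finset.range n).filter (σ.mem 11 · ≠ 0), (σ.mem 4 v * 75 + 24) ≤
          75 * ∑ v ∈ (Finset.range n).filter (σ.mem 11 · ≠ 0), σ.mem 4 v + 24 * n := by
        rw [Finset.sum_add_distrib, ← Finset.sum_mul]
        have := Finset.card_filter_le (Finset.range n) (σ.mem 11 · ≠ 0)
        rw [Finset.card_range] at this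
        simp only [Finset.sum_const, smul_eq_mul]
        omega
      simp only [cost_reg, cost_lit]
      omega
    · by_cases hk : σ.mem 12 v < n
      · exact h7.starts v hv hk
      · have := h7.inv.le v hv.1
        omega
    · have := h7.inv.le v hv.1
      by_cases hu' : ρ.mem 13 u < n
      · obtain ⟨i, hi, rfl⟩ := h7.inv.surj u hu.1 hu'
        exact h7.done i (by omega) v hv huv
      · omega
    · exact h4.trans (h6.weaken (by simp) le_rfl)

end

/-! ### The breadth-first tree -/

/-- Search from the vertex in register `30` among the vertices whose entry in array `6` is at least
register `31`. -/
def searchFrom : Cmd :=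
  .seq (forTo 32 (.reg 0) (.seq (.ite ((Expr.get 6 (.reg 32)).less (.reg 31))
    (.put 11 (.reg 32) (.lit 0)) (.put 11 (.reg 32) (.lit 1))) (.put 12 (.reg 32) (.reg 0)))) <|
  .seq (.put 12 (.reg 30) (.lit 0)) bfs

/-- Copy the first `n` entries of array `13` to array `6`. -/
def copyDist : Cmd := forTo 32 (.reg 0) (.put 6 (.reg 32) (.get 13 (.reg 32)))

/-- Make the vertex in register `x` the parent of the one in register `y`, if the depths permit. -/
def link (x y : ℕ) : Cmd :=
  .ite ((Expr.get 6 (.reg x) + .lit 1).same (.get 6 (.reg y)))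
    (.ite ((Expr.get 6 (.reg y)).less (.reg 0)) (.put 2 (.reg y) (.reg x)) .skip) .skip

/-- Array `2` receives the parents. -/
def buildPar : Cmd :=
  .seq (forTo 32 (.reg 0) (.put 2 (.reg 32) (.reg 0))) <|
  forTo 32 (.reg 1) <| .seq (.assign 33 (.get 0 (.reg 32))) <|
    .seq (.assign 34 (.get 1 (.reg 32))) <| .seq (link 33 34) (link 34 33)

section

variable {w : ℕ} [NeZero w] {ω : ℕ → Bool} {n m : ℕ} {E : ℕ → ℕ → Prop}

theorem run_searchFrom {r l : ℕ} {σ : State} (hW : Big n m w) (hn : σ.reg 0 = n) (hm : σ.reg 1 = m)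
    (hr : σ.reg 30 = r) (hl : σ.reg 31 = l) (hrn : r < n)
    (hE : ∀ x y, E x y → x < n ∧ y < n) (A : AdjInv n m E E (2 * m) (σ.mem 4) (σ.mem 5)) :
    RunT w ω searchFrom σ (600 * n + 300 + 150 * m) fun τ =>
      Bell n E (fun v => v < n ∧ l ≤ σ.mem 6 v) (srcKey n r) (τ.mem 13) ∧
      Frame [11, 12, 13, 14, 15, 16] 32 σ τ := by
  have hW' := hW
  unfold Big at hW'
  have h1 : RunT w ω (forTo 32 (.reg 0) (.seq (.ite ((Expr.get 6 (.reg 32)).less (.reg 31))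
      (.put 11 (.reg 32) (.lit 0)) (.put 11 (.reg 32) (.lit 1))) (.put 12 (.reg 32) (.reg 0)))) σ
      (50 * n + 10) fun τ => (∀ v < n, (τ.mem 11 v ≠ 0 ↔ l ≤ σ.mem 6 v) ∧ τ.mem 12 v = n) ∧
      Frame [11, 12] 32 σ τ := by
    refine RunT.forTo (N := n) (fun i τ => τ.reg 32 = i ∧
      (∀ v < i, (τ.mem 11 v ≠ 0 ↔ l ≤ σ.mem 6 v) ∧ τ.mem 12 v = n) ∧ Frame [11, 12] 32 σ τ) 30
      (by omega) ?_ ?_ ?_ ?_ ?_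
    · simp
    · rintro i τ - ⟨h1, -, h3⟩
      exact ⟨h1, by simp [h3.2, hn]⟩
    · rintro i τ hi ⟨h1, h2, h3⟩
      have hn' := h3.2 0 (by simp)
      have hl' := h3.2 31 (by simp)
      have h6 := h3.1 6 (by simp)
      rw [hn] at hn'
      rw [hl] at hl'
      simp (disch := omega) [RunT, h1, hn', hl', h6]
      constructor
      all_goals
        intro h
        refine ⟨fun v hv => ?_, by simpa using h3⟩
        by_cases hvi : v = i
        · subst hvi; simpa using h
        · have := h2 v (by omega)
          simp only [Function.update_of_ne hvi]
          simpa [Nat.pos_iff_ne_zero] using this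
    · exact fun τ h => h.2
    · simp; omega
  refine RunT.seq h1 (T₂ := 550 * n + 280 + 150 * m) ?_ (by omega)
  rintro τ ⟨h2, h3⟩
  have h5 : ∑ v ∈ (Finset.range n).filter (fun v => τ.mem 11 v ≠ 0), σ.mem 4 v ≤ 2 * m := by
    rw [← A.sum]
    exact Finset.sum_le_sum_of_subset (Finset.filter_subset _ _)
  refine RunT.seq (T₁ := 5) (P := fun υ => υ = τ.setMem 12 r 0)
    (T₂ := 500 * n + 200 + 150 * m) ?_ ?_ (by omega)
  · simp [RunT, h3.2, hr]
  · rintro _ rfl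
    refine (run_bfs (E := E) (c := 2 * m) hW (by simp [h3.2, hn]) (by simp [h3.2, hm]) hE
      (by simpa [h3.1] using A)).mono ?_ ?_
    · simp [h3.1] at h5 ⊢
      omega
    · rintro υ ⟨h6, h7⟩
      refine ⟨h6.congr (fun v => ?_) (fun v hv => ?_) (fun _ _ => rfl), ?_⟩
      · refine and_congr_right fun hv => ?_
        simpa using (h2 v hv).1
      · simp only [setMem_mem, ↓reduceIte, Function.update_apply, srcKey]
        split_ifs
        · rfl
        · exact (h2 v hv.1).2
      · refine Frame.trans (τ := τ.setMem 12 r 0) ?_ (h7.weaken (by simp) (by simp))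
        simpa using h3.weaken (by simp) le_rfl

theorem run_copyDist {σ : State} (hW : Big n m w) (hn : σ.reg 0 = n) :
    RunT w ω copyDist σ (30 * n + 10) fun τ =>
      (∀ v < n, τ.mem 6 v = σ.mem 13 v) ∧ Frame [6] 32 σ τ := by
  unfold Big at hW
  refine RunT.forTo (N := n) (fun i τ => τ.reg 32 = i ∧
    (∀ v < i, τ.mem 6 v = σ.mem 13 v) ∧ Frame [6] 32 σ τ) 20 (by omega) ?_ ?_ ?_ ?_ ?_
  · simp
  · rintro i τ - ⟨h1, -, h3⟩
    exact ⟨h1, by simp [h3.2, hn]⟩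
  · rintro i τ hi ⟨h1, h2, h3⟩
    have h13 := h3.1 13 (by simp)
    simp (disch := omega) [RunT, h1, h13]
    refine ⟨fun v hv => ?_, by simpa using h3⟩
    simp only [Function.update_apply]
    split_ifs with h
    · rw [h]
    · exact h2 v (by omega)
  · exact fun τ h => h.2
  · simp; omega

/-- All entries of `par` are legal parents, or `n`. -/
def ParInv (n : ℕ) (E : ℕ → ℕ → Prop) (dep par : ℕ → ℕ) : Prop :=
  ∀ v < n, par v = n ∨ (E (par v) v ∧ dep (par v) + 1 = dep v ∧ dep v < n)

theorem run_link {x y a b : ℕ} {τ : State} (hW : Big n m w) (hn : τ.reg 0 = n)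
    (ha : τ.reg x = a) (hb : τ.reg y = b) (hE : E a b) (han : a < n)
    (hda : τ.mem 6 a ≤ n) (h : ParInv n E (τ.mem 6) (τ.mem 2)) :
    RunT w ω (link x y) τ 30 fun υ => Frame [2] 1000 τ υ ∧ υ.reg = τ.reg ∧
      ParInv n E (τ.mem 6) (υ.mem 2) ∧ (∀ v, τ.mem 2 v ≠ n → υ.mem 2 v ≠ n) ∧
      (τ.mem 6 a + 1 = τ.mem 6 b → τ.mem 6 b < n → υ.mem 2 b ≠ n) := by
  unfold Big at hW
  simp (disch := omega) [RunT, link, hn, ha, hb, Nat.mod_eq_of_lt]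
  refine ⟨fun h1 => ⟨fun h2 => ⟨by simp, ?_, fun v hv => ?_, fun _ _ => ?_⟩, fun h2 => ⟨h, fun _ => ?_⟩⟩,
    fun h1 => ⟨h, fun h2 => (h1 h2).elim⟩⟩
  · intro v hv
    by_cases hvb : v = b
    · subst hvb
      right
      rw [Function.update_self]
      exact ⟨hE, h1, h2⟩
    · rw [Function.update_of_ne hvb]
      exact h v hv
  · simp only [Function.update_apply]
    split_ifs
    · omega
    · exact hv
  · omega
  · omega

theorem run_buildPar {s : ℕ} {σ : State} (hW : Big n m w) (hn : σ.reg 0 = n) (hm : σ.reg 1 = m)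
    (hs : s < n) (hE : ∀ x y, E x y ↔ ∃ j < m,
      (σ.mem 0 j = x ∧ σ.mem 1 j = y) ∨ (σ.mem 1 j = x ∧ σ.mem 0 j = y))
    (hlt : ∀ x y, E x y → x < n ∧ y < n)
    (B : Bell n E (· < n) (srcKey n s) (σ.mem 6)) :
    RunT w ω buildPar σ (30 * n + 100 * m + 30) fun τ =>
      IsTree n E s (σ.mem 6) (τ.mem 2) ∧
      (∀ v < n, v = s ∨ σ.mem 6 v = n → τ.mem 2 v = n) ∧ Frame [2] 32 σ τ := by
  have hW' := hW
  unfold Big at hW'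
  have h0 : RunT w ω (forTo 32 (.reg 0) (.put 2 (.reg 32) (.reg 0))) σ (30 * n + 10) fun τ =>
      (∀ v < n, τ.mem 2 v = n) ∧ Frame [2] 32 σ τ := by
    refine RunT.forTo (N := n) (fun i τ => τ.reg 32 = i ∧
      (∀ v < i, τ.mem 2 v = n) ∧ Frame [2] 32 σ τ) 20 (by omega) ?_ ?_ ?_ ?_ ?_
    · simp
    · rintro i τ - ⟨h1, -, h3⟩
      exact ⟨h1, by simp [h3.2, hn]⟩
    · rintro i τ hi ⟨h1, h2, h3⟩
      have h13 := h3.2 0 (by simp)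
      rw [hn] at h13
      simp (disch := omega) [RunT, h1, h13]
      refine ⟨fun v hv => ?_, by simpa using h3⟩
      simp only [Function.update_apply]
      split_ifs with h
      · rfl
      · exact h2 v (by omega)
    · exact fun τ h => h.2
    · simp; omega
  refine RunT.seq h0 (T₂ := 100 * m + 15) ?_ (by omega)
  rintro τ0 ⟨h1, h2⟩
  refine RunT.forTo (N := m) (fun j τ => τ.reg 32 = j ∧ Frame [2] 32 τ0 τ ∧
    ParInv n E (σ.mem 6) (τ.mem 2) ∧ ∀ j' < j, ∀ x y,
      (σ.mem 0 j' = x ∧ σ.mem 1 j' = y) ∨ (σ.mem 1 j' = x ∧ σ.mem 0 j' = y) →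
      σ.mem 6 x + 1 = σ.mem 6 y → σ.mem 6 y < n → τ.mem 2 y ≠ n) 80 (by omega) ?_ ?_ ?_ ?_ ?_
  · exact ⟨by simp, by simp, fun v hv => .inl (by simpa using h1 v hv), by simp⟩
  · rintro i τ - ⟨h1, h3, -⟩
    exact ⟨h1, by simp [h3.2, h2.2, hm]⟩
  · rintro j τ hj ⟨h3, h4, h5, h6⟩
    have g0 : τ.mem 0 = σ.mem 0 := by rw [h4.1 0 (by simp), h2.1 0 (by simp)]
    have g1 : τ.mem 1 = σ.mem 1 := by rw [h4.1 1 (by simp), h2.1 1 (by simp)]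
    have g6 : τ.mem 6 = σ.mem 6 := by rw [h4.1 6 (by simp), h2.1 6 (by simp)]
    have e1 : E (σ.mem 0 j) (σ.mem 1 j) := (hE _ _).mpr ⟨j, hj, .inl ⟨rfl, rfl⟩⟩
    have e2 : E (σ.mem 1 j) (σ.mem 0 j) := (hE _ _).mpr ⟨j, hj, .inr ⟨rfl, rfl⟩⟩
    have hn' : τ.reg 0 = n := by rw [h4.2 0 (by simp), h2.2 0 (by simp), hn]
    rw [RunT, run_seq, run_assign, run_seq, run_assign, run_seq]
    refine (run_link (τ := (τ.setReg 33 ((Expr.get 0 (.reg 32)).eval w τ)).setReg 34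
      ((Expr.get 1 (.reg 32)).eval w (τ.setReg 33 ((Expr.get 0 (.reg 32)).eval w τ))))
      (E := E) (a := σ.mem 0 j) (b := σ.mem 1 j) hW (by simp [hn'])
      (by simp [h3, g0]) (by simp [h3, g1]) e1 (hlt _ _ e1).1
      (by simpa [g6] using B.le_top _ (hlt _ _ e1).1) (by simpa [g6] using h5)).run ?_
    rintro t1 τ1 ht1 ⟨f1, r1, p1, q1, s1⟩
    simp only [setReg_mem, g6] at p1 q1 s1
    have g6' : τ1.mem 6 = σ.mem 6 := by rw [f1.1 6 (by simp), setReg_mem, setReg_mem, g6]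
    refine (run_link (τ := τ1) (E := E) (a := σ.mem 1 j) (b := σ.mem 0 j) hW (by simp [r1, hn'])
      (by simp [r1, h3, g1]) (by simp [r1, h3, g0]) e2 (hlt _ _ e2).1
      (by simpa [g6'] using B.le_top _ (hlt _ _ e2).1) (by simpa [g6'] using p1)).run ?_
    rintro t2 τ2 ht2 ⟨f2, r2, p2, q2, s2⟩
    rw [g6'] at p2 s2
    refine ⟨by simp; omega, by simp [r2, r1, h3], by simp, ?_, by simpa using p2, ?_⟩
    · rw [frame_setReg le_rfl]
      have h7 := (f1.weaken (List.Subset.refl _) (show 32 ≤ 1000 by simp)).trans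
        (f2.weaken (List.Subset.refl _) (show 32 ≤ 1000 by simp))
      exact h4.trans ((h7.of_setReg (by simp)).of_setReg (by simp))
    · intro j' hj' x y hxy hd hy
      simp only [setReg_mem]
      rcases Nat.lt_succ_iff_lt_or_eq.mp hj' with hj' | rfl
      · exact q2 _ (q1 _ (h6 j' hj' x y hxy hd hy))
      · rcases hxy with ⟨rfl, rfl⟩ | ⟨rfl, rfl⟩
        · exact q2 _ (s1 hd hy)
        · exact s2 hd hy
  · rintro τ ⟨-, h3, h4, h5⟩
    have hds : σ.mem 6 s = 0 := by
      have := B.le_key s hs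
      rw [srcKey, if_pos rfl] at this
      omega
    have hpar : ∀ v < n, σ.mem 6 v < n → v ≠ s →
        E (τ.mem 2 v) v ∧ σ.mem 6 (τ.mem 2 v) + 1 = σ.mem 6 v := by
      intro v hv hd hvs
      rcases h4 v hv with h6 | h6
      · rcases B.attained v hv hd with h7 | ⟨u, hu, huv, h7⟩
        · rw [srcKey, if_neg hvs] at h7
          omega
        · obtain ⟨j, hj, h8⟩ := (hE u v).mp huv
          exact (h5 j hj u v h8 h7.symm hd h6).elim
      · exact ⟨h6.1, h6.2.1⟩
    refine ⟨⟨fun x y h => ?_, fun x y h => (hlt x y h).1, hs, hds, B.le_top, fun u v h =>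
      B.le_step u v (hlt u v h).1 (hlt u v h).2 h, fun v hv h => ?_, fun v hv hd hvs =>
      (hpar v hv hd hvs).1, fun v hv hd hvs => (hpar v hv hd hvs).2⟩, fun v hv h => ?_, h2.trans h3⟩
    · obtain ⟨j, hj, h⟩ := (hE x y).mp h
      exact (hE y x).mpr ⟨j, hj, h.symm.imp (fun h => ⟨h.2, h.1⟩) (fun h => ⟨h.2, h.1⟩)⟩
    · rcases B.attained v hv (by omega) with h7 | ⟨u, hu, huv, h7⟩
      · rw [srcKey] at h7
        split_ifs at h7 with h8
        · exact h8
        · omega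
      · omega
    · rcases h4 v hv with h6 | ⟨h6, h7, h8⟩
      · exact h6
      · rcases h with rfl | h
        · omega
        · omega
  · simp; omega

end

/-! ### Ancestors and lowest common ancestors -/

/-- Entry `q * n + t` of array `7` tells whether `q` is an ancestor of `t`. -/
def buildAnc : Cmd :=
  forTo 32 (.reg 0) <| .ite ((Expr.get 6 (.reg 32)).less (.reg 0))
    (.seq (.assign 33 (.reg 32)) (forTo 34 (.get 6 (.reg 32) + .lit 1)
      (.seq (.put 7 (.reg 33 * .reg 0 + .reg 32) (.lit 1)) (.assign 33 (.get 2 (.reg 33)))))) .skip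

/-- Entry `x * n + r` of array `8` is the depth of the lowest common ancestor of `x` and `r`; the
vertices `x` are treated in the order of their depths. -/
def buildLca : Cmd :=
  forTo 32 (.reg 0) <| forTo 33 (.reg 0) <| .ite ((Expr.get 6 (.reg 33)).same (.reg 32))
    (forTo 34 (.reg 0) (.ite (.get 7 (.reg 33 * .reg 0 + .reg 34))
      (.put 8 (.reg 33 * .reg 0 + .reg 34) (.reg 32))
      (.put 8 (.reg 33 * .reg 0 + .reg 34) (.get 8 (.get 2 (.reg 33) * .reg 0 + .reg 34))))) .skip

section

variable {w : ℕ} [NeZero w] {ω : ℕ → Bool} {n m : ℕ} {E : ℕ → ℕ → Prop} {s : ℕ}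

/-- Writing to an entry of a two-dimensional array with rows of length `c`. -/
theorem update_row {f : ℕ → ℕ} {c x y v x' y' : ℕ} (hy : y < c) (hy' : y' < c) :
    Function.update f (x * c + y) v (x' * c + y') =
      if x' = x ∧ y' = y then v else f (x' * c + y') := by
  simp only [Function.update_apply, idx_inj hy' hy]

/-- The marks of `t` are set while climbing from `t` to the root, which takes `dep t + 1` steps. -/
theorem run_buildAnc {σ : State} (hW : Big n m w) (hn : σ.reg 0 = n)
    (T : IsTree n E s (σ.mem 6) (σ.mem 2)) (h7 : ∀ i, σ.mem 7 i = 0) :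
    RunT w ω buildAnc σ (40 * (n * n) + 100 * n + 10) fun τ =>
      (∀ q < n, ∀ t < n, τ.mem 7 (q * n + t) ≠ 0 ↔ Anc n (σ.mem 6) (σ.mem 2) q t) ∧
      Frame [7] 32 σ τ := by
  unfold Big at hW
  refine RunT.forTo (N := n) (fun i τ => τ.reg 32 = i ∧
    (∀ q < n, ∀ t < n, τ.mem 7 (q * n + t) ≠ 0 ↔ t < i ∧ Anc n (σ.mem 6) (σ.mem 2) q t) ∧
    Frame [7] 32 σ τ) (30 * n + 60) (by omega) ?_ ?_ ?_ ?_ ?_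
  · simp [h7]
  · rintro i τ - ⟨h1, -, h3⟩
    exact ⟨h1, by simp [h3.2, hn]⟩
  · rintro t τ ht ⟨h1, h2, h3⟩
    have hn' := h3.2 0 (by simp)
    rw [hn] at hn'
    have g6 := h3.1 6 (by simp)
    have g2 := h3.1 2 (by simp)
    by_cases hd : σ.mem 6 t < n
    · have hloop : RunT w ω (forTo 34 (.get 6 (.reg 32) + .lit 1)
          (.seq (.put 7 (.reg 33 * .reg 0 + .reg 32) (.lit 1)) (.assign 33 (.get 2 (.reg 33)))))
          (τ.setReg 33 t) (30 * n + 40) fun υ =>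
          (∀ q < n, ∀ t' < n, υ.mem 7 (q * n + t') ≠ 0 ↔ t' < t + 1 ∧
            Anc n (σ.mem 6) (σ.mem 2) q t') ∧ Frame [7] 33 τ υ := by
        refine RunT.forTo (N := σ.mem 6 t + 1) (fun i υ => υ.reg 34 = i ∧ Frame [7] 33 τ υ ∧
          υ.reg 33 = (σ.mem 2)^[i] t ∧
          ∀ q < n, ∀ t' < n, υ.mem 7 (q * n + t') ≠ 0 ↔ (t' < t ∧
            Anc n (σ.mem 6) (σ.mem 2) q t') ∨ (t' = t ∧ ∃ k < i, (σ.mem 2)^[k] t = q)) 14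
          (by omega) ?_ ?_ ?_ ?_ ?_
        · refine ⟨by simp, by simp, by simp, ?_⟩
          simpa using h2
        · rintro i υ - ⟨h4, h5, -⟩
          refine ⟨h4, ?_⟩
          have := h5.2 32 (by simp)
          have := h5.1 6 (by simp)
          simp (disch := omega) [*, Nat.mod_eq_of_lt]
        · rintro i υ hi ⟨h4, h5, h6, h8⟩
          have h9 := T.iterate ht hd (show i ≤ σ.mem 6 t by omega)
          have k0 := h5.2 0 (by simp)
          have k32 := h5.2 32 (by simp)
          rw [hn'] at k0
          rw [h1] at k32
          have k2 := h5.1 2 (by simp)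
          rw [g2] at k2
          have := row_le n h9.1
          simp (disch := omega) [RunT, h4, h6, k0, k32, k2, Nat.mod_eq_of_lt]
          refine ⟨by simpa using h5, (Function.iterate_succ_apply' (σ.mem 2) i t).symm,
            fun q hq t' ht' => ?_⟩
          rw [update_row ht ht']
          by_cases hc : q = (σ.mem 2)^[i] t ∧ t' = t
          · rw [if_pos hc]
            simp only [one_ne_zero, not_false_eq_true, true_iff]
            exact .inr ⟨hc.2, i, le_rfl, hc.1.symm⟩
          · rw [if_neg hc]
            refine (h8 q hq t' ht').trans (or_congr Iff.rfl (and_congr_right fun htt => ?_))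
            constructor
            · rintro ⟨k, hk, he⟩
              exact ⟨k, hk.le, he⟩
            · rintro ⟨k, hk, he⟩
              refine ⟨k, lt_of_le_of_ne hk ?_, he⟩
              rintro rfl
              exact hc ⟨he.symm, htt⟩
        · rintro υ ⟨h4, h5, h6, h8⟩
          refine ⟨fun q hq t' ht' => (h8 q hq t' ht').trans ?_, h5⟩
          constructor
          · rintro (h | ⟨rfl, k, hk, he⟩)
            · exact ⟨by omega, h.2⟩
            · exact ⟨by omega, ht', hd, k, by omega, he⟩
          · rintro ⟨h10, h11⟩
            rcases Nat.lt_succ_iff_lt_or_eq.mp h10 with h | rfl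
            · exact .inl ⟨h, h11⟩
            · obtain ⟨-, -, k, hk, he⟩ := h11
              exact .inr ⟨rfl, k, by omega, he⟩
        · simp; omega
      rw [RunT, run_ite]
      refine ⟨fun _ => ?_, fun h => ?_⟩
      · rw [run_seq, run_assign, eval_reg, h1]
        refine hloop.run fun t' υ h4 ⟨h5, h6⟩ => ⟨by simp; omega, by simp [h6.2, h1], by simp,
          by simpa using h5, ?_⟩
        rw [frame_setReg le_rfl]
        exact h3.trans (h6.weaken (List.Subset.refl _) (by simp))
      · simp [h1, g6, hn'] at h
        omega
    · rw [RunT, run_ite]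
      refine ⟨fun h => ?_, fun h => ?_⟩
      · simp [h1, g6, hn'] at h
        omega
      · rw [run_skip]
        refine ⟨by simp, h1, by simp, fun q hq t' ht' => ?_, by simpa using h3⟩
        rw [setReg_mem, h2 q hq t' ht']
        refine ⟨fun h => ⟨by omega, h.2⟩, fun h => ⟨?_, h.2⟩⟩
        rcases Nat.lt_succ_iff_lt_or_eq.mp h.1 with h4 | rfl
        · exact h4
        · exact (hd h.2.2.1).elim
  · rintro τ ⟨-, h2, h3⟩
    refine ⟨fun q hq t ht => ?_, h3⟩
    rw [h2 q hq t ht]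
    simp [ht]
  · simp
    nlinarith

/-- Row `x` is copied from the row of the parent of `x` except at the descendants of `x`. The inner
loop runs once for each `x`, namely when the outer counter is the depth of `x`. -/
theorem run_buildLca {σ : State} (hW : Big n m w) (hn : σ.reg 0 = n)
    (T : IsTree n E s (σ.mem 6) (σ.mem 2)) (hpar : ∀ v < n, σ.mem 2 v ≤ n)
    (hanc : ∀ q < n, ∀ t < n, σ.mem 7 (q * n + t) ≠ 0 ↔ Anc n (σ.mem 6) (σ.mem 2) q t) :
    RunT w ω buildLca σ (100 * (n * n) + 100 * n + 20) fun τ =>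
      (∀ x < n, σ.mem 6 x < n → ∀ r < n, σ.mem 6 r < n →
        IsLcaDepth n (σ.mem 6) (σ.mem 2) x r (τ.mem 8 (x * n + r))) ∧
      Frame [8] 32 σ τ := by
  unfold Big at hW
  refine RunT.forTo_sum (N := n) (fun d τ => τ.reg 32 = d ∧
    (∀ x < n, σ.mem 6 x < d → ∀ r < n, σ.mem 6 r < n →
        IsLcaDepth n (σ.mem 6) (σ.mem 2) x r (τ.mem 8 (x * n + r))) ∧
    Frame [8] 32 σ τ)
    (fun d => ∑ x ∈ Finset.range n, ((if σ.mem 6 x = d then 36 * n + 25 else 10) + 9) + 8)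
    (by omega) ?_ ?_ ?_ ?_ ?_
  · simp
  · rintro i τ - ⟨h1, -, h3⟩
    exact ⟨h1, by simp [h3.2, hn]⟩
  · rintro d τ hdn ⟨h1, h2, h3⟩
    refine RunT.forTo_sum (N := n) (fun y υ => υ.reg 33 = y ∧
      (∀ x < n, (σ.mem 6 x < d ∨ (σ.mem 6 x = d ∧ x < y)) → ∀ r < n, σ.mem 6 r < n →
        IsLcaDepth n (σ.mem 6) (σ.mem 2) x r (υ.mem 8 (x * n + r))) ∧
      Frame [8] 33 τ υ) (fun x => if σ.mem 6 x = d then 36 * n + 25 else 10) (by omega) ?_ ?_ ?_ ?_ ?_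
    · simpa using h2
    · rintro i υ - ⟨k1, -, k3⟩
      exact ⟨k1, by simp [k3.2, h3.2, hn]⟩
    · rintro y υ hy ⟨k1, k2, k3⟩
      have hn' : υ.reg 0 = n := by rw [k3.2 0 (by simp), h3.2 0 (by simp), hn]
      have k32 : υ.reg 32 = d := by rw [k3.2 32 (by simp), h1]
      have g6 : υ.mem 6 = σ.mem 6 := by rw [k3.1 6 (by simp), h3.1 6 (by simp)]
      have g2 : υ.mem 2 = σ.mem 2 := by rw [k3.1 2 (by simp), h3.1 2 (by simp)]
      have g7 : υ.mem 7 = σ.mem 7 := by rw [k3.1 7 (by simp), h3.1 7 (by simp)]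
      by_cases hd : σ.mem 6 y = d
      · rw [if_pos hd]
        rw [RunT, run_ite]
        refine ⟨fun _ => ?_, fun h => ?_⟩
        · refine (RunT.forTo (N := n) (T := 36 * n + 10) (Q := fun ρ => (∀ r < n, σ.mem 6 r < n →
              IsLcaDepth n (σ.mem 6) (σ.mem 2) y r (ρ.mem 8 (y * n + r))) ∧
              (∀ x < n, x ≠ y → ∀ r < n, ρ.mem 8 (x * n + r) = υ.mem 8 (x * n + r)) ∧
              Frame [8] 34 υ ρ) (fun z ρ => ρ.reg 34 = z ∧ (∀ r < z, σ.mem 6 r < n →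
              IsLcaDepth n (σ.mem 6) (σ.mem 2) y r (ρ.mem 8 (y * n + r))) ∧
              (∀ x < n, x ≠ y → ∀ r < n, ρ.mem 8 (x * n + r) = υ.mem 8 (x * n + r)) ∧
              Frame [8] 34 υ ρ) 27 (by omega) ?_ ?_ ?_ ?_ ?_).run ?_
          · simp
          · rintro i ρ - ⟨l1, -, -, l3⟩
            exact ⟨l1, by simp [l3.2, hn']⟩
          · rintro z ρ hz ⟨l1, l2, l3, l4⟩
            have l0 := l4.2 0 (by simp)
            have l32 := l4.2 32 (by simp)
            have l33 := l4.2 33 (by simp)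
            have l6 := l4.1 6 (by simp)
            have l2' := l4.1 2 (by simp)
            have l7 := l4.1 7 (by simp)
            rw [hn'] at l0
            rw [k32] at l32
            rw [k1] at l33
            rw [g6] at l6
            rw [g2] at l2'
            rw [g7] at l7
            have := row_le n hy
            have hpy := hpar y hy
            have := Nat.mul_le_mul_right n hpy
            have hfin : ∀ v, (σ.mem 6 z < n → IsLcaDepth n (σ.mem 6) (σ.mem 2) y z v) →
                (∀ r ≤ z, σ.mem 6 r < n → IsLcaDepth n (σ.mem 6) (σ.mem 2) y r
                  (Function.update (ρ.mem 8) (y * n + z) v (y * n + r))) ∧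
                (∀ x < n, x ≠ y → ∀ r < n, Function.update (ρ.mem 8) (y * n + z) v (x * n + r) =
                  υ.mem 8 (x * n + r)) := by
              intro v hv
              refine ⟨fun r hr hrd => ?_, fun x hx hxy r hr => ?_⟩
              · rw [update_row hz (by omega)]
                split_ifs with hc
                · rw [hc.2] at hrd ⊢
                  exact hv hrd
                · exact l2 r (by omega) hrd
              · rw [update_row hz hr, if_neg (fun h => hxy h.1)]
                exact l3 x hx hxy r hr
            simp (disch := omega) [RunT, l1, l0, l32, l33, l2', l7, Nat.mod_eq_of_lt]
            constructor
            · intro ha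
              have := hfin d fun _ => hd ▸ T.isLcaDepth_of_anc ((hanc y hy z hz).mp ha)
              exact ⟨this.1, this.2, by simpa using l4⟩
            · intro ha
              have := hfin (ρ.mem 8 (σ.mem 2 y * n + z)) fun hzd => by
                have hna : ¬ Anc n (σ.mem 6) (σ.mem 2) y z := fun h =>
                  (hanc y hy z hz).mpr h ha
                have hys : y ≠ s := by
                  rintro rfl
                  exact hna (T.s_anc hz hzd)
                have hyd : σ.mem 6 y < n := by omega
                have hp := T.par_lt hy hyd hys
                have hdp := T.dep_par y hy hyd hys
                refine T.isLcaDepth_of_par hy hyd hys hna ?_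
                rw [l3 _ hp (by intro h; rw [h] at hdp; omega) z hz]
                exact k2 _ hp (.inl (by omega)) z hz hzd
              exact ⟨this.1, this.2, by simpa using l4⟩
          · exact fun ρ h => h.2
          · simp; omega
          · rintro t' ρ ht' ⟨l1, l2, l3⟩
            refine ⟨by simp; omega, by simp [l3.2, k1], by simp, fun x hx hxy r hr hrd => ?_, ?_⟩
            · rw [setReg_mem]
              by_cases hxy' : x = y
              · subst hxy'
                exact l1 r hr hrd
              · rw [l2 x hx hxy' r hr]
                exact k2 x hx (by omega) r hr hrd
            · rw [frame_setReg le_rfl]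
              exact k3.trans (l3.weaken (List.Subset.refl _) (by simp))
        · simp [k1, g6, k32] at h
          omega
      · rw [if_neg hd]
        rw [RunT, run_ite]
        refine ⟨fun h => ?_, fun h => ?_⟩
        · simp [k1, g6, k32] at h
          omega
        · rw [run_skip]
          refine ⟨by simp, k1, by simp, fun x hx hxy r hr hrd => ?_, by simpa using k3⟩
          refine k2 x hx ?_ r hr hrd
          rcases hxy with hxy | ⟨hxy, hxy'⟩
          · exact .inl hxy
          · refine .inr ⟨hxy, lt_of_le_of_ne (by omega) ?_⟩
            rintro rfl
            exact hd hxy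
    · rintro υ ⟨k1, k2, k3⟩
      refine ⟨by simp [k3.2, h1], by simp, fun x hx hxd r hr hrd => ?_, ?_⟩
      · exact k2 x hx (by omega) r hr hrd
      · rw [frame_setReg le_rfl]
        exact h3.trans (k3.weaken (List.Subset.refl _) (by simp))
    · simp
  · rintro τ ⟨-, h2, h3⟩
    exact ⟨h2, h3⟩
  · have h1 : ∑ d ∈ Finset.range n, ∑ x ∈ Finset.range n,
        (if σ.mem 6 x = d then 36 * n + 25 else 10) ≤ n * (36 * n + 25) + n * (n * 10) := by
      rw [Finset.sum_comm]
      have : ∀ x ∈ Finset.range n, ∑ d ∈ Finset.range n,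
          (if σ.mem 6 x = d then 36 * n + 25 else 10) ≤ (36 * n + 25) + n * 10 := by
        intro x _
        calc _ ≤ ∑ d ∈ Finset.range n, ((if σ.mem 6 x = d then 36 * n + 25 else 0) + 10) := by
              refine Finset.sum_le_sum fun d _ => ?_
              split_ifs <;> omega
          _ ≤ _ := by
              rw [Finset.sum_add_distrib, Finset.sum_ite_eq]
              simp only [Finset.sum_const, Finset.card_range, smul_eq_mul]
              split_ifs <;> omega
      have := Finset.sum_le_sum this
      simp only [Finset.sum_const, Finset.card_range, smul_eq_mul] at this
      linarith
    simp only [Finset.sum_add_distrib, Finset.sum_const, Finset.card_range, smul_eq_mul, cost_reg]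
    nlinarith

end

/-! ### The spacing and the offset of the landmark levels -/

/-- Register `3` receives the square root of `n`, rounded up. -/
def buildSqrt : Cmd :=
  .seq (.assign 3 (.lit 1)) <| forTo 32 (.reg 0) <|
    .ite ((Expr.reg 3 * .reg 3).less (.reg 0)) (.assign 3 (.reg 3 + .lit 1)) .skip

/-- Register `4` receives a residue modulo register `3` such that the fewest vertices have a depth
in its class. -/
def buildOffset : Cmd :=
  .seq (.assign 33 (.reg 0 + .lit 1)) <| .seq (.assign 4 (.lit 0)) <| forTo 32 (.reg 3) <|
    .seq (.assign 34 (.lit 0)) <|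
    .seq (forTo 35 (.reg 0) (.ite ((Expr.get 6 (.reg 35)).less (.reg 0))
      (.ite ((Expr.get 6 (.reg 35) % .reg 3).same (.reg 32)) (.assign 34 (.reg 34 + .lit 1)) .skip)
      .skip)) <|
    .ite ((Expr.reg 34).less (.reg 33)) (.seq (.assign 33 (.reg 34)) (.assign 4 (.reg 32))) .skip

/-- The reachable vertices with depth congruent to `a` modulo `K`, among the first `b` vertices. -/
def landmarks (n : ℕ) (dep : ℕ → ℕ) (K a b : ℕ) : Finset ℕ :=
  (Finset.range b).filter fun v => dep v < n ∧ dep v % K = a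

theorem landmarks_succ {n : ℕ} {dep : ℕ → ℕ} {K a b : ℕ} :
    (landmarks n dep K a (b + 1)).card =
      (landmarks n dep K a b).card + if dep b < n ∧ dep b % K = a then 1 else 0 := by
  unfold landmarks
  rw [Finset.range_add_one, Finset.filter_insert]
  split_ifs with h
  · rw [Finset.card_insert_of_notMem (by simp)]
  · simp

/-- The smallest of `K` residue classes of depths has at most `n / K` members. -/
theorem mul_landmarks_le {n K a : ℕ} {dep : ℕ → ℕ}
    (h : ∀ i < K, (landmarks n dep K a n).card ≤ (landmarks n dep K i n).card) :
    K * (landmarks n dep K a n).card ≤ n := by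
  by_cases hK : K = 0
  · subst hK; simp
  have h1 : ∑ i ∈ Finset.range K, (landmarks n dep K a n).card ≤
      ∑ i ∈ Finset.range K, (landmarks n dep K i n).card :=
    Finset.sum_le_sum fun i hi => h i (Finset.mem_range.mp hi)
  have h2 : ∑ i ∈ Finset.range K, (landmarks n dep K i n).card =
      ((Finset.range n).filter fun v => dep v < n).card := by
    rw [Finset.card_eq_sum_card_fiberwise (f := fun v => dep v % K) (t := Finset.range K)]
    · refine Finset.sum_congr rfl fun i _ => ?_
      rw [landmarks, Finset.filter_filter]
    · intro v _
      simpa using Nat.mod_lt _ (Nat.pos_of_ne_zero hK)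
  have h3 := Finset.card_filter_le (Finset.range n) fun v => dep v < n
  simp only [Finset.sum_const, Finset.card_range, smul_eq_mul] at h1 h3
  omega

section

variable {w : ℕ} [NeZero w] {ω : ℕ → Bool} {n m : ℕ}

/-- The last two bounds on `K` are those of a square root of `n` that is rounded up. -/
theorem run_buildSqrt {σ : State} (hW : Big n m w) (hn : σ.reg 0 = n) (hpos : 0 < n) :
    RunT w ω buildSqrt σ (50 * n + 10) fun τ =>
      1 ≤ τ.reg 3 ∧ n ≤ τ.reg 3 * τ.reg 3 ∧ (τ.reg 3 - 1) * (τ.reg 3 - 1) < n ∧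
      Frame [] 3 σ τ := by
  unfold Big at hW
  refine RunT.seq (T₁ := 2) (T₂ := 50 * n + 7) (P := fun τ => τ = σ.setReg 3 1) (by simp [RunT]) ?_
    (by omega)
  rintro _ rfl
  refine RunT.forTo (N := n) (fun i τ => τ.reg 32 = i ∧ 1 ≤ τ.reg 3 ∧
    (τ.reg 3 - 1) * (τ.reg 3 - 1) < n ∧ (n ≤ τ.reg 3 * τ.reg 3 ∨ τ.reg 3 = i + 1) ∧
    Frame [] 3 σ τ) 40 (by omega) ?_ ?_ ?_ ?_ ?_
  · simp [hpos]
  · rintro i τ - ⟨h1, -, -, -, h3⟩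
    exact ⟨h1, by simp [h3.2, hn]⟩
  · rintro i τ hi ⟨h1, h2, h3, h4, h5⟩
    have h6 : τ.reg 3 ≤ n := by
      by_contra h
      have : n * n ≤ (τ.reg 3 - 1) * (τ.reg 3 - 1) := Nat.mul_le_mul (by omega) (by omega)
      have : n * 1 ≤ n * n := Nat.mul_le_mul_left n hpos
      omega
    have h7 := Nat.mul_le_mul h6 h6
    have h8 := h5.2 0 (by simp)
    rw [hn] at h8
    simp (disch := omega) [RunT, h1, h8, Nat.mod_eq_of_lt]
    refine ⟨fun h => ⟨h, ?_, h5⟩, fun h => ⟨h2, h3, .inl h, h5⟩⟩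
    rcases h4 with h4 | h4
    · omega
    · exact .inr h4
  · rintro τ ⟨-, h2, h3, h4, h5⟩
    refine ⟨h2, ?_, h3, h5⟩
    rcases h4 with h4 | h4
    · exact h4
    · rw [h4]; nlinarith
  · simp; omega

theorem run_buildOffset {K : ℕ} {σ : State} (hW : Big n m w) (hn : σ.reg 0 = n)
    (hK : σ.reg 3 = K) (hK1 : 1 ≤ K) (hKn : K ≤ n) (hdep : ∀ v < n, σ.mem 6 v ≤ n) :
    RunT w ω buildOffset σ (K * (60 * n + 60) + 20) fun τ =>
      τ.reg 4 < K ∧ K * (landmarks n (σ.mem 6) K (τ.reg 4) n).card ≤ n ∧ Frame [] 4 σ τ := by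
  unfold Big at hW
  refine RunT.seq (T₁ := 4) (T₂ := K * (60 * n + 60) + 15) (P := fun τ => τ = σ.setReg 33 (n + 1))
    (by simp (disch := omega) [RunT, hn, Nat.mod_eq_of_lt]) ?_ (by omega)
  rintro _ rfl
  refine RunT.seq (T₁ := 2) (T₂ := K * (60 * n + 60) + 10)
    (P := fun τ => τ = (σ.setReg 33 (n + 1)).setReg 4 0) (by simp [RunT]) ?_ (by omega)
  rintro _ rfl
  set c : ℕ → ℕ := fun a => (landmarks n (σ.mem 6) K a n).card
  have hc : ∀ a b, b ≤ n → (landmarks n (σ.mem 6) K a b).card ≤ n := fun a b hb => by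
    have := Finset.card_filter_le (Finset.range b) fun v => σ.mem 6 v < n ∧ σ.mem 6 v % K = a
    rw [Finset.card_range] at this
    exact this.trans hb
  refine RunT.forTo (N := K) (fun i τ => τ.reg 32 = i ∧ τ.reg 4 < K ∧
    (∀ j < i, τ.reg 33 ≤ c j) ∧ (τ.reg 33 = c (τ.reg 4) ∨ τ.reg 33 = n + 1) ∧ τ.reg 33 ≤ n + 1 ∧
    Frame [] 4 σ τ) (50 * n + 40) (by omega) ?_ ?_ ?_ ?_ ?_
  · simp; omega
  · rintro i τ - ⟨h1, -, -, -, -, h3⟩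
    exact ⟨h1, by simp [h3.2, hK]⟩
  · rintro i τ hi ⟨h1, h2, h3, h4, h5, h6⟩
    have hn' := h6.2 0 (by simp)
    rw [hn] at hn'
    have hK' := h6.2 3 (by simp)
    rw [hK] at hK'
    have g6 := h6.1 6 (by simp)
    rw [RunT, run_seq, run_assign, run_seq]
    refine (RunT.forTo (N := n) (T := 50 * n + 10) (Q := fun υ => υ.reg 34 = c i ∧
      Frame [] 34 τ υ) (fun j υ => υ.reg 35 = j ∧
      υ.reg 34 = (landmarks n (σ.mem 6) K i j).card ∧ Frame [] 34 τ υ) 40 (by omega)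
      ?_ ?_ ?_ ?_ ?_).run ?_
    · simp [landmarks]
    · rintro j υ - ⟨k1, -, k3⟩
      exact ⟨k1, by simp [k3.2, hn']⟩
    · rintro j υ hj ⟨k1, k2, k3⟩
      have kn := k3.2 0 (by simp)
      rw [hn'] at kn
      have k32 := k3.2 32 (by simp)
      rw [h1] at k32
      have kK := k3.2 3 (by simp)
      rw [hK'] at kK
      have k6 := k3.1 6 (by simp)
      rw [g6] at k6
      have := hdep j hj
      have hm : σ.mem 6 j % K < K := Nat.mod_lt _ (by omega)
      have := hc i j hj.le
      simp (disch := omega) [RunT, k1, kn, k32, kK, k6, k2, Nat.mod_eq_of_lt, landmarks_succ]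
      refine ⟨fun g1 => ⟨fun g2 => ⟨by simp [g1, g2], k3⟩, fun g2 => ⟨by simp [g2], k3⟩⟩,
        fun g1 => ⟨by omega, k3⟩⟩
    · exact fun υ h => h.2
    · simp; omega
    · rintro t' υ ht' ⟨k1, k2⟩
      have k32 := k2.2 32 (by simp)
      rw [h1] at k32
      have k33 := k2.2 33 (by simp)
      have k4 := k2.2 4 (by simp)
      have hf := h6.trans (k2.weaken (List.Subset.refl _) (show 4 ≤ 34 by simp))
      have hci : c i ≤ n := hc i n le_rfl
      simp (disch := omega) [k1, k32, k33, k4]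
      refine ⟨fun g => ⟨by omega, hi, fun j hj => ?_, by omega, hf⟩, fun g => ⟨by omega, h2,
        fun j hj => ?_, h4, h5, hf⟩⟩
      · rcases hj.lt_or_eq with hj | rfl
        · exact g.le.trans (h3 j hj)
        · exact le_rfl
      · rcases hj.lt_or_eq with hj | rfl
        · exact h3 j hj
        · exact g
  · rintro τ ⟨-, h2, h3, h4, h5, h6⟩
    refine ⟨h2, mul_landmarks_le fun i hi => ?_, h6⟩
    rcases h4 with h4 | h4
    · rw [show (landmarks n (σ.mem 6) K (τ.reg 4) n).card = τ.reg 33 from h4.symm]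
      exact h3 i hi
    · have := h3 0 (by omega)
      have : c 0 ≤ n := hc 0 n le_rfl
      omega
  · simp
    nlinarith

end

/-! ### Searching for a minimum -/

/-- `b` is the minimum of `n` and of `f` over a set between `S` and `P`: in the course of a search
through `P`, the elements of `S` have been taken into account. -/
structure MinInv {ι : Type*} (n : ℕ) (P S : ι → Prop) (f : ι → ℕ) (b : ℕ) : Prop where
  le : b ≤ n
  le_of : ∀ k, S k → b ≤ f k
  mem : b = n ∨ ∃ k, P k ∧ b = f k

section

variable {ι : Type*} {n : ℕ} {P S S' : ι → Prop} {f : ι → ℕ} {b : ℕ}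

theorem MinInv.init (h : ∀ k, ¬ S k) : MinInv n P S f n :=
  ⟨le_rfl, fun k hk => (h k hk).elim, .inl rfl⟩

theorem MinInv.keep (h : MinInv n P S f b) (hS : ∀ k, S' k → S k ∨ b ≤ f k) :
    MinInv n P S' f b :=
  ⟨h.le, fun k hk => (hS k hk).elim (h.le_of k) id, h.mem⟩

theorem MinInv.replace (h : MinInv n P S f b) {k : ι} (hk : P k) (hb : f k ≤ b)
    (hS : ∀ j, S' j → S j ∨ j = k) : MinInv n P S' f (f k) :=
  ⟨hb.trans h.le, fun j hj => (hS j hj).elim (fun h' => hb.trans (h.le_of j h'))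
    (fun h' => h' ▸ le_rfl), .inr ⟨k, hk, rfl⟩⟩

/-- The final value of the search is `g` if no `f k` is smaller than `g`, and some `f k` is at most
`g` unless `g = n`. -/
theorem MinInv.eq (h : MinInv n P P f b) {g : ℕ} (hg : g ≤ n) (h1 : ∀ k, P k → g ≤ f k)
    (h2 : g < n → ∃ k, P k ∧ f k ≤ g) : b = g := by
  refine le_antisymm ?_ ?_
  · by_cases hn : g < n
    · obtain ⟨k, hk, hle⟩ := h2 hn
      exact (h.le_of k hk).trans hle
    · exact h.le.trans (not_lt.mp hn)
  · rcases h.mem with h3 | ⟨k, hk, h3⟩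
    · omega
    · rw [h3]; exact h1 k hk

end

/-! ### The state after the preparations -/

/-- The tree, the adjacency lists, the ancestor relation and the depths of the lowest common
ancestors are stored in the state `σ`. -/
structure Prepared (n m : ℕ) (E : ℕ → ℕ → Prop) (s : ℕ) (dep par : ℕ → ℕ) (K a : ℕ) (σ : State) :
    Prop where
  reg_n : σ.reg 0 = n
  reg_m : σ.reg 1 = m
  reg_K : σ.reg 3 = K
  reg_a : σ.reg 4 = a
  mem_dep : σ.mem 6 = dep
  mem_par : σ.mem 2 = par
  edges : ∀ x y, E x y ↔ ∃ j < m,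
    (σ.mem 0 j = x ∧ σ.mem 1 j = y) ∨ (σ.mem 1 j = x ∧ σ.mem 0 j = y)
  adj : AdjInv n m E E (2 * m) (σ.mem 4) (σ.mem 5)
  anc : ∀ q < n, ∀ t < n, σ.mem 7 (q * n + t) ≠ 0 ↔ Anc n dep par q t
  lca : ∀ x < n, dep x < n → ∀ r < n, dep r < n → IsLcaDepth n dep par x r (σ.mem 8 (x * n + r))

theorem Prepared.of_frame {n m : ℕ} {E : ℕ → ℕ → Prop} {s : ℕ} {dep par : ℕ → ℕ} {K a : ℕ}
    {σ τ : State} (h : Prepared n m E s dep par K a σ) {M : List ℕ} {r : ℕ} (hf : Frame M r σ τ)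
    (hM : ∀ b ∈ M, b = 3 ∨ 9 ≤ b) (hr : 5 ≤ r) : Prepared n m E s dep par K a τ := by
  have hmem : ∀ b < 9, b ≠ 3 → τ.mem b = σ.mem b := fun b hb hb3 => hf.1 b fun hbM => by
    have := hM b hbM
    omega
  refine ⟨?_, ?_, ?_, ?_, ?_, ?_, ?_, ?_, ?_, ?_⟩
  · rw [hf.2 0 (by omega), h.reg_n]
  · rw [hf.2 1 (by omega), h.reg_m]
  · rw [hf.2 3 (by omega), h.reg_K]
  · rw [hf.2 4 (by omega), h.reg_a]
  · rw [hmem 6 (by simp) (by simp), h.mem_dep]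
  · rw [hmem 2 (by simp) (by simp), h.mem_par]
  · rw [hmem 0 (by simp) (by simp), hmem 1 (by simp) (by simp)]; exact h.edges
  · rw [hmem 4 (by simp) (by simp), hmem 5 (by simp) (by simp)]; exact h.adj
  · rw [hmem 7 (by simp) (by simp)]; exact h.anc
  · rw [hmem 8 (by simp) (by simp)]; exact h.lca

/-! ### Replacement paths to the landmarks -/

/-- Enter the edge from the vertex in register `x` to the one in register `y` into the table in
array `17`, for the landmark in register `30`. -/
def relax (x y : ℕ) : Cmd :=
  .ite ((Expr.get 6 (.reg x)).less (.reg 0)) (.ite ((Expr.get 6 (.reg y)).less (.reg 0))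
    (.ite ((Expr.get 2 (.reg y)).same (.reg x)) .skip
      (.seq (.assign 36 ((.get 8 (.reg x * .reg 0 + .reg 30) - .reg 31) * .reg 33 +
        (.get 8 (.reg y * .reg 0 + .reg 30) - .reg 31)))
      (.seq (.assign 37 (.get 6 (.reg x) + .lit 1 + .get 13 (.reg y)))
      (.ite ((Expr.reg 37).less (.get 17 (.reg 36))) (.put 17 (.reg 36) (.reg 37)) .skip))))
    .skip) .skip

/-- An edge between reachable vertices, taken in the direction from `x` to `y`, that can end the part
of a replacement path outside of a subtree: it is not the tree edge from `x` down to `y`. -/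
def TabEdge (n : ℕ) (E : ℕ → ℕ → Prop) (dep par : ℕ → ℕ) (x y : ℕ) : Prop :=
  E x y ∧ dep x < n ∧ dep y < n ∧ par y ≠ x

/-- Entry `i, j` of the table `F` (with rows of length `K + 1`) is the least value `val x y` of an
edge in `S` with `L x - lo = i` and `L y - lo = j`, and `n` if there is none. -/
structure TabInv (n K lo : ℕ) (E S : ℕ → ℕ → Prop) (dep par L : ℕ → ℕ) (val : ℕ → ℕ → ℕ)
    (F : ℕ → ℕ) : Prop where
  le : ∀ i ≤ K, ∀ j ≤ K, F (i * (K + 1) + j) ≤ n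
  sound : ∀ i ≤ K, ∀ j ≤ K, F (i * (K + 1) + j) = n ∨ ∃ x y, TabEdge n E dep par x y ∧
    L x - lo = i ∧ L y - lo = j ∧ F (i * (K + 1) + j) = val x y
  complete : ∀ x y, S x y → TabEdge n E dep par x y →
    F ((L x - lo) * (K + 1) + (L y - lo)) ≤ val x y

theorem TabInv.keep {n K lo : ℕ} {E S S' : ℕ → ℕ → Prop} {dep par L : ℕ → ℕ} {val : ℕ → ℕ → ℕ}
    {F : ℕ → ℕ} (h : TabInv n K lo E S dep par L val F)
    (hS : ∀ x y, S' x y → TabEdge n E dep par x y →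
      S x y ∨ F ((L x - lo) * (K + 1) + (L y - lo)) ≤ val x y) :
    TabInv n K lo E S' dep par L val F :=
  ⟨h.le, h.sound, fun x y hxy he => (hS x y hxy he).elim (fun h' => h.complete x y h' he) id⟩

theorem TabInv.push {n K lo : ℕ} {E S S' : ℕ → ℕ → Prop} {dep par L : ℕ → ℕ} {val : ℕ → ℕ → ℕ}
    {F : ℕ → ℕ} (h : TabInv n K lo E S dep par L val F) {x y : ℕ} (he : TabEdge n E dep par x y)
    (hE : ∀ x y, E x y → x < n ∧ y < n) (hL : ∀ v < n, dep v < n → L v - lo ≤ K)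
    (hlt : val x y < F ((L x - lo) * (K + 1) + (L y - lo)))
    (hS : ∀ a b, S' a b → S a b ∨ (a = x ∧ b = y)) :
    TabInv n K lo E S' dep par L val
      (Function.update F ((L x - lo) * (K + 1) + (L y - lo)) (val x y)) := by
  have hx := hL x (hE _ _ he.1).1 he.2.1
  have hy := hL y (hE _ _ he.1).2 he.2.2.1
  have hn := h.le _ hx _ hy
  refine ⟨fun i hi j hj => ?_, fun i hi j hj => ?_, fun a b hab hab' => ?_⟩
  · rw [update_row (by omega) (by omega)]
    split_ifs
    · omega
    · exact h.le i hi j hj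
  · rw [update_row (by omega) (by omega)]
    split_ifs with hc
    · exact .inr ⟨x, y, he, hc.1.symm, hc.2.symm, rfl⟩
    · exact h.sound i hi j hj
  · have ha := hL a (hE _ _ hab'.1).1 hab'.2.1
    have hb := hL b (hE _ _ hab'.1).2 hab'.2.2.1
    rw [update_row (by omega) (by omega)]
    rcases hS a b hab with h' | ⟨rfl, rfl⟩
    · have h1 := h.complete a b h' hab'
      split_ifs with hc
      · rw [hc.1, hc.2] at h1
        omega
      · exact h1
    · simp

section

variable {w : ℕ} [NeZero w] {ω : ℕ → Bool} {n m : ℕ} {E : ℕ → ℕ → Prop} {s : ℕ} {dep par : ℕ → ℕ}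
  {K a : ℕ}

/-- Row `i ≤ dep q - lo - 1` and column `j ≥ dep q - lo` of the table belong to the edges that lead
into the subtree of `q`. -/
theorem IsTree.table_min (T : IsTree n E s dep par) {q r lo i b : ℕ} {L f g F : ℕ → ℕ}
    (hqs : q ≠ s) (hqr : Anc n dep par q r) (hlo : dep q = lo + i + 1) (hK : dep r - lo ≤ K)
    (hL : ∀ x < n, dep x < n → IsLcaDepth n dep par x r (L x))
    (hf : Bell n E (· < n) (srcKey n r) f) (hg : Bell n (Del E par q) (· < n) (srcKey n s) g)
    (hF : TabInv n K lo E E dep par L (fun x y => dep x + 1 + f y) F)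
    (hb : MinInv n (fun p : ℕ × ℕ => p.1 ≤ i ∧ i < p.2 ∧ p.2 ≤ K)
      (fun p : ℕ × ℕ => p.1 ≤ i ∧ i < p.2 ∧ p.2 ≤ K) (fun p => F (p.1 * (K + 1) + p.2)) b) :
    b = g r := by
  have hq := (T.anc_lt hqr).1
  have hiK : i < K := by
    have := (T.anc_lt hqr).2
    omega
  have hd : dep q < n := (T.anc_lt hqr).2.trans_lt hqr.2.1
  refine hb.eq (hg.le_top r hqr.1) ?_ fun hn => ?_
  -- every entry in the region comes from an edge into the subtree of `q`
  · rintro ⟨i', j'⟩ ⟨h1, h2, h3⟩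
    rcases hF.sound i' (by dsimp only at h1; omega) j' h3 with h4 | ⟨x, y, he, h4, h5, h6⟩
    · dsimp only
      rw [h4]
      exact hg.le_top r hqr.1
    · dsimp only at *
      rw [h6]
      have hx := T.lt _ _ he.1
      have hy := T.lt _ _ (T.symm _ _ he.1)
      have lx := (hL x hx he.2.1).2 q hqr
      have ly := (hL y hy he.2.2.1).2 q hqr
      refine T.repl_le_cross hq hd hqs hg hqr hf ⟨he.1, fun ha => ?_, ly.mp (by omega), he.2.2.2⟩
      have := lx.mpr ha
      omega
  -- the edge by which a shortest replacement path enters the subtree belongs to the region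
  · obtain ⟨x, y, h1, h2⟩ := T.exists_cross hqs hg hqr hf hn
    have hx := T.lt _ _ h1.1
    have hdx : dep x < n := by omega
    have lx := (hL x hx hdx)
    have ly := (hL y h1.2.2.1.1 h1.2.2.1.2.1)
    have lx' : ¬ dep q ≤ L x := fun h => h1.2.1 ((lx.2 q hqr).mp h)
    have ly' := (ly.2 q hqr).mpr h1.2.2.1
    have := ly.1
    refine ⟨(L x - lo, L y - lo), ⟨by dsimp only; omega, by dsimp only; omega, by dsimp only; omega⟩,
      ?_⟩
    exact (hF.complete x y h1.1 ⟨h1.1, hdx, h1.2.2.1.2.1, h1.2.2.2⟩).trans h2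

theorem run_relax {x y u v r lo : ℕ} {S S' : ℕ → ℕ → Prop} {f : ℕ → ℕ} {τ : State}
    (hW : Big n m w) (hKn : K ≤ n)
    (C : Prepared n m E s dep par K a τ) (hx : τ.reg x = u) (hy : τ.reg y = v) (hr : τ.reg 30 = r)
    (hlo : τ.reg 31 = lo) (h33 : τ.reg 33 = K + 1) (hrn : r < n)
    (hxx : x < 36) (hyy : y < 36)
    (hE : ∀ x y, E x y → x < n ∧ y < n) (huv : E u v) (hf : τ.mem 13 = f) (hfn : f v ≤ n)
    (hL : ∀ v < n, dep v < n → τ.mem 8 (v * n + r) ≤ n ∧ τ.mem 8 (v * n + r) - lo ≤ K)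
    (h : TabInv n K lo E S dep par (fun v => τ.mem 8 (v * n + r)) (fun x y => dep x + 1 + f y)
      (τ.mem 17)) (hS : ∀ a b, S' a b → S a b ∨ (a = u ∧ b = v)) :
    RunT w ω (relax x y) τ 70 fun υ => Frame [17] 36 τ υ ∧
      TabInv n K lo E S' dep par (fun v => τ.mem 8 (v * n + r)) (fun x y => dep x + 1 + f y)
        (υ.mem 17) := by
  unfold Big at hW
  have e0 := C.reg_n
  have e6 := C.mem_dep
  have e2 := C.mem_par
  obtain ⟨hun, hvn⟩ := hE u v huv
  have hru := row_le n hun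
  have hrv := row_le n hvn
  have hx36 : x ≠ 36 := by omega
  have hx37 : x ≠ 37 := by omega
  have hy36 : y ≠ 36 := by omega
  by_cases h1 : dep u < n
  · by_cases h2 : dep v < n
    · by_cases h3 : par v = u
      · simp (disch := omega) [RunT, relax, hx, hy, e0, e6, e2, h1, h2, h3]
        have h4 : TabInv n K lo E S' dep par (fun v => τ.mem 8 (v * n + r))
            (fun x y => dep x + 1 + f y) (τ.mem 17) := h.keep fun p q hpq he => by
          rcases hS p q hpq with h' | ⟨rfl, rfl⟩
          · exact .inl h'
          · exact (he.2.2.2 h3).elim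
        simp [h4]
      · have hLu := hL u hun h1
        have hLv := hL v hvn h2
        have h4 : (τ.mem 8 (u * n + r) - lo) * (K + 1) ≤ K * (n + 1) :=
          Nat.mul_le_mul hLu.2 (by omega)
        have h5 : K * (n + 1) ≤ n * (n + 1) := Nat.mul_le_mul_right _ hKn
        have h6 : n * (n + 1) = n * n + n := by ring
        simp (disch := omega) [RunT, relax, hx, hy, e0, e6, e2, h1, h2, h3, hr, hlo, h33, hf,
          Nat.mod_eq_of_lt, hx36, hx37, hy36, hy36.symm, hx36.symm]
        refine ⟨⟨⟨fun h7 => ⟨by simp, h.push ⟨huv, h1, h2, h3⟩ hE (fun v hv hd => (hL v hv hd).2)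
          h7 hS⟩, fun h7 => h.keep fun p q hpq he => ?_⟩, fun _ => by omega⟩, fun _ => by omega⟩
        rcases hS p q hpq with h' | ⟨rfl, rfl⟩
        · exact .inl h'
        · exact .inr h7
    · simp (disch := omega) [RunT, relax, hx, hy, e0, e6, e2, h1, h2]
      have h3 : TabInv n K lo E S' dep par (fun v => τ.mem 8 (v * n + r))
          (fun x y => dep x + 1 + f y) (τ.mem 17) := h.keep fun p q hpq he => by
        rcases hS p q hpq with h' | ⟨rfl, rfl⟩
        · exact .inl h'
        · exact (h2 he.2.2.1).elim
      simp [h3]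
  · simp (disch := omega) [RunT, relax, hx, hy, e0, e6, e2, h1]
    have h3 : TabInv n K lo E S' dep par (fun v => τ.mem 8 (v * n + r))
        (fun x y => dep x + 1 + f y) (τ.mem 17) := h.keep fun p q hpq he => by
      rcases hS p q hpq with h' | ⟨rfl, rfl⟩
      · exact .inl h'
      · exact (h1 he.2.1).elim
    simp [h3]

end

/-- Copy the first `n` entries of array `13` to the row of the landmark in array `9`. -/
def copyRow : Cmd := forTo 32 (.reg 0) (.put 9 (.reg 30 * .reg 0 + .reg 32) (.get 13 (.reg 32)))

/-- Fill the table of the landmark in register `30`, whose distances are in array `13`. -/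
def fillTable : Cmd :=
  .seq (.assign 33 (.reg 3 + .lit 1)) <|
  .seq (forTo 32 (.reg 33 * .reg 33) (.put 17 (.reg 32) (.reg 0))) <|
  forTo 32 (.reg 1) <| .seq (.assign 34 (.get 0 (.reg 32))) <|
    .seq (.assign 35 (.get 1 (.reg 32))) <| .seq (relax 34 35) (relax 35 34)

/-- Register `36` receives the minimum over the rows up to register `32` and the columns beyond
register `32` of the table. -/
def tableMin : Cmd :=
  .seq (.assign 36 (.reg 0)) <| forTo 34 (.reg 32 + .lit 1) <| forTo 35 (.reg 33) <|
    .ite ((Expr.reg 32).less (.reg 35))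
      (.seq (.assign 37 (.get 17 (.reg 34 * .reg 33 + .reg 35)))
        (.ite ((Expr.reg 37).less (.reg 36)) (.assign 36 (.reg 37)) .skip)) .skip

/-- Write the replacement lengths of the landmark in register `30` to its row of array `10`, for the
edges below depth `lo` on its tree path, where `lo` is the value of register `31`. -/
def readTable : Cmd :=
  forTo 32 (.reg 3) <| .ite ((Expr.reg 32).less (.get 6 (.reg 30) - .reg 31))
    (.seq tableMin (.put 10 (.reg 30 * .reg 0 + (.reg 31 + (.reg 32 + .lit 1))) (.reg 36))) .skip

section

variable {w : ℕ} [NeZero w] {ω : ℕ → Bool} {n m : ℕ} {E : ℕ → ℕ → Prop} {s : ℕ} {dep par : ℕ → ℕ}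
  {K a : ℕ}

theorem run_copyRow {r : ℕ} {σ : State} (hW : Big n m w) (hn : σ.reg 0 = n) (hr : σ.reg 30 = r)
    (hrn : r < n) :
    RunT w ω copyRow σ (30 * n + 10) fun τ =>
      (∀ v < n, τ.mem 9 (r * n + v) = σ.mem 13 v) ∧
      (∀ x < n, x ≠ r → ∀ v < n, τ.mem 9 (x * n + v) = σ.mem 9 (x * n + v)) ∧
      Frame [9] 32 σ τ := by
  unfold Big at hW
  have hrow := row_le n hrn
  refine RunT.forTo (N := n) (fun i τ => τ.reg 32 = i ∧
    (∀ v < i, τ.mem 9 (r * n + v) = σ.mem 13 v) ∧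
    (∀ x < n, x ≠ r → ∀ v < n, τ.mem 9 (x * n + v) = σ.mem 9 (x * n + v)) ∧ Frame [9] 32 σ τ) 20
    (by omega) ?_ ?_ ?_ ?_ ?_
  · simp
  · rintro i τ - ⟨h1, -, -, h3⟩
    exact ⟨h1, by simp [h3.2, hn]⟩
  · rintro i τ hi ⟨h1, h2, h3, h4⟩
    have h13 := h4.1 13 (by simp)
    have h0 := h4.2 0 (by simp)
    have h30 := h4.2 30 (by simp)
    rw [hn] at h0
    rw [hr] at h30
    simp (disch := omega) [RunT, h1, h13, h0, h30, Nat.mod_eq_of_lt]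
    refine ⟨fun v hv => ?_, fun x hx hxr v hv => ?_, by simpa using h4⟩
    · rw [update_row (by omega) (by omega)]
      split_ifs with h
      · rw [h.2]
      · exact h2 v (by omega)
    · rw [update_row (by omega) (by omega), if_neg (fun h => hxr h.1)]
      exact h3 x hx hxr v hv
  · exact fun τ h => h.2
  · simp; omega

theorem run_fillTable {r lo : ℕ} {f : ℕ → ℕ} {σ : State} (hW : Big n m w) (hKn : K ≤ n)
    (C : Prepared n m E s dep par K a σ) (hE : ∀ x y, E x y → x < n ∧ y < n)
    (hr : σ.reg 30 = r) (hlo : σ.reg 31 = lo) (hrn : r < n) (hdr : dep r < n)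
    (hK : dep r - lo ≤ K) (hf : σ.mem 13 = f) (hfn : ∀ v < n, f v ≤ n) :
    RunT w ω fillTable σ (30 * ((K + 1) * (K + 1)) + 200 * m + 50) fun τ =>
      TabInv n K lo E E dep par (fun v => σ.mem 8 (v * n + r)) (fun x y => dep x + 1 + f y)
        (τ.mem 17) ∧ τ.reg 33 = K + 1 ∧ Frame [17] 32 σ τ := by
  have hW' := hW
  unfold Big at hW'
  have hKK : K * K ≤ n * n := Nat.mul_le_mul hKn hKn
  have hKK' : (K + 1) * (K + 1) = K * K + 2 * K + 1 := by ring
  have hL : ∀ v < n, dep v < n → σ.mem 8 (v * n + r) ≤ n ∧ σ.mem 8 (v * n + r) - lo ≤ K := by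
    intro v hv hd
    have := (C.lca v hv hd r hrn hdr).1
    omega
  refine RunT.seq (T₁ := 4) (P := fun τ => τ = σ.setReg 33 (K + 1))
    (T₂ := 30 * ((K + 1) * (K + 1)) + 200 * m + 45) ?_ ?_ (by omega)
  · simp (disch := omega) [RunT, C.reg_K, Nat.mod_eq_of_lt]
  rintro _ rfl
  refine RunT.seq (T₁ := 30 * ((K + 1) * (K + 1)) + 20) (T₂ := 200 * m + 20)
    (P := fun τ => (∀ i < (K + 1) * (K + 1), τ.mem 17 i = n) ∧ τ.reg 33 = K + 1 ∧
      Frame [17] 32 σ τ) ?_ ?_ (by omega)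
  · refine RunT.forTo (N := (K + 1) * (K + 1)) (fun i τ => τ.reg 32 = i ∧
      (∀ j < i, τ.mem 17 j = n) ∧ τ.reg 33 = K + 1 ∧ Frame [17] 32 σ τ) 3 (by omega) ?_ ?_ ?_ ?_ ?_
    · simp
    · rintro i τ - ⟨h1, -, h3, h4⟩
      exact ⟨h1, by rw [eval_mul, eval_reg, h3, Nat.mod_eq_of_lt (by omega)]⟩
    · rintro i τ hi ⟨h1, h2, h3, h4⟩
      have h0 := h4.2 0 (by simp)
      rw [C.reg_n] at h0
      simp (disch := omega) [RunT, h1, h0, h3]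
      refine ⟨fun v hv => ?_, by simpa using h4⟩
      simp only [Function.update_apply]
      split_ifs with h
      · rfl
      · exact h2 v (by omega)
    · exact fun τ h => h.2
    · simp; omega
  rintro τ0 ⟨h1, h33, h2⟩
  refine RunT.forTo (N := m) (fun j τ => τ.reg 32 = j ∧ Frame [17] 32 τ0 τ ∧ τ.reg 33 = K + 1 ∧
    TabInv n K lo E (fun x y => ∃ j' < j, (σ.mem 0 j' = x ∧ σ.mem 1 j' = y) ∨
      (σ.mem 1 j' = x ∧ σ.mem 0 j' = y)) dep par (fun v => σ.mem 8 (v * n + r))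
      (fun x y => dep x + 1 + f y) (τ.mem 17)) 160 (by omega) ?_ ?_ ?_ ?_ ?_
  · refine ⟨by simp, by simp, by simp [h33], fun i hi j hj => ?_, fun i hi j hj => .inl ?_,
      by simp⟩
    all_goals
      have := row_le (K + 1) (show i < K + 1 by omega)
      have := h1 (i * (K + 1) + j) (by omega)
      simp [this]
  · rintro i τ - ⟨h3, h4, -⟩
    exact ⟨h3, by simp [h4.2, h2.2, C.reg_m]⟩
  · rintro j τ hj ⟨h3, h4, h5, h6⟩
    have hF := h2.trans h4
    have D := C.of_frame hF (by simp) (by simp)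
    have e1 : E (σ.mem 0 j) (σ.mem 1 j) := (C.edges _ _).mpr ⟨j, hj, .inl ⟨rfl, rfl⟩⟩
    have e2 : E (σ.mem 1 j) (σ.mem 0 j) := (C.edges _ _).mpr ⟨j, hj, .inr ⟨rfl, rfl⟩⟩
    have g0 : τ.mem 0 = σ.mem 0 := hF.1 0 (by simp)
    have g1 : τ.mem 1 = σ.mem 1 := hF.1 1 (by simp)
    have g8 : τ.mem 8 = σ.mem 8 := hF.1 8 (by simp)
    have g13 : τ.mem 13 = σ.mem 13 := hF.1 13 (by simp)
    have g30 : τ.reg 30 = r := by rw [hF.2 30 (by simp), hr]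
    have g31 : τ.reg 31 = lo := by rw [hF.2 31 (by simp), hlo]
    rw [RunT, run_seq, run_assign, run_seq, run_assign, run_seq]
    set ρ := (τ.setReg 34 ((Expr.get 0 (.reg 32)).eval w τ)).setReg 35
      ((Expr.get 1 (.reg 32)).eval w (τ.setReg 34 ((Expr.get 0 (.reg 32)).eval w τ))) with hρ
    have hρf : Frame [17] 33 τ ρ := by simp [hρ]
    refine (run_relax (τ := ρ) (u := σ.mem 0 j) (v := σ.mem 1 j) (r := r) (lo := lo) (f := f)
      (S := fun x y => ∃ j' < j, (σ.mem 0 j' = x ∧ σ.mem 1 j' = y) ∨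
        (σ.mem 1 j' = x ∧ σ.mem 0 j' = y))
      (S' := fun x y => (∃ j' < j, (σ.mem 0 j' = x ∧ σ.mem 1 j' = y) ∨
        (σ.mem 1 j' = x ∧ σ.mem 0 j' = y)) ∨ (x = σ.mem 0 j ∧ y = σ.mem 1 j))
      hW hKn (D.of_frame hρf (by simp) (by simp)) (by simp [hρ, h3, g0]) (by simp [hρ, h3, g1])
      (by simp [hρ, g30]) (by simp [hρ, g31]) (by simp [hρ, h5]) hrn (by simp) (by simp) hE e1
      (by simp [hρ, g13, hf]) (hfn _ (hE _ _ e1).2) (by simpa [hρ, g8] using hL)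
      (by simpa [hρ, g8] using h6) (fun _ _ => id)).run ?_
    rintro t1 τ1 ht1 ⟨f1, q1⟩
    have hρ1 : Frame [17] 33 τ τ1 := hρf.trans (f1.weaken (List.Subset.refl _) (by simp))
    have g8' : τ1.mem 8 = σ.mem 8 := by rw [hρ1.1 8 (by simp), g8]
    refine (run_relax (τ := τ1) (u := σ.mem 1 j) (v := σ.mem 0 j) (r := r) (lo := lo) (f := f)
      (S := fun x y => (∃ j' < j, (σ.mem 0 j' = x ∧ σ.mem 1 j' = y) ∨
        (σ.mem 1 j' = x ∧ σ.mem 0 j' = y)) ∨ (x = σ.mem 0 j ∧ y = σ.mem 1 j))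
      (S' := fun x y => ∃ j' < j + 1, (σ.mem 0 j' = x ∧ σ.mem 1 j' = y) ∨
        (σ.mem 1 j' = x ∧ σ.mem 0 j' = y))
      hW hKn (D.of_frame hρ1 (by simp) (by simp)) (by simp [f1.2, hρ, h3, g1])
      (by simp [f1.2, hρ, h3, g0])
      (by simp [f1.2, hρ, g30]) (by simp [f1.2, hρ, g31]) (by simp [f1.2, hρ, h5]) hrn (by simp)
      (by simp) hE e2
      (by rw [hρ1.1 13 (by simp), g13, hf]) (hfn _ (hE _ _ e2).2) (by simpa [g8'] using hL)
      (by simpa [g8', hρ, g8] using q1) ?_).run ?_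
    · rintro x y ⟨j', hj', h⟩
      rcases Nat.lt_succ_iff_lt_or_eq.mp hj' with hj' | rfl
      · exact .inl (.inl ⟨j', hj', h⟩)
      · rcases h with ⟨rfl, rfl⟩ | ⟨rfl, rfl⟩
        · exact .inl (.inr ⟨rfl, rfl⟩)
        · exact .inr ⟨rfl, rfl⟩
    rintro t2 τ2 ht2 ⟨f2, q2⟩
    refine ⟨by simp; omega, by simp [f2.2, f1.2, hρ, h3], by simp, ?_,
      by simp [f2.2, f1.2, hρ, h5], by simpa [g8'] using q2⟩
    rw [frame_setReg le_rfl]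
    exact h4.trans ((hρ1.trans (f2.weaken (List.Subset.refl _) (by simp))).weaken
      (List.Subset.refl _) (by simp))
  · rintro τ ⟨-, h3, h4, h5⟩
    exact ⟨h5.keep fun x y hxy _ => .inl ((C.edges x y).mp hxy), h4, h2.trans h3⟩
  · simp; omega

theorem run_tableMin {i : ℕ} {σ : State} (hW : Big n m w) (hKn : K ≤ n) (hn : σ.reg 0 = n)
    (hi : σ.reg 32 = i) (hiK : i < K) (h33 : σ.reg 33 = K + 1) :
    RunT w ω tableMin σ (60 * ((K + 1) * (K + 1))) fun τ =>
      MinInv n (fun p : ℕ × ℕ => p.1 ≤ i ∧ i < p.2 ∧ p.2 ≤ K)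
        (fun p : ℕ × ℕ => p.1 ≤ i ∧ i < p.2 ∧ p.2 ≤ K) (fun p => σ.mem 17 (p.1 * (K + 1) + p.2))
        (τ.reg 36) ∧ Frame [] 34 σ τ := by
  unfold Big at hW
  have hKK : K * K ≤ n * n := Nat.mul_le_mul hKn hKn
  have hKK' : (K + 1) * (K + 1) = K * K + 2 * K + 1 := by ring
  have hcost : (i + 1) * (37 * (K + 1) + 12 + (1 + 1 + 1) + 8) ≤ 37 * ((K + 1) * (K + 1)) + 23 * K := by
    have := Nat.mul_le_mul_right (37 * (K + 1) + 12 + (1 + 1 + 1) + 8) (show i + 1 ≤ K by omega)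
    have : K * (37 * (K + 1) + 12 + (1 + 1 + 1) + 8) = 37 * (K * K) + 37 * K + 23 * K := by ring
    omega
  have hKpos : 1 ≤ K := by omega
  refine RunT.seq (T₁ := 2) (P := fun τ => τ = σ.setReg 36 n)
    (T₂ := 60 * ((K + 1) * (K + 1)) - 3) ?_ ?_ (by omega)
  · simp [RunT, hn]
  rintro _ rfl
  refine RunT.forTo (N := i + 1) (fun x τ => τ.reg 34 = x ∧ Frame [] 34 σ τ ∧
    MinInv n (fun p : ℕ × ℕ => p.1 ≤ i ∧ i < p.2 ∧ p.2 ≤ K)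
      (fun p : ℕ × ℕ => p.1 < x ∧ i < p.2 ∧ p.2 ≤ K) (fun p => σ.mem 17 (p.1 * (K + 1) + p.2))
      (τ.reg 36)) (37 * (K + 1) + 12) (by omega) ?_ ?_ ?_ ?_ ?_
  · exact ⟨by simp, by simp, by simpa using MinInv.init (by simp)⟩
  · rintro x τ - ⟨h1, h2, -⟩
    refine ⟨h1, ?_⟩
    have := h2.2 32 (by simp)
    simp (disch := omega) [this, hi, Nat.mod_eq_of_lt]
  · rintro x τ hx ⟨h1, h2, h3⟩
    have hxrow : x * (K + 1) + (K + 1) ≤ (K + 1) * (K + 1) := row_le _ (by omega)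
    refine RunT.forTo (N := K + 1) (fun y υ => υ.reg 35 = y ∧ Frame [] 35 τ υ ∧
      MinInv n (fun p : ℕ × ℕ => p.1 ≤ i ∧ i < p.2 ∧ p.2 ≤ K)
        (fun p : ℕ × ℕ => i < p.2 ∧ p.2 ≤ K ∧ (p.1 < x ∨ (p.1 = x ∧ p.2 < y)))
        (fun p => σ.mem 17 (p.1 * (K + 1) + p.2)) (υ.reg 36)) 28 (by omega) ?_ ?_ ?_ ?_ ?_
    · refine ⟨by simp, by simp, ?_⟩
      rw [setReg_reg, if_neg (by simp)]
      exact h3.keep (by rintro p ⟨p1, p2, p3 | ⟨-, p3⟩⟩ <;> [exact .inl ⟨p3, p1, p2⟩; omega])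
    · rintro y υ - ⟨k1, k2, -⟩
      exact ⟨k1, by simp [k2.2, h2.2, h33]⟩
    · rintro y υ hy ⟨k1, k2, k3⟩
      have k32 : υ.reg 32 = i := by rw [k2.2 32 (by simp), h2.2 32 (by simp), hi]
      have k33 : υ.reg 33 = K + 1 := by rw [k2.2 33 (by simp), h2.2 33 (by simp), h33]
      have k34 : υ.reg 34 = x := by rw [k2.2 34 (by simp), h1]
      have k17 : υ.mem 17 = σ.mem 17 := by rw [k2.1 17 (by simp), h2.1 17 (by simp)]
      simp (disch := omega) [RunT, k1, k32, k33, k34, k17, Nat.mod_eq_of_lt]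
      refine ⟨fun g1 => ⟨fun g2 => ⟨k2, ?_⟩, fun g2 => ⟨k2, ?_⟩⟩, fun g1 => ⟨k2, ?_⟩⟩
      · refine k3.replace (k := (x, y)) ⟨by dsimp only; omega, g1, by dsimp only; omega⟩ g2.le ?_
        rintro ⟨p, q⟩ ⟨p1, p2, p3⟩
        simp only [Prod.mk.injEq]
        dsimp only at *
        omega
      · refine k3.keep ?_
        rintro ⟨p, q⟩ ⟨p1, p2, p3⟩
        dsimp only at *
        by_cases hpq : p = x ∧ q = y
        · rw [hpq.1, hpq.2]; exact .inr g2
        · exact .inl (by omega)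
      · refine k3.keep ?_
        rintro ⟨p, q⟩ ⟨p1, p2, p3⟩
        dsimp only at *
        exact .inl (by omega)
    · rintro υ ⟨k1, k2, k3⟩
      refine ⟨by simp [k2.2, h1], by simp, ?_, ?_⟩
      · rw [frame_setReg le_rfl]
        exact h2.trans (k2.weaken (List.Subset.refl _) (by simp))
      · rw [setReg_reg, if_neg (by simp)]
        exact k3.keep fun p hp => .inl (by omega)
    · simp; omega
  · rintro τ ⟨-, h2, h3⟩
    exact ⟨h3.keep fun p hp => .inl (by omega), h2⟩
  · simp only [cost_reg, cost_add, cost_lit]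
    omega

theorem run_readTable {r lo : ℕ} {σ : State} (hW : Big n m w) (hKn : K ≤ n)
    (C : Prepared n m E s dep par K a σ) (hr : σ.reg 30 = r) (hlo : σ.reg 31 = lo) (hrn : r < n)
    (hdr : dep r < n) (h33 : σ.reg 33 = K + 1) :
    RunT w ω readTable σ (K * (60 * ((K + 1) * (K + 1)) + 40) + 10) fun τ =>
      (∀ i < K, i < dep r - lo → MinInv n (fun p : ℕ × ℕ => p.1 ≤ i ∧ i < p.2 ∧ p.2 ≤ K)
        (fun p : ℕ × ℕ => p.1 ≤ i ∧ i < p.2 ∧ p.2 ≤ K) (fun p => σ.mem 17 (p.1 * (K + 1) + p.2))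
        (τ.mem 10 (r * n + (lo + (i + 1))))) ∧
      (∀ x < n, x ≠ r → ∀ v < n, τ.mem 10 (x * n + v) = σ.mem 10 (x * n + v)) ∧
      Frame [10] 32 σ τ := by
  have hW' := hW
  unfold Big at hW'
  have hrow := row_le n hrn
  refine RunT.forTo (N := K) (fun i τ => τ.reg 32 = i ∧ τ.reg 33 = K + 1 ∧
    (∀ i' < i, i' < dep r - lo → MinInv n (fun p : ℕ × ℕ => p.1 ≤ i' ∧ i' < p.2 ∧ p.2 ≤ K)
        (fun p : ℕ × ℕ => p.1 ≤ i' ∧ i' < p.2 ∧ p.2 ≤ K)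
        (fun p => σ.mem 17 (p.1 * (K + 1) + p.2)) (τ.mem 10 (r * n + (lo + (i' + 1))))) ∧
    (∀ x < n, x ≠ r → ∀ v < n, τ.mem 10 (x * n + v) = σ.mem 10 (x * n + v)) ∧ Frame [10] 32 σ τ)
    (60 * ((K + 1) * (K + 1)) + 29) (by omega) ?_ ?_ ?_ ?_ ?_
  · exact ⟨by simp, by simp [h33], by simp, by simp, by simp⟩
  · rintro i τ - ⟨h1, -, -, -, h3⟩
    exact ⟨h1, by simp [h3.2, C.reg_K]⟩
  · rintro i τ hi ⟨h1, h2, h3, h4, h5⟩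
    have g6 : τ.mem 6 = dep := by rw [h5.1 6 (by simp), C.mem_dep]
    have g30 : τ.reg 30 = r := by rw [h5.2 30 (by simp), hr]
    have g31 : τ.reg 31 = lo := by rw [h5.2 31 (by simp), hlo]
    have g0 : τ.reg 0 = n := by rw [h5.2 0 (by simp), C.reg_n]
    have g17 : τ.mem 17 = σ.mem 17 := h5.1 17 (by simp)
    have hb : ((Expr.reg 32).less (.get 6 (.reg 30) - .reg 31)).eval w τ = 0 ↔
        dep r - lo ≤ i := by
      simp (disch := omega) [h1, g6, g30, g31, Nat.mod_eq_of_lt]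
    rw [RunT, run_ite]
    refine ⟨fun h6 => ?_, fun h6 => ?_⟩
    · have h7 : i < dep r - lo := by
        by_contra h
        exact h6 (hb.mpr (by omega))
      rw [run_seq]
      refine (run_tableMin (K := K) hW hKn g0 h1 hi h2).run ?_
      rintro t υ ht ⟨m1, f1⟩
      have e0 : υ.reg 0 = n := by rw [f1.2 0 (by simp), g0]
      have e30 : υ.reg 30 = r := by rw [f1.2 30 (by simp), g30]
      have e31 : υ.reg 31 = lo := by rw [f1.2 31 (by simp), g31]
      have e32 : υ.reg 32 = i := by rw [f1.2 32 (by simp), h1]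
      have e33 : υ.reg 33 = K + 1 := by rw [f1.2 33 (by simp), h2]
      have e10 : υ.mem 10 = τ.mem 10 := f1.1 10 (by simp)
      have hfr : Frame [10] 32 σ υ := h5.trans (f1.weaken (by simp) (by simp))
      simp (disch := omega) [e0, e30, e31, e32, e33, e10, Nat.mod_eq_of_lt]
      refine ⟨by omega, fun i' hi' hd => ?_, fun x hx hxr v hv => ?_, by simpa using hfr⟩
      · simp only [Function.update_apply]
        split_ifs with h8
        · obtain rfl : i' = i := by omega
          simpa [g17] using m1
        · exact h3 i' (by omega) hd
      · rw [update_row (by omega) (by omega), if_neg (fun h => hxr h.1)]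
        exact h4 x hx hxr v hv
    · have h7 := hb.mp h6
      rw [run_skip]
      refine ⟨by simp, h1, by simp, by simp [h2], fun i' hi' hd => ?_, h4, by simpa using h5⟩
      exact h3 i' (by omega) hd
  · exact fun τ h => h.2.2
  · simp only [cost_reg]
    have : K * (60 * ((K + 1) * (K + 1)) + 29 + 1 + 8) ≤ K * (60 * ((K + 1) * (K + 1)) + 40) :=
      Nat.mul_le_mul_left _ (by omega)
    omega

end

/-- Compute the distances and the replacement lengths of the landmark in register `30`. -/
def landmarkRow : Cmd :=
  .seq (.assign 31 (.get 6 (.reg 30))) <| .seq searchFrom <| .seq copyRow <|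
  .seq (.assign 31 (.lit 0)) <| .seq searchFrom <|
  .seq (.assign 31 (.get 6 (.reg 30) - .reg 3)) <| .seq fillTable readTable

/-- Treat all landmarks, which are the reachable vertices with depth congruent to register `4`
modulo register `3`. -/
def landmarkRows : Cmd :=
  forTo 30 (.reg 0) <| .ite ((Expr.get 6 (.reg 30)).less (.reg 0))
    (.ite ((Expr.get 6 (.reg 30) % .reg 3).same (.reg 4)) landmarkRow .skip) .skip

/-- Row `r` of `F` holds the distances from `r` within the vertices that are at least as deep as
`r`, and row `r` of `D` holds, at each of the last `K` depths `d ≤ dep r`, the length of a shortest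
path from `s` to `r` avoiding the edge from depth `d - 1` to depth `d` on the tree path. -/
structure RowSpec (n : ℕ) (E : ℕ → ℕ → Prop) (s : ℕ) (dep par : ℕ → ℕ) (K : ℕ) (F D : ℕ → ℕ)
    (r : ℕ) : Prop where
  dist : Bell n E (fun v => v < n ∧ dep r ≤ dep v) (srcKey n r) fun v => F (r * n + v)
  le : ∀ q, Anc n dep par q r → q ≠ s → dep r < dep q + K → D (r * n + dep q) ≤ n
  repl : ∀ q, Anc n dep par q r → q ≠ s → dep r < dep q + K → ∀ g,
    Bell n (Del E par q) (· < n) (srcKey n s) g → D (r * n + dep q) = g r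

/-- A bound for the running time spent on one landmark. -/
def landmarkTime (n m K : ℕ) : ℕ :=
  1300 * n + 500 * m + 60 * ((K + 1) * ((K + 1) * (K + 1))) + 40 * K + 1000

section

variable {w : ℕ} [NeZero w] {ω : ℕ → Bool} {n m : ℕ} {E : ℕ → ℕ → Prop} {s : ℕ} {dep par : ℕ → ℕ}
  {K a : ℕ}

/-- The specification of `r` only depends on row `r`. -/
theorem RowSpec.congr {F D F' D' : ℕ → ℕ} {r : ℕ} (h : RowSpec n E s dep par K F D r)
    (T : IsTree n E s dep par) (hF : ∀ v < n, F' (r * n + v) = F (r * n + v))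
    (hD : ∀ v < n, D' (r * n + v) = D (r * n + v)) : RowSpec n E s dep par K F' D' r := by
  refine ⟨h.dist.congr (fun _ => Iff.rfl) (fun _ _ => rfl) fun v hv => (hF v hv.1).symm,
    fun q hq hs hK => ?_, fun q hq hs hK g hg => ?_⟩
  · rw [hD _ ((T.anc_lt hq).2.trans_lt hq.2.1)]
    exact h.le q hq hs hK
  · rw [hD _ ((T.anc_lt hq).2.trans_lt hq.2.1)]
    exact h.repl q hq hs hK g hg

/-- The first search is restricted to the depths from `dep r` on, the second one is not; it provides
the distances for the table, which starts at depth `dep r - K`, or at `0` if this is negative. -/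
theorem run_landmarkRow {r : ℕ} {σ : State} (hW : Big n m w) (hKn : K ≤ n)
    (T : IsTree n E s dep par) (C : Prepared n m E s dep par K a σ) (hr : σ.reg 30 = r)
    (hrn : r < n) (hdr : dep r < n) :
    RunT w ω landmarkRow σ (landmarkTime n m K) fun τ =>
      RowSpec n E s dep par K (τ.mem 9) (τ.mem 10) r ∧
      (∀ x < n, x ≠ r → ∀ v < n, τ.mem 9 (x * n + v) = σ.mem 9 (x * n + v)) ∧
      (∀ x < n, x ≠ r → ∀ v < n, τ.mem 10 (x * n + v) = σ.mem 10 (x * n + v)) ∧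
      Frame [9, 10, 11, 12, 13, 14, 15, 16, 17] 31 σ τ := by
  have hW' := hW
  unfold Big at hW'
  have hE : ∀ x y, E x y → x < n ∧ y < n := fun x y h => ⟨T.lt _ _ h, T.lt _ _ (T.symm _ _ h)⟩
  have hT : (K + 1) * ((K + 1) * (K + 1)) = K * ((K + 1) * (K + 1)) + (K + 1) * (K + 1) := by ring
  have hT' : K * (60 * ((K + 1) * (K + 1)) + 40) = 60 * (K * ((K + 1) * (K + 1))) + 40 * K := by
    ring
  unfold landmarkTime
  rw [RunT, landmarkRow, run_seq, run_assign, run_seq]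
  set σ1 := σ.setReg 31 ((Expr.get 6 (.reg 30)).eval w σ) with hσ1
  have F1 : Frame [] 31 σ σ1 := by simp [hσ1]
  have C1 := C.of_frame F1 (by simp) (by simp)
  have hr1 : σ1.reg 30 = r := by simp [hσ1, hr]
  refine (run_searchFrom (σ := σ1) (r := r) (l := dep r) hW C1.reg_n C1.reg_m hr1
    (by simp [hσ1, hr, C.mem_dep]) hrn hE C1.adj).run ?_
  rintro t2 σ2 ht2 ⟨B2, F2⟩
  have C2 := C1.of_frame F2 (by simp) (by simp)
  have hr2 : σ2.reg 30 = r := by rw [F2.2 30 (by simp), hr1]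
  rw [C1.mem_dep] at B2
  rw [run_seq]
  refine (run_copyRow (σ := σ2) hW C2.reg_n hr2 hrn).run ?_
  rintro t3 σ3 ht3 ⟨R3, S3, F3⟩
  have C3 := C2.of_frame F3 (by simp) (by simp)
  have hr3 : σ3.reg 30 = r := by rw [F3.2 30 (by simp), hr2]
  rw [run_seq, run_assign, run_seq]
  set σ4 := σ3.setReg 31 ((Expr.lit 0).eval w σ3) with hσ4
  have F4 : Frame [] 31 σ3 σ4 := by simp [hσ4]
  have C4 := C3.of_frame F4 (by simp) (by simp)
  have hr4 : σ4.reg 30 = r := by simp [hσ4, hr3]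
  refine (run_searchFrom (σ := σ4) (r := r) (l := 0) hW C4.reg_n C4.reg_m hr4
    (by simp [hσ4]) hrn hE C4.adj).run ?_
  rintro t5 σ5 ht5 ⟨B5, F5⟩
  have C5 := C4.of_frame F5 (by simp) (by simp)
  have hr5 : σ5.reg 30 = r := by rw [F5.2 30 (by simp), hr4]
  have B5' : Bell n E (· < n) (srcKey n r) (σ5.mem 13) :=
    B5.congr (fun v => by simp) (fun _ _ => rfl) fun _ _ => rfl
  rw [run_seq, run_assign, run_seq]
  set σ6 := σ5.setReg 31 ((Expr.get 6 (.reg 30) - .reg 3).eval w σ5) with hσ6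
  have F6 : Frame [] 31 σ5 σ6 := by simp [hσ6]
  have C6 := C5.of_frame F6 (by simp) (by simp)
  have hr6 : σ6.reg 30 = r := by simp [hσ6, hr5]
  have hlo : σ6.reg 31 = dep r - K := by
    simp (disch := omega) [hσ6, hr5, C5.mem_dep, C5.reg_K, Nat.mod_eq_of_lt]
  refine (run_fillTable (σ := σ6) (f := σ5.mem 13) hW hKn C6 hE hr6 hlo hrn hdr (by omega)
    (by simp [hσ6]) B5'.le_top).run ?_
  rintro t7 σ7 ht7 ⟨R7, h33, F7⟩
  have C7 := C6.of_frame F7 (by simp) (by simp)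
  have hr7 : σ7.reg 30 = r := by rw [F7.2 30 (by simp), hr6]
  have hlo7 : σ7.reg 31 = dep r - K := by rw [F7.2 31 (by simp), hlo]
  refine (run_readTable (σ := σ7) hW hKn C7 hr7 hlo7 hrn hdr h33).run ?_
  rintro t8 σ8 ht8 ⟨R8, S8, F8⟩
  have e9 : σ8.mem 9 = σ3.mem 9 := by
    rw [F8.1 9 (by simp), F7.1 9 (by simp), F6.1 9 (by simp), F5.1 9 (by simp), F4.1 9 (by simp)]
  have e9' : σ2.mem 9 = σ.mem 9 := by rw [F2.1 9 (by simp), F1.1 9 (by simp)]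
  have e10 : σ7.mem 10 = σ.mem 10 := by
    rw [F7.1 10 (by simp), F6.1 10 (by simp), F5.1 10 (by simp), F4.1 10 (by simp),
      F3.1 10 (by simp), F2.1 10 (by simp), F1.1 10 (by simp)]
  -- the index of the entry for the edge above `q` in the loop that reads the table
  have hentry : ∀ q, Anc n dep par q r → q ≠ s → dep r < dep q + K →
      ∃ i < K, i < dep r - (dep r - K) ∧ dep q = dep r - K + i + 1 := by
    intro q hq hqs hqK
    have h1 := T.anc_lt hq
    have h2 : dep q ≠ 0 := fun h => hqs (T.eq_s q h1.1 h)
    exact ⟨dep q - 1 - (dep r - K), by omega, by omega, by omega⟩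
  refine ⟨by simp; omega, ⟨?_, ?_, ?_⟩, ?_, ?_, ?_⟩
  · refine B2.congr (fun _ => Iff.rfl) (fun _ _ => rfl) fun v hv => ?_
    rw [e9, R3 v hv.1]
  · intro q hq hqs hqK
    obtain ⟨i, h1, h2, hi⟩ := hentry q hq hqs hqK
    rw [hi]
    exact (R8 i h1 h2).le
  · intro q hq hqs hqK g hg
    obtain ⟨i, h1, h2, hi⟩ := hentry q hq hqs hqK
    have h3 := R8 i h1 h2
    have h4 := T.table_min (L := fun v => σ6.mem 8 (v * n + r)) hqs hq hi (by omega)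
      (fun x hx hd => C6.lca x hx hd r hrn hdr) B5' hg R7 h3
    rw [hi]
    exact h4
  · intro x hx hxr v hv
    rw [e9, S3 x hx hxr v hv, e9']
  · intro x hx hxr v hv
    rw [S8 x hx hxr v hv, e10]
  · have G : ∀ {M : List ℕ} {k : ℕ} {σ τ : State}, Frame M k σ τ →
        M ⊆ [9, 10, 11, 12, 13, 14, 15, 16, 17] → 31 ≤ k →
        Frame [9, 10, 11, 12, 13, 14, 15, 16, 17] 31 σ τ := fun h h1 h2 => h.weaken h1 h2
    exact (G F1 (by simp) (by simp)).trans <| (G F2 (by simp) (by simp)).trans <|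
      (G F3 (by simp) (by simp)).trans <| (G F4 (by simp) (by simp)).trans <|
      (G F5 (by simp) (by simp)).trans <| (G F6 (by simp) (by simp)).trans <|
      (G F7 (by simp) (by simp)).trans (G F8 (by simp) (by simp))

theorem run_landmarkRows {σ : State} (hW : Big n m w) (hKn : K ≤ n)
    (T : IsTree n E s dep par) (C : Prepared n m E s dep par K a σ) :
    RunT w ω landmarkRows σ
      (40 * n + 10 + (landmarks n dep K a n).card * landmarkTime n m K) fun τ =>
      (∀ r < n, dep r < n → dep r % K = a → RowSpec n E s dep par K (τ.mem 9) (τ.mem 10) r) ∧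
      Frame [9, 10, 11, 12, 13, 14, 15, 16, 17] 30 σ τ := by
  have hW' := hW
  unfold Big at hW'
  refine RunT.forTo_sum (N := n) (fun i τ => τ.reg 30 = i ∧
    (∀ r < i, dep r < n → dep r % K = a → RowSpec n E s dep par K (τ.mem 9) (τ.mem 10) r) ∧
    Frame [9, 10, 11, 12, 13, 14, 15, 16, 17] 30 σ τ)
    (fun i => 25 + if dep i < n ∧ dep i % K = a then landmarkTime n m K else 0) (by omega)
    ?_ ?_ ?_ ?_ ?_
  · simp
  · rintro i τ - ⟨h1, -, h3⟩
    exact ⟨h1, by simp [h3.2, C.reg_n]⟩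
  · rintro i τ hi ⟨h1, h2, h3⟩
    have D := C.of_frame h3 (by simp) (by simp)
    have hmod : dep i % K ≤ dep i := Nat.mod_le _ _
    have hdi := T.dep_le i hi
    have hskip : ¬ (dep i < n ∧ dep i % K = a) → ∀ r < i + 1, dep r < n → dep r % K = a →
        RowSpec n E s dep par K (τ.mem 9) (τ.mem 10) r := by
      intro h r hr h4 h5
      have : r ≠ i := by
        rintro rfl
        exact h ⟨h4, h5⟩
      exact h2 r (by omega) h4 h5
    by_cases h4 : dep i < n
    · have e1 : ((Expr.get 6 (.reg 30)).less (.reg 0)).eval w τ ≠ 0 := by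
        simp [h1, D.mem_dep, D.reg_n, h4]
      rw [RunT, run_ite]
      refine ⟨fun _ => ?_, fun h => (e1 h).elim⟩
      by_cases h5 : dep i % K = a
      · have e2 : ((Expr.get 6 (.reg 30) % .reg 3).same (.reg 4)).eval w τ ≠ 0 := by
          simp (disch := omega) [h1, D.mem_dep, D.reg_K, D.reg_a, h5, Nat.mod_eq_of_lt]
        rw [run_ite]
        refine ⟨fun _ => ?_, fun h => (e2 h).elim⟩
        refine (run_landmarkRow hW hKn T D h1 hi h4).run ?_
        rintro t υ ht ⟨k1, k2, k3, k4⟩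
        refine ⟨?_, by rw [k4.2 30 (by simp), h1], by simp, ?_, ?_⟩
        · rw [if_pos ⟨h4, h5⟩]
          simp
          omega
        · intro r hr h6 h7
          simp only [setReg_mem]
          rcases Nat.lt_succ_iff_lt_or_eq.mp hr with hr | rfl
          · exact (h2 r hr h6 h7).congr T (k2 r (by omega) (by omega)) (k3 r (by omega) (by omega))
          · exact k1
        · rw [frame_setReg le_rfl]
          exact h3.trans (k4.weaken (List.Subset.refl _) (by simp))
      · have e2 : ((Expr.get 6 (.reg 30) % .reg 3).same (.reg 4)).eval w τ = 0 := by
          simp (disch := omega) [h1, D.mem_dep, D.reg_K, D.reg_a, h5, Nat.mod_eq_of_lt]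
        rw [run_ite]
        refine ⟨fun h => (h e2).elim, fun _ => ?_⟩
        rw [run_skip]
        exact ⟨by simp; omega, h1, by simp, hskip (fun h => h5 h.2), by simpa using h3⟩
    · have e1 : ((Expr.get 6 (.reg 30)).less (.reg 0)).eval w τ = 0 := by
        simp [h1, D.mem_dep, D.reg_n]
        omega
      rw [RunT, run_ite]
      refine ⟨fun h => (h e1).elim, fun _ => ?_⟩
      rw [run_skip]
      exact ⟨by simp; omega, h1, by simp, hskip (fun h => h4 h.1), by simpa using h3⟩
  · exact fun τ h => h.2
  · have h1 : ∑ i ∈ Finset.range n, (25 + (if dep i < n ∧ dep i % K = a then landmarkTime n m K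
        else 0) + (Expr.reg 0).cost + 8) =
        34 * n + (landmarks n dep K a n).card * landmarkTime n m K := by
      rw [landmarks, Finset.card_filter, Finset.sum_mul]
      simp only [Finset.sum_add_distrib, ite_mul, one_mul, zero_mul]
      simp
      ring
    rw [h1]
    simp
    omega

end

/-! ### Replacement paths across one tree edge, near the edge -/

/-- The level of landmarks at depth at least `d` that comes first, if the levels of landmarks are
the depths congruent to `a` modulo `K`. -/
def nextLevel (K a d : ℕ) : ℕ := d + (a + K - d % K) % K

/-- Array `19` receives the replacement lengths that are known before the search below the edge
to the vertex in register `20`, and array `20` the list of the vertices on the level in register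
`22`. -/
def gather : Cmd :=
  .seq (.assign 23 (.lit 0)) <| forTo 30 (.reg 0) <|
  .seq (.ite (.get 7 (.reg 20 * .reg 0 + .reg 30))
    (.ite ((Expr.get 6 (.reg 30)).same (.reg 22))
      (.put 19 (.reg 30) (.get 10 (.reg 30 * .reg 0 + .reg 24))) (.put 19 (.reg 30) (.reg 0)))
    (.put 19 (.reg 30) (.get 6 (.reg 30))))
  (.ite ((Expr.get 6 (.reg 30)).same (.reg 22)) (.ite ((Expr.get 6 (.reg 30)).less (.reg 0))
    (.seq (.put 20 (.reg 23) (.reg 30)) (.assign 23 (.reg 23 + .lit 1))) .skip) .skip)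

/-- Update the minimum in register `31` by the neighbour in register `33`. -/
def offer : Cmd :=
  .seq (.assign 34 (.get 19 (.reg 33) + .lit 1))
    (.ite ((Expr.reg 34).less (.reg 31)) (.assign 31 (.reg 34)) .skip)

/-- Register `31` receives the length of a shortest way to the vertex in register `30` through a
neighbour whose replacement length is known. -/
def enter : Cmd :=
  .seq (.assign 31 (.reg 0)) <| forTo 32 (.get 4 (.reg 30)) <|
  .seq (.assign 33 (.get 5 (.reg 30 * .reg 1 + .reg 32))) <|
  .ite ((Expr.reg 30).same (.reg 20)) (.ite ((Expr.reg 33).same (.reg 21)) .skip offer) offer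

/-- Prepare the search below the edge to the vertex in register `20`. -/
def prepNear : Cmd :=
  forTo 30 (.reg 0) <| .seq (.put 11 (.reg 30) (.lit 0)) <|
  .ite (.get 7 (.reg 20 * .reg 0 + .reg 30)) (.ite ((Expr.get 6 (.reg 30)).less (.reg 22))
    (.seq (.put 11 (.reg 30) (.lit 1)) (.seq enter (.put 12 (.reg 30) (.reg 31)))) .skip) .skip

/-- The vertices at depth `l < n` among the first `b` vertices. -/
def level (n : ℕ) (dep : ℕ → ℕ) (l b : ℕ) : Finset ℕ :=
  (Finset.range b).filter fun v => dep v = l ∧ dep v < n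

open Classical in
/-- The replacement lengths across the edge to `q` that are known before the search below `q`: those
outside of the subtree of `q`, and those on the level `l` of landmarks. -/
noncomputable def known (n : ℕ) (dep par : ℕ → ℕ) (q l : ℕ) (D : ℕ → ℕ) (x : ℕ) : ℕ :=
  if Anc n dep par q x then if dep x = l then D (x * n + dep q) else n else dep x

/-- The registers hold the vertex `q`, its parent, its depth and the level `l`. -/
structure Below (n m : ℕ) (E : ℕ → ℕ → Prop) (s : ℕ) (dep par : ℕ → ℕ) (K a q l : ℕ)
    (σ : State) : Prop where
  prep : Prepared n m E s dep par K a σ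
  reg_q : σ.reg 20 = q
  reg_p : σ.reg 21 = par q
  reg_l : σ.reg 22 = l
  reg_d : σ.reg 24 = dep q

theorem Below.of_frame {n m : ℕ} {E : ℕ → ℕ → Prop} {s : ℕ} {dep par : ℕ → ℕ} {K a q l : ℕ}
    {σ τ : State} (h : Below n m E s dep par K a q l σ) {M : List ℕ} {r : ℕ} (hf : Frame M r σ τ)
    (hM : ∀ b ∈ M, b = 3 ∨ 9 ≤ b) (hr : 25 ≤ r) : Below n m E s dep par K a q l τ :=
  ⟨h.prep.of_frame hf hM (by omega), by rw [hf.2 20 (by omega), h.reg_q],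
    by rw [hf.2 21 (by omega), h.reg_p], by rw [hf.2 22 (by omega), h.reg_l],
    by rw [hf.2 24 (by omega), h.reg_d]⟩

theorem level_succ {n : ℕ} {dep : ℕ → ℕ} {l b : ℕ} :
    (level n dep l (b + 1)).card =
      (level n dep l b).card + if dep b = l ∧ dep b < n then 1 else 0 := by
  unfold level
  rw [Finset.range_add_one, Finset.filter_insert]
  split_ifs with h
  · rw [Finset.card_insert_of_notMem (by simp)]
  · simp

theorem level_card_le {n : ℕ} {dep : ℕ → ℕ} {l b : ℕ} : (level n dep l b).card ≤ b :=
  (Finset.card_filter_le _ _).trans (Finset.card_range b).le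

section

variable {w : ℕ} [NeZero w] {ω : ℕ → Bool} {n m : ℕ} {E : ℕ → ℕ → Prop} {s : ℕ} {dep par : ℕ → ℕ}
  {K a q l : ℕ}

/-- After the run, array `20` lists the level `l`, and register `23` is its size. -/
theorem run_gather {σ : State} (hW : Big n m w) (B : Below n m E s dep par K a q l σ) (hq : q < n)
    (hdq : dep q < n) :
    RunT w ω gather σ (80 * n + 10) fun τ =>
      (∀ x < n, τ.mem 19 x = known n dep par q l (σ.mem 10) x) ∧
      τ.reg 23 = (level n dep l n).card ∧
      (∀ r, r ∈ level n dep l n ↔ ∃ j < τ.reg 23, τ.mem 20 j = r) ∧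
      (∀ x ≤ 24, x ≠ 23 → τ.reg x = σ.reg x) ∧ ∀ b, b ≠ 19 → b ≠ 20 → τ.mem b = σ.mem b := by
  unfold Big at hW
  have C := B.prep
  have hrow := row_le n hq
  refine RunT.seq (T₁ := 2) (T₂ := 80 * n + 7) (P := fun τ => τ = σ.setReg 23 0) (by simp [RunT]) ?_
    (by omega)
  rintro _ rfl
  refine RunT.forTo (N := n) (fun i τ => τ.reg 30 = i ∧
    (∀ x < i, τ.mem 19 x = known n dep par q l (σ.mem 10) x) ∧
    τ.reg 23 = (level n dep l i).card ∧
    (∀ r, r ∈ level n dep l i ↔ ∃ j < τ.reg 23, τ.mem 20 j = r) ∧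
    (∀ x ≤ 24, x ≠ 23 → τ.reg x = σ.reg x) ∧ ∀ b, b ≠ 19 → b ≠ 20 → τ.mem b = σ.mem b) 70
    (by omega) ?_ ?_ ?_ ?_ ?_
  · refine ⟨by simp, by simp, by simp [level], by simp [level], fun x hx hx' => ?_, by simp⟩
    simp [hx', show x ≠ 30 by omega]
  · rintro i τ - ⟨h1, -, -, -, h2, -⟩
    exact ⟨h1, by simp [h2, C.reg_n]⟩
  · rintro i τ hi ⟨h1, h2, h3, h4, h5, h6⟩
    have hrow' := row_le n hi
    have hcard := level_card_le (n := n) (dep := dep) (l := l) (b := i)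
    have g0 : τ.reg 0 = n := by rw [h5 0 (by simp) (by simp), C.reg_n]
    have g20 : τ.reg 20 = q := by rw [h5 20 (by simp) (by simp), B.reg_q]
    have g22 : τ.reg 22 = l := by rw [h5 22 (by simp) (by simp), B.reg_l]
    have g24 : τ.reg 24 = dep q := by rw [h5 24 (by simp) (by simp), B.reg_d]
    have g6 : τ.mem 6 = dep := by rw [h6 6 (by simp) (by simp), C.mem_dep]
    have g7 : τ.mem 7 = σ.mem 7 := h6 7 (by simp) (by simp)
    have g10 : τ.mem 10 = σ.mem 10 := h6 10 (by simp) (by simp)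
    have hanc := C.anc q hq i hi
    rw [RunT, run_seq]
    have hA : RunT w ω (.ite (.get 7 (.reg 20 * .reg 0 + .reg 30))
        (.ite ((Expr.get 6 (.reg 30)).same (.reg 22))
          (.put 19 (.reg 30) (.get 10 (.reg 30 * .reg 0 + .reg 24))) (.put 19 (.reg 30) (.reg 0)))
        (.put 19 (.reg 30) (.get 6 (.reg 30)))) τ 30 fun υ =>
        υ = τ.setMem 19 i (known n dep par q l (σ.mem 10) i) := by
      by_cases hA : Anc n dep par q i
      · have h7 := hanc.mpr hA
        by_cases hl : dep i = l
        · simp (disch := omega) [RunT, g0, g20, g22, g24, g6, g7, g10, h1, Nat.mod_eq_of_lt, known,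
            hA, hl, h7]
        · simp (disch := omega) [RunT, g0, g20, g22, g24, g6, g7, g10, h1, Nat.mod_eq_of_lt, known,
            hA, hl, h7]
      · have h7 : σ.mem 7 (q * n + i) = 0 := by
          by_contra h
          exact hA (hanc.mp h)
        simp (disch := omega) [RunT, g0, g20, g22, g24, g6, g7, g10, h1, Nat.mod_eq_of_lt, known,
            hA, h7]
    refine hA.run ?_
    rintro t _ ht rfl
    have hknown : ∀ x < i + 1, Function.update (τ.mem 19) i (known n dep par q l (σ.mem 10) i) x =
        known n dep par q l (σ.mem 10) x := by
      intro x hx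
      simp only [Function.update_apply]
      split_ifs with h
      · rw [h]
      · exact h2 x (by omega)
    have hsucc := level_succ (n := n) (dep := dep) (l := l) (b := i)
    have hmem : ∀ r, r ∈ level n dep l (i + 1) ↔
        r ∈ level n dep l i ∨ (r = i ∧ dep i = l ∧ dep i < n) := by
      intro r
      simp only [level, Finset.mem_filter, Finset.mem_range, Nat.lt_succ_iff_lt_or_eq]
      constructor
      · rintro ⟨h | rfl, h'⟩
        · exact .inl ⟨h, h'⟩
        · exact .inr ⟨rfl, h'⟩
      · rintro (⟨h, h'⟩ | ⟨rfl, h'⟩)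
        · exact ⟨.inl h, h'⟩
        · exact ⟨.inr rfl, h'⟩
    have hskip : ¬ (dep i = l ∧ dep i < n) → (level n dep l (i + 1)).card = τ.reg 23 ∧
        ∀ r, r ∈ level n dep l (i + 1) ↔ ∃ j < τ.reg 23, τ.mem 20 j = r := by
      intro h
      refine ⟨by rw [hsucc, if_neg h, h3, add_zero], fun r => ?_⟩
      rw [hmem, ← h4]
      simp [h]
    by_cases hl : dep i = l
    · by_cases hn : dep i < n
      · have hn' : l < n := hl ▸ hn
        rw [if_pos ⟨hl, hn⟩] at hsucc
        simp (disch := omega) [g0, g22, g6, h1, hl, hn', hn'.not_ge, Nat.mod_eq_of_lt]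
        refine ⟨by omega, fun x hx => hknown x (by omega), by omega, fun r => ?_,
          fun x hx hx' => ?_, fun b hb hb' => ?_⟩
        · rw [hmem, h4]
          constructor
          · rintro (⟨j, hj, hj'⟩ | ⟨rfl, -⟩)
            · exact ⟨j, by omega, by rw [Function.update_of_ne (by omega), hj']⟩
            · exact ⟨τ.reg 23, by omega, by simp⟩
          · rintro ⟨j, hj, hj'⟩
            by_cases h : j = τ.reg 23
            · subst h
              rw [Function.update_self] at hj'
              exact .inr ⟨hj'.symm, hl, hn⟩
            · rw [Function.update_of_ne h] at hj'
              exact .inl ⟨j, by omega, hj'⟩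
        · rw [if_neg (by omega), if_neg (by omega), h5 x hx hx']
        · rw [if_neg hb', if_neg hb, h6 b hb hb']
      · obtain ⟨k1, k2⟩ := hskip (fun h => hn h.2)
        have hn' : n ≤ l := hl ▸ not_lt.mp hn
        simp (disch := omega) [g0, g22, g6, h1, hl, hn', not_lt.mpr hn', Nat.mod_eq_of_lt]
        refine ⟨by omega, fun x hx => hknown x (by omega), by omega, k2,
          fun x hx hx' => ?_, fun b hb hb' => ?_⟩
        · rw [if_neg (by omega), h5 x hx hx']
        · rw [if_neg hb, h6 b hb hb']
    · obtain ⟨k1, k2⟩ := hskip (fun h => hl h.1)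
      simp (disch := omega) [g0, g22, g6, h1, hl, Nat.mod_eq_of_lt]
      refine ⟨by omega, fun x hx => hknown x (by omega), by omega, k2,
        fun x hx hx' => ?_, fun b hb hb' => ?_⟩
      · rw [if_neg (by omega), h5 x hx hx']
      · rw [if_neg hb, h6 b hb hb']
  · exact fun τ h => h.2
  · simp; omega

theorem run_offer {x b : ℕ} {τ : State} (hx : τ.reg 33 = x) (hb : τ.reg 31 = b)
    (hlt : τ.mem 19 x + 1 < 2 ^ w) :
    RunT w ω offer τ 14 fun υ => υ.reg 31 = min b (τ.mem 19 x + 1) ∧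
      (∀ y, y ≠ 31 → y ≠ 34 → υ.reg y = τ.reg y) ∧ υ.mem = τ.mem := by
  simp (disch := omega) [RunT, offer, hx, hb, Nat.mod_eq_of_lt]
  refine ⟨fun h => ⟨by omega, fun y h1 h2 => by simp [h1, h2]⟩,
    fun h => ⟨by omega, fun y _ h1 => by simp [h1]⟩⟩

theorem run_enter {t : ℕ} {σ : State} (hW : Big n m w) (T : IsTree n E s dep par)
    (B : Below n m E s dep par K a q l σ) (hq : q < n) (hdq : dep q < n) (hqs : q ≠ s)
    (ht : Anc n dep par q t) (hr : σ.reg 30 = t) (hk : ∀ x < n, σ.mem 19 x ≤ n) :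
    RunT w ω enter σ (50 * σ.mem 4 t + 15) fun τ =>
      MinInv n (fun x => Del E par q x t) (fun x => Del E par q x t) (fun x => σ.mem 19 x + 1)
        (τ.reg 31) ∧ Frame [] 31 σ τ := by
  unfold Big at hW
  have C := B.prep
  have hdeg := C.adj.le t ht.1
  have hrow := row_le m ht.1
  -- within the subtree of `q`, only the edge from the parent to `q` itself has been deleted
  have hnq : ∀ x, E x t → (Del E par q x t ↔ ¬ (t = q ∧ x = par q)) := by
    intro x hx
    refine ⟨fun h h' => h.2.1 ⟨h'.2, h'.1⟩, fun h => ⟨hx, fun h' => h ⟨h'.2, h'.1⟩, fun h' => ?_⟩⟩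
    rw [h'.2] at ht
    exact T.not_anc_par hq hdq hqs ht
  refine RunT.seq (T₁ := 2) (T₂ := 50 * σ.mem 4 t + 12) (P := fun τ => τ = σ.setReg 31 n)
    (by simp [RunT, C.reg_n]) ?_ (by omega)
  rintro _ rfl
  refine RunT.forTo (N := σ.mem 4 t) (fun i τ => τ.reg 32 = i ∧
    MinInv n (fun x => Del E par q x t)
      (fun x => Del E par q x t ∧ ∃ j < i, σ.mem 5 (t * m + j) = x) (fun x => σ.mem 19 x + 1)
        (τ.reg 31) ∧ Frame [] 31 σ τ) 36
    (by omega) ?_ ?_ ?_ ?_ ?_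
  · exact ⟨by simp, by simpa using MinInv.init (by simp), by simp⟩
  · rintro i τ - ⟨h1, -, h3⟩
    exact ⟨h1, by simp [h3.1 4, h3.2, hr]⟩
  · rintro i τ hi ⟨h1, h2, h3⟩
    have g0 : τ.reg 0 = n := by rw [h3.2 0 (by simp), C.reg_n]
    have g1 : τ.reg 1 = m := by rw [h3.2 1 (by simp), C.reg_m]
    have g20 : τ.reg 20 = q := by rw [h3.2 20 (by simp), B.reg_q]
    have g21 : τ.reg 21 = par q := by rw [h3.2 21 (by simp), B.reg_p]
    have g30 : τ.reg 30 = t := by rw [h3.2 30 (by simp), hr]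
    have g5 : τ.mem 5 = σ.mem 5 := h3.1 5 (by simp)
    have g19 : τ.mem 19 = σ.mem 19 := h3.1 19 (by simp)
    have hx := T.symm _ _ (C.adj.sound t ht.1 i hi)
    set x := σ.mem 5 (t * m + i) with hxdef
    have hxn := T.lt _ _ hx
    have hkx := hk x hxn
    have hS : ∀ y, (Del E par q y t ∧ ∃ j < i + 1, σ.mem 5 (t * m + j) = y) →
        (Del E par q y t ∧ ∃ j < i, σ.mem 5 (t * m + j) = y) ∨ (Del E par q y t ∧ y = x) := by
      rintro y ⟨hy, j, hj, hj'⟩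
      rcases Nat.lt_succ_iff_lt_or_eq.mp hj with hj | rfl
      · exact .inl ⟨hy, j, hj, hj'⟩
      · exact .inr ⟨hy, hj'.symm⟩
    have hev : (Expr.get 5 (.reg 30 * .reg 1 + .reg 32)).eval w τ = x := by
      simp (disch := omega) [g30, g1, h1, g5, Nat.mod_eq_of_lt]
      exact hxdef.symm
    rw [RunT, run_seq, run_assign, hev]
    have hoffer : Del E par q x t → RunT w ω offer (τ.setReg 33 x) 14 fun υ => υ.reg 32 = i ∧
        MinInv n (fun x => Del E par q x t)
          (fun x => Del E par q x t ∧ ∃ j < i + 1, σ.mem 5 (t * m + j) = x)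
          (fun x => σ.mem 19 x + 1) (υ.reg 31) ∧ Frame [] 31 σ υ := by
      intro hd
      refine (run_offer (x := x) (b := τ.reg 31) (by simp) (by simp)
        (by simp [g19]; omega)).mono le_rfl ?_
      rintro υ ⟨k1, k2, k3⟩
      refine ⟨by simp [k2, h1], ?_, ?_⟩
      · simp only [setReg_mem, g19] at k1
        rw [k1]
        rcases le_total (τ.reg 31) (σ.mem 19 x + 1) with h | h
        · rw [min_eq_left h]
          refine h2.keep fun y hy => ?_
          rcases hS y hy with h' | ⟨-, rfl⟩
          · exact .inl h'
          · exact .inr h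
        · rw [min_eq_right h]
          refine h2.replace hd h fun y hy => ?_
          rcases hS y hy with h' | ⟨-, rfl⟩
          · exact .inl h'
          · exact .inr rfl
      · refine h3.trans ⟨fun b _ => by rw [k3, setReg_mem], fun y hy => ?_⟩
        rw [k2 y (by omega) (by omega), setReg_reg, if_neg (by omega)]
    have hfin : ∀ {υ : State}, (υ.reg 32 = i ∧ MinInv n (fun x => Del E par q x t)
          (fun x => Del E par q x t ∧ ∃ j < i + 1, σ.mem 5 (t * m + j) = x)
          (fun x => σ.mem 19 x + 1) (υ.reg 31) ∧ Frame [] 31 σ υ) → υ.reg 32 = i ∧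
          (υ.setReg 32 (i + 1)).reg 32 = i + 1 ∧ MinInv n (fun x => Del E par q x t)
          (fun x => Del E par q x t ∧ ∃ j < i + 1, σ.mem 5 (t * m + j) = x)
          (fun x => σ.mem 19 x + 1) ((υ.setReg 32 (i + 1)).reg 31) ∧
          Frame [] 31 σ (υ.setReg 32 (i + 1)) := fun h =>
      ⟨h.1, by simp, by simpa using h.2.1, by simpa using h.2.2⟩
    have e1 : ((Expr.reg 30).same (.reg 20)).eval w (τ.setReg 33 x) = 0 ↔ t ≠ q := by
      simp [g30, g20]
    have e2 : ((Expr.reg 33).same (.reg 21)).eval w (τ.setReg 33 x) = 0 ↔ x ≠ par q := by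
      simp [g21]
    rw [run_ite, run_ite]
    refine ⟨fun c1 => ⟨fun c2 => ?_, fun c2 => ?_⟩, fun c1 => ?_⟩
    · have c3 : t = q := by
        by_contra h
        exact c1 (e1.mpr h)
      have c4 : x = par q := by
        by_contra h
        exact c2 (e2.mpr h)
      rw [run_skip]
      refine ⟨by simp, hfin ⟨by simp [h1], ?_, by simpa using h3⟩⟩
      simp only [setReg_reg, Nat.reduceEqDiff, ↓reduceIte]
      refine h2.keep fun y hy => ?_
      rcases hS y hy with h' | ⟨h', rfl⟩
      · exact .inl h'
      · exact ((hnq _ hx).mp h' ⟨c3, c4⟩).elim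
    · refine (hoffer ((hnq x hx).mpr fun h => e2.mp c2 h.2)).run fun t υ ht hυ => ⟨?_, hfin hυ⟩
      simp; omega
    · refine (hoffer ((hnq x hx).mpr fun h => e1.mp c1 h.1)).run fun t υ ht hυ => ⟨?_, hfin hυ⟩
      simp; omega
  · rintro τ ⟨-, h2, h3⟩
    refine ⟨h2.keep fun x hx => .inl ⟨hx, C.adj.complete t x ht.1 (T.symm _ _ hx.1)⟩, h3⟩
  · simp; omega

end

/-- Register `31` receives the length of a shortest replacement path to the vertex in register `30`
through the level of landmarks. -/
def leave : Cmd :=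
  .seq (.assign 31 (.reg 0)) <| forTo 32 (.reg 23) <| .seq (.assign 33 (.get 20 (.reg 32))) <|
  .seq (.assign 34 (.get 19 (.reg 33) + .get 9 (.reg 33 * .reg 0 + .reg 30)))
    (.ite ((Expr.reg 34).less (.reg 31)) (.assign 31 (.reg 34)) .skip)

/-- Write the replacement lengths across the edge to the vertex in register `20` to array `3`. -/
def output : Cmd :=
  forTo 30 (.reg 0) <| .ite (.get 7 (.reg 20 * .reg 0 + .reg 30))
    (.ite ((Expr.get 6 (.reg 30)).less (.reg 22))
      (.put 3 (.reg 30 * .reg 0 + (.reg 24 - .lit 1)) (.get 13 (.reg 30)))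
      (.seq leave (.put 3 (.reg 30 * .reg 0 + (.reg 24 - .lit 1)) (.reg 31)))) .skip

/-- Treat the edge to the vertex in register `20`. -/
def belowEdge : Cmd :=
  .seq (.assign 24 (.get 6 (.reg 20))) <| .seq (.assign 21 (.get 2 (.reg 20))) <|
  .seq (.assign 22 (.reg 24 + (.reg 4 + .reg 3 - .reg 24 % .reg 3) % .reg 3)) <|
  .seq gather <| .seq prepNear <| .seq bfs output

theorem le_nextLevel {K a d : ℕ} : d ≤ nextLevel K a d := Nat.le_add_right _ _

theorem nextLevel_lt {K a d : ℕ} (h : a < K) : nextLevel K a d < d + K :=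
  Nat.add_lt_add_left (Nat.mod_lt _ (by omega)) _

theorem nextLevel_mod {K a d : ℕ} (h : a < K) : nextLevel K a d % K = a := by
  have h1 := Nat.div_add_mod d K
  have h2 := Nat.mod_lt d (show 0 < K by omega)
  rw [nextLevel, Nat.add_mod, Nat.mod_mod, ← Nat.add_mod]
  have h3 : d + (a + K - d % K) = a + K * (d / K + 1) := by
    rw [mul_add]
    omega
  rw [h3, Nat.add_mul_mod_self_left, Nat.mod_eq_of_lt h]

section

variable {w : ℕ} [NeZero w] {ω : ℕ → Bool} {n m : ℕ} {E : ℕ → ℕ → Prop} {s : ℕ} {dep par : ℕ → ℕ}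
  {K a q l : ℕ}

open Classical in
theorem run_prepNear {σ : State} (hW : Big n m w) (T : IsTree n E s dep par)
    (B : Below n m E s dep par K a q l σ) (hq : q < n) (hdq : dep q < n) (hqs : q ≠ s)
    (hk : ∀ x < n, σ.mem 19 x ≤ n) :
    RunT w ω prepNear σ (80 * n + 10 +
        50 * ∑ t ∈ Finset.range n, if Anc n dep par q t ∧ dep t < l then σ.mem 4 t else 0) fun τ =>
      (∀ t < n, (τ.mem 11 t ≠ 0 ↔ Anc n dep par q t ∧ dep t < l) ∧
        (Anc n dep par q t → dep t < l → MinInv n (fun x => Del E par q x t)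
          (fun x => Del E par q x t) (fun x => σ.mem 19 x + 1) (τ.mem 12 t))) ∧
      Frame [11, 12] 30 σ τ := by
  have hW' := hW
  unfold Big at hW
  have hrow := row_le n hq
  refine RunT.forTo_sum (N := n) (fun i τ => τ.reg 30 = i ∧
    (∀ t < i, (τ.mem 11 t ≠ 0 ↔ Anc n dep par q t ∧ dep t < l) ∧
      (Anc n dep par q t → dep t < l → MinInv n (fun x => Del E par q x t)
        (fun x => Del E par q x t) (fun x => σ.mem 19 x + 1) (τ.mem 12 t))) ∧
    Frame [11, 12] 30 σ τ)
    (fun i => 60 + 50 * if Anc n dep par q i ∧ dep i < l then σ.mem 4 i else 0) (by omega)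
    ?_ ?_ ?_ ?_ ?_
  · simp
  · rintro i τ - ⟨h1, -, h3⟩
    exact ⟨h1, by simp [h3.2, B.prep.reg_n]⟩
  · rintro i τ hi ⟨h1, h2, h3⟩
    have D := B.of_frame h3 (by simp) (by simp)
    have C := D.prep
    have hanc := C.anc q hq i hi
    have hkeep : ∀ {f : ℕ → ℕ} {b : ℕ}, (f i ≠ 0 ↔ Anc n dep par q i ∧ dep i < l) →
        (∀ t, t ≠ i → f t = τ.mem 11 t) → (Anc n dep par q i → dep i < l →
          MinInv n (fun x => Del E par q x i) (fun x => Del E par q x i)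
            (fun x => σ.mem 19 x + 1) b) →
        ∀ t < i + 1, (f t ≠ 0 ↔ Anc n dep par q t ∧ dep t < l) ∧
          (Anc n dep par q t → dep t < l → MinInv n (fun x => Del E par q x t)
            (fun x => Del E par q x t) (fun x => σ.mem 19 x + 1)
            (Function.update (τ.mem 12) i b t)) := by
      intro f b k1 k2 k3 t ht
      by_cases hti : t = i
      · subst hti
        exact ⟨k1, by simpa using k3⟩
      · rw [k2 t hti, Function.update_of_ne hti]
        exact h2 t (by omega)
    by_cases c1 : Anc n dep par q i
    · have c1' := hanc.mpr c1
      by_cases c2 : dep i < l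
      · rw [RunT, run_seq, run_put, run_ite]
        refine ⟨fun _ => ?_, fun h => ?_⟩
        swap
        · simp (disch := omega) [h1, D.reg_q, C.reg_n, Nat.mod_eq_of_lt, c1'] at h
        rw [run_ite]
        refine ⟨fun _ => ?_, fun h => ?_⟩
        swap
        · simp [h1, D.reg_l, C.mem_dep, c2] at h
          omega
        rw [run_seq, run_put, run_seq]
        set ρ := ((τ.setMem 11 ((Expr.reg 30).eval w τ) ((Expr.lit 0).eval w τ)).setMem 11
          ((Expr.reg 30).eval w (τ.setMem 11 ((Expr.reg 30).eval w τ) ((Expr.lit 0).eval w τ)))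
          ((Expr.lit 1).eval w
            (τ.setMem 11 ((Expr.reg 30).eval w τ) ((Expr.lit 0).eval w τ)))) with hρ
        have f1 : Frame [11, 12] 31 τ ρ := by simp [hρ]
        have f1' : Frame [11, 12] 30 σ ρ := h3.trans (f1.weaken (List.Subset.refl _) (by simp))
        have g19 : ρ.mem 19 = σ.mem 19 := f1'.1 19 (by simp)
        have g4 : ρ.mem 4 = σ.mem 4 := f1'.1 4 (by simp)
        refine (run_enter (σ := ρ) (t := i) hW' T (D.of_frame f1 (by simp) (by simp)) hq hdq hqs c1
          (by simp [hρ, h1]) (by rwa [g19])).run ?_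
        rintro t υ ht ⟨k1, k2⟩
        rw [g4] at ht
        rw [g19] at k1
        have f2 : Frame [11, 12] 30 σ υ := f1'.trans (k2.weaken (by simp) (by simp))
        have e30 : υ.reg 30 = i := by rw [k2.2 30 (by simp), f1.2 30 (by simp), h1]
        rw [run_put]
        refine ⟨?_, by simpa using e30, by simp, ?_, by simpa using f2⟩
        · rw [if_pos ⟨c1, c2⟩]
          simp
          omega
        · have e12 : υ.mem 12 = τ.mem 12 := by rw [k2.1 12 (by simp), hρ]; simp
          have e11 : υ.mem 11 = Function.update (τ.mem 11) i 1 := by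
            rw [k2.1 11 (by simp), hρ]; simp [h1]
          simp only [eval_reg, setReg_mem, setMem_mem, Nat.reduceEqDiff, ↓reduceIte, e30, e12, e11]
          exact hkeep (by simp [c1, c2]) (fun t ht => by simp [ht]) fun _ _ => k1
      · simp (disch := omega) [RunT, h1, D.reg_q, C.reg_n, D.reg_l, C.mem_dep, Nat.mod_eq_of_lt, c1',
          c2, not_lt.mp c2]
        refine ⟨fun t ht => ?_, by simpa using h3⟩
        have := hkeep (f := Function.update (τ.mem 11) i 0) (b := τ.mem 12 i) (by simp; omega)
          (fun t ht => by simp [ht]) (fun _ h => (c2 h).elim) t (by omega)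
        simpa using this
    · have c1' : τ.mem 7 (q * n + i) = 0 := by
        by_contra h
        exact c1 (hanc.mp h)
      simp (disch := omega) [RunT, h1, D.reg_q, C.reg_n, Nat.mod_eq_of_lt, c1']
      refine ⟨by omega, fun t ht => ?_, by simpa using h3⟩
      have := hkeep (f := Function.update (τ.mem 11) i 0) (b := τ.mem 12 i) (by simp [c1])
        (fun t ht => by simp [ht]) (fun h _ => (c1 h).elim) t (by omega)
      simpa using this
  · exact fun τ h => h.2
  · simp only [Finset.sum_add_distrib, ← Finset.mul_sum]
    simp
    omega

theorem run_leave {t : ℕ} {σ : State} (hW : Big n m w) (B : Below n m E s dep par K a q l σ)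
    (ht : t < n) (hr : σ.reg 30 = t) (hk : ∀ x < n, σ.mem 19 x ≤ n)
    (hlev : ∀ r, r ∈ level n dep l n ↔ ∃ j < σ.reg 23, σ.mem 20 j = r)
    (hcard : σ.reg 23 = (level n dep l n).card)
    (hd : ∀ r ∈ level n dep l n, σ.mem 9 (r * n + t) ≤ n) :
    RunT w ω leave σ (50 * (level n dep l n).card + 15) fun τ =>
      MinInv n (· ∈ level n dep l n) (· ∈ level n dep l n)
        (fun r => σ.mem 19 r + σ.mem 9 (r * n + t)) (τ.reg 31) ∧ Frame [] 31 σ τ := by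
  unfold Big at hW
  have C := B.prep
  have hcn := level_card_le (n := n) (dep := dep) (l := l) (b := n)
  refine RunT.seq (T₁ := 2) (T₂ := 50 * (level n dep l n).card + 12)
    (P := fun τ => τ = σ.setReg 31 n) (by simp [RunT, C.reg_n]) ?_ (by omega)
  rintro _ rfl
  refine RunT.forTo (N := (level n dep l n).card) (fun i τ => τ.reg 32 = i ∧
    MinInv n (· ∈ level n dep l n) (fun r => ∃ j < i, σ.mem 20 j = r)
        (fun r => σ.mem 19 r + σ.mem 9 (r * n + t)) (τ.reg 31) ∧ Frame [] 31 σ τ) 36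
    (by omega) ?_ ?_ ?_ ?_ ?_
  · exact ⟨by simp, by simpa using MinInv.init (by simp), by simp⟩
  · rintro i τ - ⟨h1, -, h3⟩
    exact ⟨h1, by simp [h3.2, hcard]⟩
  · rintro i τ hi ⟨h1, h2, h3⟩
    have g0 : τ.reg 0 = n := by rw [h3.2 0 (by simp), C.reg_n]
    have g30 : τ.reg 30 = t := by rw [h3.2 30 (by simp), hr]
    have g20 : τ.mem 20 = σ.mem 20 := h3.1 20 (by simp)
    have g19 : τ.mem 19 = σ.mem 19 := h3.1 19 (by simp)
    have g9 : τ.mem 9 = σ.mem 9 := h3.1 9 (by simp)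
    have hx : σ.mem 20 i ∈ level n dep l n := (hlev _).mpr ⟨i, by omega, rfl⟩
    have hS : ∀ y, (∃ j < i + 1, σ.mem 20 j = y) →
        (∃ j < i, σ.mem 20 j = y) ∨ y = σ.mem 20 i := by
      rintro y ⟨j, hj, hj'⟩
      rcases Nat.lt_succ_iff_lt_or_eq.mp hj with hj | rfl
      · exact .inl ⟨j, hj, hj'⟩
      · exact .inr hj'.symm
    have hdx := hd _ hx
    set x := σ.mem 20 i
    have hxn : x < n := by simpa using (Finset.mem_filter.mp hx).1
    have hrow := row_le n hxn
    have hkx := hk x hxn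
    have hrun : RunT w ω (.seq (.assign 33 (.get 20 (.reg 32))) <|
        .seq (.assign 34 (.get 19 (.reg 33) + .get 9 (.reg 33 * .reg 0 + .reg 30)))
        (.ite ((Expr.reg 34).less (.reg 31)) (.assign 31 (.reg 34)) .skip)) τ 36 fun υ =>
        υ.reg 32 = i ∧ υ.reg 31 = min (τ.reg 31) (σ.mem 19 x + σ.mem 9 (x * n + t)) ∧
          Frame [] 31 σ υ := by
      have e20 : τ.mem 20 i = x := by rw [g20]
      simp (disch := omega) [RunT, h1, e20, g19, g9, g0, g30, Nat.mod_eq_of_lt]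
      exact ⟨fun h => ⟨by omega, h3⟩, fun h => ⟨by omega, h3⟩⟩
    refine hrun.mono le_rfl ?_
    rintro υ ⟨k1, k2, k3⟩
    refine ⟨k1, by simp, ?_, by simpa using k3⟩
    rw [setReg_reg, if_neg (by simp), k2]
    rcases le_total (τ.reg 31) (σ.mem 19 x + σ.mem 9 (x * n + t)) with h | h
    · rw [min_eq_left h]
      refine h2.keep fun y hy => ?_
      rcases hS y hy with h' | rfl
      · exact .inl h'
      · exact .inr h
    · rw [min_eq_right h]
      exact h2.replace (k := x) hx h hS
  · rintro τ ⟨-, h2, h3⟩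
    refine ⟨h2.keep fun x hx => .inl ?_, h3⟩
    rw [← hcard]
    exact (hlev x).mp hx
  · simp; omega

open Classical in
theorem run_output {σ : State} (hW : Big n m w)
    (B : Below n m E s dep par K a q l σ) (hq : q < n) (hdq : dep q < n)
    (hk : ∀ x < n, σ.mem 19 x ≤ n)
    (hlev : ∀ r, r ∈ level n dep l n ↔ ∃ j < σ.reg 23, σ.mem 20 j = r)
    (hcard : σ.reg 23 = (level n dep l n).card)
    (hd : ∀ r ∈ level n dep l n, ∀ t < n, l ≤ dep t → σ.mem 9 (r * n + t) ≤ n) :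
    RunT w ω output σ (80 * n + 10 + 50 * ∑ t ∈ Finset.range n,
        if Anc n dep par q t then (level n dep l n).card else 0) fun τ =>
      (∀ t, Anc n dep par q t →
        (dep t < l → τ.mem 3 (t * n + (dep q - 1)) = σ.mem 13 t) ∧
        (l ≤ dep t → MinInv n (· ∈ level n dep l n) (· ∈ level n dep l n)
          (fun r => σ.mem 19 r + σ.mem 9 (r * n + t)) (τ.mem 3 (t * n + (dep q - 1))))) ∧
      (∀ t < n, ∀ d < n, ¬ (Anc n dep par q t ∧ d = dep q - 1) →
        τ.mem 3 (t * n + d) = σ.mem 3 (t * n + d)) ∧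
      Frame [3] 30 σ τ := by
  have hW' := hW
  unfold Big at hW
  have hrow := row_le n hq
  refine RunT.forTo_sum (N := n) (fun i τ => τ.reg 30 = i ∧
    (∀ t < i, Anc n dep par q t →
        (dep t < l → τ.mem 3 (t * n + (dep q - 1)) = σ.mem 13 t) ∧
        (l ≤ dep t → MinInv n (· ∈ level n dep l n) (· ∈ level n dep l n)
          (fun r => σ.mem 19 r + σ.mem 9 (r * n + t)) (τ.mem 3 (t * n + (dep q - 1))))) ∧
      (∀ t < n, ∀ d < n, ¬ (Anc n dep par q t ∧ d = dep q - 1) →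
        τ.mem 3 (t * n + d) = σ.mem 3 (t * n + d)) ∧
    Frame [3] 30 σ τ)
    (fun i => 60 + 50 * if Anc n dep par q i then (level n dep l n).card else 0) (by omega)
    ?_ ?_ ?_ ?_ ?_
  · simp
  · rintro i τ - ⟨h1, -, -, h3⟩
    exact ⟨h1, by simp [h3.2, B.prep.reg_n]⟩
  · rintro i τ hi ⟨h1, h2, h2', h3⟩
    have D := B.of_frame h3 (by simp) (by simp)
    have C := D.prep
    have hanc := C.anc q hq i hi
    have hrow' := row_le n hi
    -- the effect of writing `b` to the entry for the target `i`
    have hput : ∀ b, Anc n dep par q i → (dep i < l → b = σ.mem 13 i) →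
        (l ≤ dep i → MinInv n (· ∈ level n dep l n) (· ∈ level n dep l n)
          (fun r => σ.mem 19 r + σ.mem 9 (r * n + i)) b) →
        (∀ t < i + 1, Anc n dep par q t →
          (dep t < l → Function.update (τ.mem 3) (i * n + (dep q - 1)) b (t * n + (dep q - 1)) =
            σ.mem 13 t) ∧
          (l ≤ dep t → MinInv n (· ∈ level n dep l n) (· ∈ level n dep l n)
            (fun r => σ.mem 19 r + σ.mem 9 (r * n + t))
            (Function.update (τ.mem 3) (i * n + (dep q - 1)) b (t * n + (dep q - 1))))) ∧
        (∀ t < n, ∀ d < n, ¬ (Anc n dep par q t ∧ d = dep q - 1) →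
          Function.update (τ.mem 3) (i * n + (dep q - 1)) b (t * n + d) =
            σ.mem 3 (t * n + d)) := by
      intro b hA k1 k2
      refine ⟨fun t ht hAt => ?_, fun t ht d hd hn => ?_⟩
      · rw [update_row (by omega) (by omega)]
        split_ifs with h
        · rw [h.1]; exact ⟨k1, k2⟩
        · exact h2 t (by omega) hAt
      · rw [update_row (by omega) (by omega), if_neg, h2' t ht d hd hn]
        rintro ⟨rfl, h⟩
        exact hn ⟨hA, h⟩
    by_cases c1 : Anc n dep par q i
    · have c1' := hanc.mpr c1
      by_cases c2 : dep i < l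
      · have g13 : τ.mem 13 = σ.mem 13 := h3.1 13 (by simp)
        obtain ⟨k1, k2⟩ := hput (σ.mem 13 i) c1 (fun _ => rfl) (fun h => by omega)
        have g0 := C.reg_n
        have g20 := D.reg_q
        have g24 := D.reg_d
        simp (disch := omega) [RunT, h1, g0, g20, g24, D.reg_l, C.mem_dep, Nat.mod_eq_of_lt, c1', c2,
          c2.not_ge, g13]
        exact ⟨by omega, fun t ht hA => k1 t (by omega) hA, fun t ht d hd hn => k2 t ht d hd
          (fun h => hn h.1 h.2), by simpa using h3⟩
      · rw [RunT, run_ite]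
        refine ⟨fun _ => ?_, fun h => ?_⟩
        swap
        · simp (disch := omega) [h1, D.reg_q, C.reg_n, Nat.mod_eq_of_lt, c1'] at h
        rw [run_ite]
        refine ⟨fun h => ?_, fun _ => ?_⟩
        · simp [h1, D.reg_l, C.mem_dep, c2] at h
        have g19 : τ.mem 19 = σ.mem 19 := h3.1 19 (by simp)
        have g20 : τ.mem 20 = σ.mem 20 := h3.1 20 (by simp)
        have g9 : τ.mem 9 = σ.mem 9 := h3.1 9 (by simp)
        have g23 : τ.reg 23 = σ.reg 23 := h3.2 23 (by simp)
        rw [run_seq]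
        refine (run_leave (σ := τ) hW' D hi h1 (by rwa [g19]) (by rwa [g20, g23])
          (by rwa [g23]) (fun r hr => by rw [g9]; exact hd r hr i hi (by omega))).run ?_
        rintro t υ ht ⟨k1, k2⟩
        have e0 : υ.reg 0 = n := by rw [k2.2 0 (by simp), C.reg_n]
        have e30 : υ.reg 30 = i := by rw [k2.2 30 (by simp), h1]
        have e24 : υ.reg 24 = dep q := by rw [k2.2 24 (by simp), D.reg_d]
        have e3 : υ.mem 3 = τ.mem 3 := k2.1 3 (by simp)
        rw [g19, g9] at k1
        obtain ⟨k3, k4⟩ := hput (υ.reg 31) c1 (fun h => by omega) fun _ => k1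
        have f2 : Frame [3] 30 σ υ := h3.trans (k2.weaken (by simp) (by simp))
        simp (disch := omega) [e0, e30, e24, e3, Nat.mod_eq_of_lt, c1]
        exact ⟨by omega, fun t ht hA => k3 t (by omega) hA, fun t ht d hd hn => k4 t ht d hd
          (fun h => hn h.1 h.2), by simpa using f2⟩
    · have c1' : τ.mem 7 (q * n + i) = 0 := by
        by_contra h
        exact c1 (hanc.mp h)
      have g0 := C.reg_n
      have g20 := D.reg_q
      simp (disch := omega) [RunT, h1, g0, g20, Nat.mod_eq_of_lt, c1']
      refine ⟨by omega, fun t ht hA => ?_, fun t ht d hd hn => h2' t ht d hd fun h => hn h.1 h.2, h3⟩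
      have : t ≠ i := by
        rintro rfl
        exact c1 hA
      exact h2 t (by omega) hA
  · exact fun τ h => ⟨fun t ht => h.2.1 t ht.1 ht, h.2.2⟩
  · simp only [Finset.sum_add_distrib, ← Finset.mul_sum]
    simp
    omega

end

section

variable {w : ℕ} [NeZero w] {ω : ℕ → Bool} {n m : ℕ} {E : ℕ → ℕ → Prop} {s : ℕ} {dep par : ℕ → ℕ}
  {K a q l : ℕ}

/-- The known replacement lengths are correct on the level of landmarks. -/
theorem IsTree.known_eq (T : IsTree n E s dep par) {F D g : ℕ → ℕ} (hq : q < n) (hdq : dep q < n)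
    (hqs : q ≠ s) (hlq : l < dep q + K)
    (R : ∀ r < n, dep r < n → dep r = l → RowSpec n E s dep par K F D r)
    (G : Bell n (Del E par q) (· < n) (srcKey n s) g) {r : ℕ} (hr : r < n) (hdr : dep r = l)
    (hl : l < n) : known n dep par q l D r = g r := by
  unfold known
  split_ifs with h
  · exact (R r hr (by omega) hdr).repl q h hqs (by omega) g G
  · exact (T.repl_eq_dep hq hdq hqs G hr h).symm

/-- A replacement path to a vertex at depth at least `l` splits at its last vertex on level `l`. -/
theorem IsTree.level_min (T : IsTree n E s dep par) {F D g : ℕ → ℕ} (hq : q < n) (hdq : dep q < n)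
    (hqs : q ≠ s) (hql : dep q ≤ l) (hlq : l < dep q + K)
    (R : ∀ r < n, dep r < n → dep r = l → RowSpec n E s dep par K F D r)
    (G : Bell n (Del E par q) (· < n) (srcKey n s) g) {t b : ℕ} (ht : t < n) (hdt : dep t < n)
    (hlt : l ≤ dep t)
    (hb : MinInv n (· ∈ level n dep l n) (· ∈ level n dep l n)
      (fun r => known n dep par q l D r + F (r * n + t)) b) : b = g t := by
  have hmem : ∀ r, r ∈ level n dep l n ↔ r < n ∧ dep r = l := by
    intro r
    simp only [level, Finset.mem_filter, Finset.mem_range]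
    exact ⟨fun h => ⟨h.1, h.2.1⟩, fun h => ⟨h.1, h.2, by omega⟩⟩
  have hF : ∀ r < n, dep r = l → Bell n E (fun v => v < n ∧ l ≤ dep v) (srcKey n r)
      fun v => F (r * n + v) := fun r hr hd => by
    have := (R r hr (by omega) hd).dist
    rwa [hd] at this
  refine hb.eq (G.le_top t ht) (fun r hr => ?_) fun hg => ?_
  · obtain ⟨hr, hd⟩ := (hmem r).mp hr
    rw [T.known_eq hq hdq hqs hlq R G hr hd (by omega)]
    exact T.repl_le_level hq hdq hqs G hql (hF r hr hd) ht hlt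
  · obtain ⟨r, hr, hd, h⟩ := T.exists_level G (fun r v => F (r * n + v)) hF ht hlt hg
    refine ⟨r, (hmem r).mpr ⟨hr, hd⟩, ?_⟩
    rwa [T.known_eq hq hdq hqs hlq R G hr hd (by omega)]

open Classical in
/-- The first sum bounds the search above the level `l`, and the second sum the time spent on the
minima over the level `l`. -/
theorem run_belowEdge {σ : State} (hW : Big n m w) (hKn : K ≤ n) (haK : a < K)
    (T : IsTree n E s dep par) (C : Prepared n m E s dep par K a σ)
    (R : ∀ r < n, dep r < n → dep r % K = a → RowSpec n E s dep par K (σ.mem 9) (σ.mem 10) r)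
    (hrq : σ.reg 20 = q) (hq : q < n) (hdq : dep q < n) (hqs : q ≠ s) :
    RunT w ω belowEdge σ (1000 * n + 500 +
        125 * ∑ t ∈ Finset.range n, (if Anc n dep par q t ∧ dep t < nextLevel K a (dep q) then
          σ.mem 4 t else 0) +
        50 * ∑ t ∈ Finset.range n, (if Anc n dep par q t then
          (level n dep (nextLevel K a (dep q)) n).card else 0)) fun τ =>
      (∀ t, Anc n dep par q t → ∀ g, Bell n (Del E par q) (· < n) (srcKey n s) g →
        τ.mem 3 (t * n + (dep q - 1)) = g t) ∧
      (∀ t < n, ∀ d < n, ¬ (Anc n dep par q t ∧ d = dep q - 1) →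
        τ.mem 3 (t * n + d) = σ.mem 3 (t * n + d)) ∧
      Frame [3, 11, 12, 13, 14, 15, 16, 19, 20] 21 σ τ := by
  have hW' := hW
  unfold Big at hW'
  have hE : ∀ x y, E x y → x < n ∧ y < n := fun x y h => ⟨T.lt _ _ h, T.lt _ _ (T.symm _ _ h)⟩
  have hql : dep q ≤ nextLevel K a (dep q) := le_nextLevel
  have hlq := nextLevel_lt (d := dep q) haK
  have hla := nextLevel_mod (d := dep q) haK
  have hdK : dep q % K < K := Nat.mod_lt _ (by omega)
  have hlev : (Expr.reg 24 + (.reg 4 + .reg 3 - .reg 24 % .reg 3) % .reg 3).eval w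
      ((σ.setReg 24 (dep q)).setReg 21 (par q)) = nextLevel K a (dep q) := by
    have h1 : (a + K - dep q % K) % K < K := Nat.mod_lt _ (by omega)
    simp (disch := omega) only [eval_add, eval_reg, eval_sub, eval_mod, setReg_reg,
      Nat.reduceEqDiff, ↓reduceIte, C.reg_a, C.reg_K, Nat.mod_eq_of_lt (show dep q % K < 2 ^ w by
      omega), Nat.mod_eq_of_lt (show a + K < 2 ^ w by omega),
      Nat.mod_eq_of_lt (show a + K - dep q % K < 2 ^ w by omega),
      Nat.mod_eq_of_lt (show (a + K - dep q % K) % K < 2 ^ w by omega)]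
    exact Nat.mod_eq_of_lt (by omega)
  set l := nextLevel K a (dep q) with hldef
  have R' : ∀ r < n, dep r < n → dep r = l →
      RowSpec n E s dep par K (σ.mem 9) (σ.mem 10) r := fun r hr hd hl =>
    R r hr hd (by rw [hl, hla])
  rw [RunT, belowEdge, run_seq, run_assign, run_seq, run_assign, run_seq, run_assign]
  have e1 : (Expr.get 6 (.reg 20)).eval w σ = dep q := by simp [hrq, C.mem_dep]
  have e2 : (Expr.get 2 (.reg 20)).eval w (σ.setReg 24 (dep q)) = par q := by
    simp [hrq, C.mem_par]
  rw [e1, e2, hlev]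
  set σ1 := ((σ.setReg 24 (dep q)).setReg 21 (par q)).setReg 22 l with hσ1
  have F1 : Frame [] 21 σ σ1 := by simp [hσ1]
  have B1 : Below n m E s dep par K a q l σ1 :=
    ⟨C.of_frame F1 (by simp) (by simp), by simp [hσ1, hrq], by simp [hσ1], by simp [hσ1],
      by simp [hσ1]⟩
  rw [run_seq]
  refine (run_gather hW B1 hq hdq).run ?_
  rintro t2 σ2 ht2 ⟨G2, cnt2, lev2, regs2, mems2⟩
  have m2 : ∀ b, b ≠ 19 → b ≠ 20 → σ2.mem b = σ.mem b := fun b hb hb' => by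
    rw [mems2 b hb hb', hσ1]; rfl
  have F2 : Frame [19, 20] 23 σ1 σ2 :=
    ⟨fun b hb => mems2 b (by rintro rfl; simp at hb) (by rintro rfl; simp at hb),
      fun x hx => regs2 x (by omega) (by omega)⟩
  have B2 : Below n m E s dep par K a q l σ2 :=
    ⟨B1.prep.of_frame F2 (by simp) (by simp), by rw [regs2 20 (by simp) (by simp), B1.reg_q],
      by rw [regs2 21 (by simp) (by simp), B1.reg_p],
      by rw [regs2 22 (by simp) (by simp), B1.reg_l],
      by rw [regs2 24 (by simp) (by simp), B1.reg_d]⟩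
  have e10 : σ1.mem 10 = σ.mem 10 := rfl
  rw [e10] at G2
  have hknown : ∀ x < n, σ2.mem 19 x ≤ n := by
    intro x hx
    rw [G2 x hx, known]
    split_ifs with h1 h2
    · exact (R' x hx h1.2.1 h2).le q h1 hqs (by omega)
    · exact le_rfl
    · exact T.dep_le x hx
  rw [run_seq]
  refine (run_prepNear hW T B2 hq hdq hqs hknown).run ?_
  rintro t3 σ3 ht3 ⟨G3, F3⟩
  have B3 := B2.of_frame F3 (by simp) (by simp)
  have e4 : σ2.mem 4 = σ.mem 4 := m2 4 (by simp) (by simp)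
  rw [e4] at ht3
  rw [run_seq]
  refine (run_bfs (σ := σ3) (E := E) (c := 2 * m) hW B3.prep.reg_n B3.prep.reg_m hE
    B3.prep.adj).run ?_
  rintro t4 σ4 ht4 ⟨G4, F4⟩
  have B4 := B3.of_frame F4 (by simp) (by simp)
  have hsum : ∑ v ∈ (Finset.range n).filter (σ3.mem 11 · ≠ 0), σ3.mem 4 v =
      ∑ t ∈ Finset.range n, if Anc n dep par q t ∧ dep t < l then σ.mem 4 t else 0 := by
    rw [Finset.sum_filter]
    refine Finset.sum_congr rfl fun t ht => ?_
    rw [F3.1 4 (by simp), e4]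
    exact if_congr (G3 t (Finset.mem_range.mp ht)).1 rfl rfl
  rw [hsum] at ht4
  have g9 : σ4.mem 9 = σ.mem 9 := by
    rw [F4.1 9 (by simp), F3.1 9 (by simp), m2 9 (by simp) (by simp)]
  have g19 : σ4.mem 19 = σ2.mem 19 := by rw [F4.1 19 (by simp), F3.1 19 (by simp)]
  have g20 : σ4.mem 20 = σ2.mem 20 := by rw [F4.1 20 (by simp), F3.1 20 (by simp)]
  have g23 : σ4.reg 23 = σ2.reg 23 := by rw [F4.2 23 (by simp), F3.2 23 (by simp)]
  have g3 : σ4.mem 3 = σ.mem 3 := by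
    rw [F4.1 3 (by simp), F3.1 3 (by simp), m2 3 (by simp) (by simp)]
  refine (run_output (σ := σ4) hW B4 hq hdq (by rwa [g19]) (by rwa [g20, g23]) (by rwa [g23])
    (fun r hr t ht hlt => ?_)).run ?_
  · simp only [level, Finset.mem_filter, Finset.mem_range] at hr
    rw [g9]
    exact (R' r hr.1 hr.2.2 hr.2.1).dist.le_top t ⟨ht, by omega⟩
  rintro t5 σ5 ht5 ⟨G5, H5, F5⟩
  refine ⟨by simp; omega, fun t hA g hg => ?_, ?_, ?_⟩
  · rcases lt_or_ge (dep t) l with h | h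
    · rw [(G5 t hA).1 h]
      refine T.repl_near hq hdq hqs hg (l := l)
        (G := known n dep par q l (σ.mem 10)) (key := σ3.mem 12) ?_ ?_ ?_ ?_ ?_ ?_ hA h
      · exact fun x _ hx => if_neg hx
      · exact fun x hx hxA hd => T.known_eq hq hdq hqs hlq R' hg hx hd
          (by have := hxA.2.1; omega)
      · intro x hx hxA hd
        rw [known, if_pos hxA, if_neg hd]
      · intro x hx hd y hy
        rw [← G2 y (T.lt _ _ hy.1)]
        exact ((G3 x hx.1).2 hx hd).le_of y hy
      · intro x hx hd
        rcases ((G3 x hx.1).2 hx hd).mem with h1 | ⟨y, hy, h1⟩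
        · exact .inl h1.ge
        · refine .inr ⟨y, hy, ?_⟩
          rw [← G2 y (T.lt _ _ hy.1)]
          exact h1.ge
      · refine G4.congr (fun v => ?_) (fun _ _ => rfl) fun _ _ => rfl
        exact ⟨fun hv => (G3 v hv.1).1.mp hv.2, fun hv => ⟨hv.1.1, (G3 v hv.1.1).1.mpr hv⟩⟩
    · have h1 := (G5 t hA).2 h
      rw [g19, g9] at h1
      refine T.level_min hq hdq hqs hql hlq R' hg hA.1 hA.2.1 h ⟨h1.le, fun r hr => ?_, ?_⟩
      · rw [← G2 r (Finset.mem_range.mp (Finset.mem_filter.mp hr).1)]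
        exact h1.le_of r hr
      · rcases h1.mem with h2 | ⟨r, hr, h2⟩
        · exact .inl h2
        · refine .inr ⟨r, hr, ?_⟩
          rw [← G2 r (Finset.mem_range.mp (Finset.mem_filter.mp hr).1)]
          exact h2
  · rw [← g3]; exact H5
  · have G : ∀ {M : List ℕ} {k : ℕ} {σ τ : State}, Frame M k σ τ →
        M ⊆ [3, 11, 12, 13, 14, 15, 16, 19, 20] → 21 ≤ k →
        Frame [3, 11, 12, 13, 14, 15, 16, 19, 20] 21 σ τ := fun h h1 h2 => h.weaken h1 h2
    exact (G F1 (by simp) (by simp)).trans <| (G F2 (by simp) (by simp)).trans <|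
      (G F3 (by simp) (by simp)).trans <| (G F4 (by simp) (by simp)).trans
      (G F5 (by simp) (by simp))

end

/-! ### The replacement paths of all tree edges -/

/-- Treat the edges from all reachable vertices other than the source to their parents. -/
def belowEdges : Cmd :=
  forTo 20 (.reg 0) <| .ite ((Expr.get 6 (.reg 20)).less (.reg 0))
    (.ite ((Expr.get 6 (.reg 20)).same (.lit 0)) .skip belowEdge) .skip

section

variable {n m : ℕ} {E : ℕ → ℕ → Prop} {s : ℕ} {dep par : ℕ → ℕ} {K a : ℕ}

open Classical in
/-- A vertex has at most `K` ancestors for which it lies before the next level of landmarks. -/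
theorem IsTree.card_near (T : IsTree n E s dep par) (haK : a < K) (t : ℕ) :
    ((Finset.range n).filter fun q => Anc n dep par q t ∧ dep t < nextLevel K a (dep q)).card ≤
      K := by
  have h : ((Finset.range n).filter fun q => Anc n dep par q t ∧
      dep t < nextLevel K a (dep q)).card ≤ (Finset.Ico (dep t + 1 - K) (dep t + 1)).card := by
    refine Finset.card_le_card_of_injOn dep (fun q hq => ?_) fun q hq q' hq' h => ?_
    · simp only [Finset.coe_filter, Set.mem_ofPred_eq] at hq
      have h1 := (T.anc_lt hq.2.1).2
      have h2 := nextLevel_lt (d := dep q) haK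
      simp only [Finset.coe_Ico, Set.mem_Ico]
      omega
    · simp only [Finset.coe_filter, Set.mem_ofPred_eq] at hq hq'
      exact T.anc_unique hq.2.1 hq'.2.1 h
  rw [Nat.card_Ico] at h
  omega

open Classical in
theorem IsTree.sum_near (T : IsTree n E s dep par) (haK : a < K) (f : ℕ → ℕ) :
    ∑ q ∈ Finset.range n, ∑ t ∈ Finset.range n,
      (if Anc n dep par q t ∧ dep t < nextLevel K a (dep q) then f t else 0) ≤
      K * ∑ t ∈ Finset.range n, f t := by
  rw [Finset.sum_comm, Finset.mul_sum]
  refine Finset.sum_le_sum fun t _ => ?_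
  rw [← Finset.sum_filter, Finset.sum_const, smul_eq_mul]
  exact Nat.mul_le_mul_right _ (T.card_near haK t)

/-- Each level of landmarks is the next one for at most `K` depths. -/
theorem sum_level_le (haK : a < K) :
    ∑ d ∈ Finset.range n, (level n dep (nextLevel K a d) n).card ≤
      K * (landmarks n dep K a n).card := by
  simp only [level, landmarks, Finset.card_filter]
  rw [Finset.sum_comm, Finset.mul_sum]
  refine Finset.sum_le_sum fun r _ => ?_
  split_ifs with h
  · rw [← Finset.card_filter]
    have h1 : ((Finset.range n).filter fun d => dep r = nextLevel K a d ∧ dep r < n).card ≤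
        (Finset.Ico (dep r + 1 - K) (dep r + 1)).card := by
      refine Finset.card_le_card fun d hd => ?_
      simp only [Finset.mem_filter] at hd
      have h2 := nextLevel_lt (d := d) haK
      have h3 := le_nextLevel (K := K) (a := a) (d := d)
      simp only [Finset.mem_Ico]
      omega
    rw [Nat.card_Ico] at h1
    omega
  · rw [mul_zero, Nat.le_zero]
    refine Finset.sum_eq_zero fun d _ => if_neg fun h' => h ⟨h'.2, ?_⟩
    rw [h'.1, nextLevel_mod haK]

open Classical in
/-- The ancestors of a vertex have distinct depths. -/
theorem IsTree.sum_far (T : IsTree n E s dep par) (c : ℕ → ℕ) :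
    ∑ q ∈ Finset.range n, ∑ t ∈ Finset.range n, (if Anc n dep par q t then c (dep q) else 0) ≤
      n * ∑ d ∈ Finset.range n, c d := by
  rw [Finset.sum_comm]
  have h : ∀ t ∈ Finset.range n,
      ∑ q ∈ Finset.range n, (if Anc n dep par q t then c (dep q) else 0) ≤
        ∑ d ∈ Finset.range n, c d := by
    intro t _
    rw [← Finset.sum_filter]
    have hinj : Set.InjOn dep ((Finset.range n).filter fun q => Anc n dep par q t) := by
      intro q hq q' hq' h
      simp only [Finset.coe_filter, Set.mem_ofPred_eq] at hq hq'
      exact T.anc_unique hq.2 hq'.2 h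
    rw [← Finset.sum_image (f := c) hinj]
    refine Finset.sum_le_sum_of_subset fun d hd => ?_
    simp only [Finset.mem_image, Finset.mem_filter] at hd
    obtain ⟨q, ⟨-, hq⟩, rfl⟩ := hd
    exact Finset.mem_range.mpr ((T.anc_lt hq).2.trans_lt hq.2.1)
  simpa using Finset.sum_le_sum h

variable {w : ℕ} [NeZero w] {ω : ℕ → Bool}

theorem run_belowEdges {σ : State} (hW : Big n m w) (hKn : K ≤ n) (haK : a < K)
    (T : IsTree n E s dep par) (C : Prepared n m E s dep par K a σ)
    (hcard : K * (landmarks n dep K a n).card ≤ n)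
    (R : ∀ r < n, dep r < n → dep r % K = a → RowSpec n E s dep par K (σ.mem 9) (σ.mem 10) r) :
    RunT w ω belowEdges σ (1050 * (n * n) + 600 * n + 10 + 250 * (K * m)) fun τ =>
      (∀ q < n, dep q < n → q ≠ s → ∀ t, Anc n dep par q t → ∀ g,
        Bell n (Del E par q) (· < n) (srcKey n s) g → τ.mem 3 (t * n + (dep q - 1)) = g t) ∧
      Frame [3, 11, 12, 13, 14, 15, 16, 19, 20] 20 σ τ := by
  classical
  have hW' := hW
  unfold Big at hW'
  refine RunT.forTo_sum (N := n) (fun i τ => τ.reg 20 = i ∧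
    (∀ q < i, dep q < n → q ≠ s → ∀ t, Anc n dep par q t → ∀ g,
      Bell n (Del E par q) (· < n) (srcKey n s) g → τ.mem 3 (t * n + (dep q - 1)) = g t) ∧
    Frame [3, 11, 12, 13, 14, 15, 16, 19, 20] 20 σ τ)
    (fun q => 20 + (1000 * n + 500 +
        125 * ∑ t ∈ Finset.range n, (if Anc n dep par q t ∧ dep t < nextLevel K a (dep q) then
          σ.mem 4 t else 0) +
        50 * ∑ t ∈ Finset.range n, (if Anc n dep par q t then
          (level n dep (nextLevel K a (dep q)) n).card else 0))) (by omega) ?_ ?_ ?_ ?_ ?_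
  · simp
  · rintro i τ - ⟨h1, -, h3⟩
    exact ⟨h1, by simp [h3.2, C.reg_n]⟩
  · rintro i τ hi ⟨h1, h2, h3⟩
    have D := C.of_frame h3 (by simp) (by simp)
    have hskip : (dep i < n → i = s) → ∀ q < i + 1, dep q < n → q ≠ s → ∀ t, Anc n dep par q t →
        ∀ g, Bell n (Del E par q) (· < n) (srcKey n s) g →
          τ.mem 3 (t * n + (dep q - 1)) = g t := by
      intro h q hq hd hs
      rcases Nat.lt_succ_iff_lt_or_eq.mp hq with hq | rfl
      · exact h2 q hq hd hs
      · exact (hs (h hd)).elim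
    rw [RunT, run_ite]
    refine ⟨fun c1 => ?_, fun c1 => ?_⟩
    · have hd : dep i < n := by
        by_contra h
        apply c1
        simp [h1, D.mem_dep, D.reg_n]
        omega
      rw [run_ite]
      refine ⟨fun c2 => ?_, fun c2 => ?_⟩
      · have hds : dep i = 0 := by
          by_contra h
          apply c2
          simp [h1, D.mem_dep, h]
        rw [run_skip]
        exact ⟨by simp; omega, h1, by simp, hskip fun _ => T.eq_s i hi hds, by simpa using h3⟩
      · have hs : i ≠ s := by
          rintro rfl
          simp [h1, D.mem_dep, T.dep_s] at c2
        have hdep0 : ∀ q < n, q ≠ s → dep q ≠ 0 := fun q hq hqs h => hqs (T.eq_s q hq h)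
        refine (run_belowEdge hW hKn haK T D (by
          rwa [h3.1 9 (by simp), h3.1 10 (by simp)]) h1 hi hd hs).run ?_
        rintro t υ ht ⟨k1, k2, k3⟩
        rw [h3.1 4 (by simp)] at ht
        refine ⟨by simp; omega, by rw [k3.2 20 (by simp), h1], by simp,
          fun q hq hdq hqs t hA g hg => ?_, ?_⟩
        · simp only [setReg_mem]
          rcases Nat.lt_succ_iff_lt_or_eq.mp hq with hq | rfl
          -- two ancestors of `t` with the same depth coincide, so no entry is written twice
          · rw [k2 t hA.1 _ (by omega), h2 q hq hdq hqs t hA g hg]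
            rintro ⟨hA', he⟩
            have d1 := hdep0 q (by omega) hqs
            have d2 := hdep0 i hi hs
            have := T.anc_unique hA hA' (by omega)
            omega
          · exact k1 t hA g hg
        · rw [frame_setReg le_rfl]
          exact h3.trans (k3.weaken (List.Subset.refl _) (by simp))
    · have hd : ¬ dep i < n := by
        simp [h1, D.mem_dep, D.reg_n] at c1
        omega
      rw [run_skip]
      exact ⟨by simp; omega, h1, by simp, hskip fun h => (hd h).elim, by simpa using h3⟩
  · exact fun τ h => h.2
  · have h1 := T.sum_near haK (σ.mem 4)
    rw [C.adj.sum] at h1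
    have h2 := T.sum_far fun d => (level n dep (nextLevel K a d) n).card
    have h3 := (sum_level_le (n := n) (dep := dep) haK).trans hcard
    have h4 := Nat.mul_le_mul_left n h3
    have h5 : K * (2 * m) = 2 * (K * m) := by ring
    have h6 : n * (1000 * n) = 1000 * (n * n) := by ring
    simp only [Finset.sum_add_distrib, ← Finset.mul_sum, Finset.sum_const, Finset.card_range,
      smul_eq_mul, cost_reg]
    omega

end

/-! ### The program -/

/-- Build the adjacency lists, a breadth-first tree, its ancestor relation and lowest common
ancestors, and choose the levels of landmarks. -/
def prepare : Cmd :=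
  .seq buildAdj <| .seq (.assign 30 (.reg 2)) <| .seq (.assign 31 (.lit 0)) <|
  .seq searchFrom <| .seq copyDist <| .seq buildPar <| .seq buildAnc <| .seq buildLca <|
  .seq buildSqrt buildOffset

/-- A deterministic program for the single source replacement path problem. Registers `0` to `4` hold
`n`, `m`, the source, `K` and `a`. Array `2` holds the parents and array `3` the output, arrays `4`
and `5` the adjacency lists, array `6` the depths, arrays `7` and `8` the ancestor relation and the
lowest common ancestors, and arrays `9` and `10` the distances and the replacement lengths of the
landmarks; the other arrays are auxiliary. -/
def solver : Cmd := .seq prepare (.seq landmarkRows belowEdges)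

section

variable {w : ℕ} [NeZero w] {ω : ℕ → Bool} {n m : ℕ} {E : ℕ → ℕ → Prop} {s : ℕ}

theorem run_prepare {σ : State} (hW : Big n m w) (hn : σ.reg 0 = n) (hm : σ.reg 1 = m)
    (hs : σ.reg 2 = s) (hsn : s < n)
    (hE : ∀ x y, E x y ↔ ∃ j < m, (σ.mem 0 j = x ∧ σ.mem 1 j = y) ∨ (σ.mem 1 j = x ∧ σ.mem 0 j = y))
    (hlt : ∀ x y, E x y → x < n ∧ y < n ∧ x ≠ y) (h4 : ∀ v, σ.mem 4 v = 0)
    (h7 : ∀ v, σ.mem 7 v = 0) :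
    RunT w ω prepare σ (200 * (n * n) + 1100 * n + 350 * m + 600) fun τ =>
      ∃ K a dep par, Prepared n m E s dep par K a τ ∧ IsTree n E s dep par ∧
        Bell n E (· < n) (srcKey n s) dep ∧ (∀ v < n, v = s ∨ dep v = n → par v = n) ∧
        1 ≤ K ∧ K ≤ n ∧ n ≤ K * K ∧ (K - 1) * (K - 1) < n ∧ a < K ∧
        K * (landmarks n dep K a n).card ≤ n := by
  have hE' : ∀ x y, E x y → x < n ∧ y < n := fun x y h => ⟨(hlt x y h).1, (hlt x y h).2.1⟩
  rw [RunT, prepare, run_seq]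
  refine (run_buildAdj hW hm hE hlt h4).run ?_
  rintro t1 σ1 ht1 ⟨A1, F1⟩
  rw [run_seq, run_assign, run_seq, run_assign, run_seq]
  set σ2 := (σ1.setReg 30 ((Expr.reg 2).eval w σ1)).setReg 31
    ((Expr.lit 0).eval w (σ1.setReg 30 ((Expr.reg 2).eval w σ1))) with hσ2
  have F2 : Frame [4, 5] 10 σ σ2 := by simpa [hσ2] using F1
  have r0 : σ2.reg 0 = n := by rw [F2.2 0 (by simp), hn]
  have r1 : σ2.reg 1 = m := by rw [F2.2 1 (by simp), hm]
  refine (run_searchFrom (σ := σ2) (r := s) (l := 0) hW r0 r1 (by simp [hσ2, F1.2, hs])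
    (by simp [hσ2]) hsn hE' A1).run ?_
  rintro t3 σ3 ht3 ⟨B3, F3⟩
  rw [run_seq]
  refine (run_copyDist (σ := σ3) hW (by rw [F3.2 0 (by simp), r0])).run ?_
  rintro t4 σ4 ht4 ⟨R4, F4⟩
  have B4 : Bell n E (· < n) (srcKey n s) (σ4.mem 6) :=
    B3.congr (fun v => by simp) (fun _ _ => rfl) fun v hv => (R4 v hv.1).symm
  have m4 : ∀ b, b < 11 → b ≠ 4 → b ≠ 5 → b ≠ 6 → σ4.mem b = σ.mem b := by
    intro b h1 h2 h3 h4
    rw [F4.1 b (by simp [h4]), F3.1 b (by simp; omega), F2.1 b (by simp [h2, h3])]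
  have r4 : ∀ x < 10, σ4.reg x = σ.reg x := by
    intro x hx
    rw [F4.2 x (by omega), F3.2 x (by omega), F2.2 x hx]
  rw [run_seq]
  refine (run_buildPar (σ := σ4) (E := E) (s := s) hW (by rw [r4 0 (by simp), hn])
    (by rw [r4 1 (by simp), hm]) hsn (by
      rwa [m4 0 (by simp) (by simp) (by simp) (by simp),
        m4 1 (by simp) (by simp) (by simp) (by simp)]) hE' B4).run ?_
  rintro t5 σ5 ht5 ⟨T5, P5, F5⟩
  set dep := σ4.mem 6 with hdep
  set par := σ5.mem 2 with hpar
  have e56 : σ5.mem 6 = dep := by rw [F5.1 6 (by simp)]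
  rw [run_seq]
  refine (run_buildAnc (σ := σ5) (E := E) (s := s) hW (by rw [F5.2 0 (by simp), r4 0 (by simp), hn])
    (by rwa [e56]) (by
      rw [F5.1 7 (by simp), m4 7 (by simp) (by simp) (by simp) (by simp)]
      exact h7)).run ?_
  rintro t6 σ6 ht6 ⟨A6, F6⟩
  have e66 : σ6.mem 6 = dep := by rw [F6.1 6 (by simp), e56]
  have e62 : σ6.mem 2 = par := by rw [F6.1 2 (by simp)]
  rw [e56] at A6
  have hparn : ∀ v < n, par v ≤ n := by
    intro v hv
    by_cases h : v = s ∨ dep v = n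
    · exact (P5 v hv h).le
    · have := T5.dep_le v hv
      exact (T5.par_lt hv (by omega) (by tauto)).le
  rw [run_seq]
  refine (run_buildLca (σ := σ6) (E := E) (s := s) hW
    (by rw [F6.2 0 (by simp), F5.2 0 (by simp), r4 0 (by simp), hn])
    (by rwa [e66, e62]) (by rwa [e62]) (by rwa [e66, e62])).run ?_
  rintro t7 σ7 ht7 ⟨L7, F7⟩
  rw [e66, e62] at L7
  have r7 : ∀ x < 10, σ7.reg x = σ.reg x := by
    intro x hx
    rw [F7.2 x (by omega), F6.2 x (by omega), F5.2 x (by omega), r4 x hx]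
  rw [run_seq]
  refine (run_buildSqrt (σ := σ7) hW (by rw [r7 0 (by simp), hn]) (by omega)).run ?_
  rintro t8 σ8 ht8 ⟨K1, K2, K3, F8⟩
  set K := σ8.reg 3 with hK
  have hKn : K ≤ n := by
    have := Nat.le_mul_self (K - 1)
    omega
  have e86 : σ8.mem 6 = dep := by rw [F8.1 6 (by simp), F7.1 6 (by simp), e66]
  refine (run_buildOffset (σ := σ8) hW (by rw [F8.2 0 (by simp), r7 0 (by simp), hn]) hK.symm K1 hKn
    (by rw [e86]; exact T5.dep_le)).run ?_
  rintro t9 σ9 ht9 ⟨A9, C9, F9⟩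
  rw [e86] at C9
  have hK9 : K * (60 * n + 60) ≤ n * (60 * n + 60) := Nat.mul_le_mul_right _ hKn
  have hK9' : n * (60 * n + 60) = 60 * (n * n) + 60 * n := by ring
  have m9 : ∀ b, b ≠ 8 → σ9.mem b = σ6.mem b := fun b hb => by
    rw [F9.1 b (by simp), F8.1 b (by simp), F7.1 b (by simp [hb])]
  have m9' : ∀ b, b ≠ 2 → b ≠ 7 → b ≠ 8 → σ9.mem b = σ4.mem b := fun b h1 h2 h3 => by
    rw [m9 b h3, F6.1 b (by simp [h2]), F5.1 b (by simp [h1])]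
  refine ⟨by simp; omega, K, σ9.reg 4, dep, par, ⟨?_, ?_, ?_, rfl, ?_, ?_, ?_, ?_, ?_, ?_⟩, T5, B4, P5,
    K1, hKn, K2, K3, A9, C9⟩
  · rw [F9.2 0 (by simp), F8.2 0 (by simp), r7 0 (by simp), hn]
  · rw [F9.2 1 (by simp), F8.2 1 (by simp), r7 1 (by simp), hm]
  · rw [F9.2 3 (by simp)]
  · rw [m9 6 (by simp), e66]
  · rw [m9 2 (by simp), e62]
  · rwa [m9' 0 (by simp) (by simp) (by simp), m9' 1 (by simp) (by simp) (by simp),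
      m4 0 (by simp) (by simp) (by simp) (by simp), m4 1 (by simp) (by simp) (by simp) (by simp)]
  · rw [m9' 4 (by simp) (by simp) (by simp), m9' 5 (by simp) (by simp) (by simp),
      F4.1 4 (by simp), F4.1 5 (by simp), F3.1 4 (by simp), F3.1 5 (by simp)]
    exact A1
  · rw [m9 7 (by simp)]
    exact A6
  · rw [F9.1 8 (by simp), F8.1 8 (by simp)]
    exact L7

/-- The running time in terms of the number `L` of landmarks. -/
theorem time_le {n m K L : ℕ} (hK1 : 1 ≤ K) (hn2 : n ≤ K * K) (hK2 : (K - 1) * (K - 1) < n)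
    (hL : K * L ≤ n) :
    200 * (n * n) + 1100 * n + 350 * m + 600 + (40 * n + 10 + L * landmarkTime n m K) +
      (1050 * (n * n) + 600 * n + 10 + 250 * (K * m)) + 2 ≤ 7000 * (n * n) + 1100 * (K * m) := by
  have hKK : K * K ≤ 2 * n := by
    obtain ⟨k, rfl⟩ : ∃ k, K = k + 1 := ⟨K - 1, by omega⟩
    simp only [Nat.add_sub_cancel] at hK2
    have : (k : ℤ) * k < n := by exact_mod_cast hK2
    zify
    nlinarith [sq_nonneg ((k : ℤ) - 1)]
  -- `K * L ≤ n ≤ K * K`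
  have hLK : L ≤ K := Nat.le_of_mul_le_mul_left (hL.trans hn2) hK1
  have hLn : L ≤ n := (Nat.le_mul_of_pos_left L hK1).trans hL
  have hnn : n ≤ n * n := Nat.le_mul_self n
  have h1 : L * n ≤ n * n := Nat.mul_le_mul_right _ hLn
  have h2 : L * m ≤ K * m := Nat.mul_le_mul_right _ hLK
  have h3 : m ≤ K * m := Nat.le_mul_of_pos_left m hK1
  have h4 : (K + 1) * ((K + 1) * (K + 1)) ≤ (2 * K) * ((2 * K) * (2 * K)) := by gcongr <;> omega
  have h5 : L * ((K + 1) * ((K + 1) * (K + 1))) ≤ 16 * (n * n) := calc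
    _ ≤ L * ((2 * K) * ((2 * K) * (2 * K))) := Nat.mul_le_mul_left _ h4
    _ = 8 * ((K * L) * (K * K)) := by ring
    _ ≤ 8 * (n * (2 * n)) := by gcongr
    _ = 16 * (n * n) := by ring
  have h6 : L * landmarkTime n m K = 1300 * (L * n) + 500 * (L * m) +
      60 * (L * ((K + 1) * ((K + 1) * (K + 1)))) + 40 * (K * L) + 1000 * L := by
    unfold landmarkTime
    ring
  omega

/-- The program solves the problem in time `O(m √n + n²)`. -/
theorem run_solver {σ : State} {G : SimpleGraph (Fin n)} {src : Fin n} (hW : Big n m w)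
    (hn : σ.reg 0 = n) (hm : σ.reg 1 = m) (hs : σ.reg 2 = src)
    (hE : ∀ x y, adjNat G x y ↔
      ∃ j < m, (σ.mem 0 j = x ∧ σ.mem 1 j = y) ∨ (σ.mem 1 j = x ∧ σ.mem 0 j = y))
    (h4 : ∀ v, σ.mem 4 v = 0) (h7 : ∀ v, σ.mem 7 v = 0) :
    Run w ω solver σ fun t τ => (t : ℝ) ≤ 7000 * (m * √n + (n : ℝ) ^ 2) ∧
      Solves G src (τ.mem 2) (τ.mem 3) := by
  have hpos : 1 ≤ n := by have := src.2; omega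
  have hlt : ∀ x y, adjNat G x y → x < n ∧ y < n ∧ x ≠ y := by
    rintro x y ⟨hx, hy, h⟩
    exact ⟨hx, hy, fun hxy => h.ne (Fin.ext hxy)⟩
  rw [solver, run_seq]
  refine (run_prepare hW hn hm hs src.2 hE hlt h4 h7).run ?_
  rintro t1 σ1 ht1 ⟨K, a, dep, par, C1, T, B, hpar, hK1, hKn, hn2, hK2, haK, hL⟩
  rw [run_seq]
  refine (run_landmarkRows hW hKn T C1).run ?_
  rintro t2 σ2 ht2 ⟨R2, F2⟩
  have C2 := C1.of_frame F2 (by simp) (by simp)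
  refine (run_belowEdges hW hKn haK T C2 hL R2).run ?_
  rintro t3 σ3 ht3 ⟨H3, F3⟩
  have C3 := C2.of_frame F3 (by simp) (by simp)
  refine ⟨?_, ?_⟩
  · have ht : t1 + (t2 + t3 + 1) + 1 ≤ 7000 * (n * n) + 1100 * (K * m) := by
      have := time_le (m := m) hK1 hn2 hK2 hL
      omega
    have hK : (K : ℝ) ≤ 2 * √n := by
      have h1 : ((K : ℝ) - 1) ^ 2 ≤ n := by
        have h2 : ((K - 1 : ℕ) : ℝ) = (K : ℝ) - 1 := by
          rw [Nat.cast_sub hK1, Nat.cast_one]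
        rw [← h2]
        exact_mod_cast (by rw [sq]; exact hK2.le : (K - 1) ^ 2 ≤ n)
      have h2 : (K : ℝ) - 1 ≤ √n := Real.le_sqrt_of_sq_le h1
      have h3 : 1 ≤ √(n : ℝ) := Real.one_le_sqrt.mpr (by exact_mod_cast hpos)
      linarith
    have ht' : ((t1 + (t2 + t3 + 1) + 1 : ℕ) : ℝ) ≤ 7000 * (n * n) + 1100 * (K * m) := by
      exact_mod_cast ht
    have hm0 : (0 : ℝ) ≤ m := Nat.cast_nonneg m
    have h1 : (K : ℝ) * m ≤ 2 * √n * m := mul_le_mul_of_nonneg_right hK hm0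
    have h2 : 0 ≤ √(n : ℝ) * m := by positivity
    nlinarith
  · rw [C3.mem_par]
    exact solves_of_tree T B hpar H3

end

/-- Words of eight times the length of `n` suffice. -/
theorem big_of_size {n m : ℕ} (hn : 1 ≤ n) (hm : m ≤ n * n) : Big n m (8 * n.size) := by
  unfold Big
  have h1 : n + 1 ≤ 2 ^ n.size := Nat.lt_size_self n
  rw [mul_comm 8 n.size, pow_mul]
  have h2 : (n + 1) ^ 8 ≤ (2 ^ n.size) ^ 8 := Nat.pow_le_pow_left h1 8
  refine lt_of_lt_of_le ?_ h2
  have h3 : n * m ≤ n * (n * n) := Nat.mul_le_mul_left _ hm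
  have h4 : 32 * (n + 1) ^ 3 ≤ (n + 1) ^ 8 := by
    have h5 : 2 ^ 5 ≤ (n + 1) ^ 5 := Nat.pow_le_pow_left (by omega) 5
    calc 32 * (n + 1) ^ 3 ≤ (n + 1) ^ 5 * (n + 1) ^ 3 := Nat.mul_le_mul_right _ h5
      _ = (n + 1) ^ 8 := by ring
  have h5 : (n + 1) ^ 3 = n * (n * n) + 3 * (n * n) + 3 * n + 1 := by ring
  omega

/-- The input lists the adjacent pairs. -/
theorem adjNat_iff_of_listsEdges {n m : ℕ} {G : SimpleGraph (Fin n)} {u v : Fin m → Fin n}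
    (h : ListsEdges G u v) (src : Fin n) (x y : ℕ) :
    adjNat G x y ↔ ∃ j < m,
      ((input u v src).mem 0 j = x ∧ (input u v src).mem 1 j = y) ∨
      ((input u v src).mem 1 j = x ∧ (input u v src).mem 0 j = y) := by
  have key : ∀ a b : Fin n, G.Adj a b ↔ ∃ j, s(u j, v j) = s(a, b) := by
    intro a b
    rw [← SimpleGraph.mem_edgeSet, ← h.2, Set.mem_range]
  constructor
  · rintro ⟨hx, hy, hxy⟩
    obtain ⟨j, hj⟩ := (key _ _).mp hxy
    refine ⟨j, j.2, ?_⟩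
    rcases Sym2.eq_iff.mp hj with ⟨h1, h2⟩ | ⟨h1, h2⟩
    · exact .inl (by simp [input, h1, h2])
    · exact .inr (by simp [input, h1, h2])
  · rintro ⟨j, hj, h1⟩
    simp only [input, hj, ↓reduceDIte, ↓reduceIte, one_ne_zero] at h1
    rcases h1 with ⟨rfl, rfl⟩ | ⟨rfl, rfl⟩
    · exact ⟨(u _).2, (v _).2, (key _ _).mpr ⟨⟨j, hj⟩, rfl⟩⟩
    · exact ⟨(v _).2, (u _).2, (key _ _).mpr ⟨⟨j, hj⟩, Sym2.eq_swap⟩⟩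

instance : MeasureTheory.IsProbabilityMeasure coins := by
  unfold coins
  infer_instance

end SSRP

theorem mainTheorem2 (c : ℕ) :
    ∃ (p : RAM.Cmd) (κ k : ℕ) (C : ℝ), 2 ≤ κ ∧
      ∀ (n m : ℕ) (G : SimpleGraph (Fin n)) (src : Fin n) (u v : Fin m → Fin n),
        SSRP.ListsEdges G u v →
          (∀ ω : ℕ → Bool, ∃ (t : ℕ) (τ : RAM.State),
            RAM.Exec (κ * n.size) ω p (SSRP.input u v src) t τ ∧
              (t : ℝ) ≤ C * (m * Real.sqrt n + (n : ℝ) ^ 2) * (1 + Real.log n) ^ k) ∧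
          1 - 1 / (n : ℝ) ^ c ≤
            RAM.coins.real {ω : ℕ → Bool | ∃ (t : ℕ) (τ : RAM.State),
              RAM.Exec (κ * n.size) ω p (SSRP.input u v src) t τ ∧
                SSRP.Solves G src (τ.mem 2) (τ.mem 3)} := by
  refine ⟨SSRP.solver, 8, 0, 7000, by norm_num, fun n m G src u v h => ?_⟩
  have hpos : 1 ≤ n := by have := src.2; omega
  have hm : m ≤ n * n := by
    have h1 : Function.Injective fun j => (u j, v j) := fun i j hij => h.1 (by
      rw [Prod.mk.injEq] at hij
      simp only [hij.1, hij.2])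
    simpa using Fintype.card_le_of_injective _ h1
  have hW := SSRP.big_of_size hpos hm
  have : NeZero (8 * n.size) := ⟨by
    have := Nat.size_pos.mpr hpos
    omega⟩
  have hrun : ∀ ω : ℕ → Bool, ∃ (t : ℕ) (τ : RAM.State),
      RAM.Exec (8 * n.size) ω SSRP.solver (SSRP.input u v src) t τ ∧
        (t : ℝ) ≤ 7000 * (m * Real.sqrt n + (n : ℝ) ^ 2) ∧
          SSRP.Solves G src (τ.mem 2) (τ.mem 3) := fun ω =>
    SSRP.run_solver (ω := ω) hW (by simp [SSRP.input]) (by simp [SSRP.input])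
      (by simp [SSRP.input]) (SSRP.adjNat_iff_of_listsEdges h src) (by simp [SSRP.input])
      (by simp [SSRP.input])
  refine ⟨fun ω => ?_, ?_⟩
  · obtain ⟨t, τ, h1, h2, -⟩ := hrun ω
    exact ⟨t, τ, h1, by simpa using h2⟩
  · have huniv : {ω : ℕ → Bool | ∃ (t : ℕ) (τ : RAM.State),
        RAM.Exec (8 * n.size) ω SSRP.solver (SSRP.input u v src) t τ ∧
          SSRP.Solves G src (τ.mem 2) (τ.mem 3)} = Set.univ :=
      Set.eq_univ_of_forall fun ω => by
        obtain ⟨t, τ, h1, -, h3⟩ := hrun ω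
        exact ⟨t, τ, h1, h3⟩
    rw [huniv, MeasureTheory.probReal_univ]
    have : 0 ≤ 1 / (n : ℝ) ^ c := by positivity
    linarith
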